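/- Let $d,N\in\mathbb N$ and $1<p<\infty$. Write points of $(\mathbb R^d)^N$ as $X=(x_1,\dots,x_N)$. A probability measure $\mu$ on $(\mathbb R^d)^N$ belongs to $\mathcal P^{1,p}((\mathbb R^d)^N)$ if it is absolutely continuous with respect to the Lebesgue measure $\mathcal L$ and $(d\mu/d\mathcal L)^{1/p}\in W^{1,p}((\mathbb R^d)^N)$; for $\mu,\nu\in\mathcal P^{1,p}((\mathbb R^d)^N)$ put $$d^{1,p}(\mu,\nu)=\left\|\Big(\frac{d\mu}{d\mathcal L}\Big)^{1/p}-\Big(\frac{d\nu}{d\mathcal L}\Big)^{1/p}\right\|_{W^{1,p}},\qquad \|u\|_{W^{1,p}}^p=\int|u|^p+\sum_{i=1}^{dN}\int|\partial_i u|^p .$$ For $\varepsilon>0$ let $\eta^\varepsilon(z)=(2\pi\varepsilon)^{-d/2}\exp(-|z|^2/(2\varepsilon))$ on $\mathbb R^d$. For a probability measure $\mu$ on $(\mathbb R^d)^N$ with marginals $\mu_1,\dots,\mu_N$ on $\mathbb R^d$, let $\Lambda^\varepsilon[\mu]$ be the measure with density $Y\mapsto\int\prod_{k=1}^N\eta^\varepsilon(y_k-x_k)\,d\mu(X)$,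 and let $\Theta^\varepsilon[\mu]$ be the measure defined by $$\int\psi\,d\Theta^\varepsilon[\mu]=\iint\psi(X)\prod_{k=1}^N\frac{\eta^\varepsilon(y_k-x_k)}{(\mu_k*\eta^\varepsilon)(y_k)}\,d\mu_1(x_1)\cdots d\mu_N(x_N)\,d\Lambda^\varepsilon[\mu](Y)$$ for every bounded continuous $\psi$, where $(\mu_k*\eta^\varepsilon)(y)=\int\eta^\varepsilon(y-x)\,d\mu_k(x)$. **Theorem.** Let $\mu\in\mathcal P^{1,p}((\mathbb R^d)^N)$ with $p>1$. Then $\Theta^\varepsilon[\mu]\in\mathcal P^{1,p}((\mathbb R^d)^N)$ for every $\varepsilon>0$, and $$\lim_{\varepsilon\to0^+}d^{1,p}(\Theta^\varepsilon[\mu],\mu)=0 .$$ -/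

import Mathlib

open MeasureTheory Filter Topology
open scoped ENNReal ContDiff

noncomputable section

namespace RegularPlan

/-- The configuration space `(ℝ^d)^N`: a point `X` has components `X k ∈ ℝ^d`, `k < N`, where `ℝ^d`
carries the Euclidean norm. Its `volume` is the Lebesgue measure. -/
abbrev Config (N d : ℕ) : Type := Fin N → EuclideanSpace ℝ (Fin d)

/-! ### The Sobolev space `W^{1,p}((ℝ^d)^N)` -/

/-- The coordinate vector of `(ℝ^d)^N` for the `i`-th coordinate of the `k`-th component. -/
def coordVec {N d : ℕ} (k : Fin N) (i : Fin d) : Config N d :=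
  Pi.single k (EuclideanSpace.single i (1 : ℝ))

/-- `v` is the weak partial derivative of `u` in the coordinate `(k, i)`, tested against smooth
compactly supported functions. -/
def HasWeakPartialDeriv {N d : ℕ} (k : Fin N) (i : Fin d) (u v : Config N d → ℝ) : Prop :=
  LocallyIntegrable u volume ∧ LocallyIntegrable v volume ∧
    ∀ φ : Config N d → ℝ, ContDiff ℝ ∞ φ → HasCompactSupport φ →
      ∫ X, u X * fderiv ℝ φ X (coordVec k i) = -∫ X, v X * φ X

/-- `G` is the weak gradient of `u`: `G k i` is the weak derivative in the coordinate `(k, i)`. -/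
def HasWeakGradient {N d : ℕ} (u : Config N d → ℝ) (G : Fin N → Fin d → Config N d → ℝ) : Prop :=
  ∀ k i, HasWeakPartialDeriv k i u (G k i)

/-- `u ∈ W^{1,p}((ℝ^d)^N)`: `u` is in `L^p` and has a weak gradient in `L^p`. -/
def MemW1p {N d : ℕ} (p : ℝ) (u : Config N d → ℝ) : Prop :=
  MemLp u (ENNReal.ofReal p) volume ∧
    ∃ G : Fin N → Fin d → Config N d → ℝ,
      HasWeakGradient u G ∧ ∀ k i, MemLp (G k i) (ENNReal.ofReal p) volume

/-- The Sobolev norm `(‖u‖_p^p + ∑_{k,i} ‖∂_{k,i} u‖_p^p)^{1/p}`, with values in `[0, ∞]`. Weak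
gradients are unique up to null sets, so the infimum is over one value if `u` has a weak gradient;
if it has none, the infimum is over the empty set and the norm is `∞`. -/
def w1pNorm {N d : ℕ} (p : ℝ) (u : Config N d → ℝ) : ℝ≥0∞ :=
  ⨅ (G : Fin N → Fin d → Config N d → ℝ) (_ : HasWeakGradient u G),
    (eLpNorm u (ENNReal.ofReal p) volume ^ p +
      ∑ k, ∑ i, eLpNorm (G k i) (ENNReal.ofReal p) volume ^ p) ^ (1 / p)

/-! ### Regular probability measures and their distance -/

/-- The `p`-th root of the Lebesgue density of `μ`. -/
def rootDensity {N d : ℕ} (p : ℝ) (μ : Measure (Config N d)) (X : Config N d) : ℝ :=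
  (μ.rnDeriv volume X).toReal ^ (1 / p)

/-- `μ ∈ 𝒫^{1,p}((ℝ^d)^N)`: `μ` is a `W^{1,p}`-regular probability measure. -/
structure IsW1pRegular {N d : ℕ} (p : ℝ) (μ : Measure (Config N d)) : Prop where
  isProbabilityMeasure : IsProbabilityMeasure μ
  absolutelyContinuous : μ ≪ volume
  memW1p : MemW1p p (rootDensity p μ)

/-- The distance `d^{1,p}(μ, ν)`: the `W^{1,p}` norm of the difference of the `p`-th roots of the
densities. -/
def d1p {N d : ℕ} (p : ℝ) (μ ν : Measure (Config N d)) : ℝ≥0∞ :=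
  w1pNorm p (fun X => rootDensity p μ X - rootDensity p ν X)

/-! ### The smoothing operator `Θ^ε` -/

/-- The marginal of `μ` on the `k`-th component. -/
def marginal {N d : ℕ} (μ : Measure (Config N d)) (k : Fin N) :
    Measure (EuclideanSpace ℝ (Fin d)) :=
  μ.map (fun X => X k)

/-- The heat kernel `η^ε(z) = (2πε)^{-d/2} exp(-|z|²/(2ε))` on `ℝ^d`. -/
def heatKernel {d : ℕ} (ε : ℝ) (z : EuclideanSpace ℝ (Fin d)) : ℝ :=
  1 / (2 * Real.pi * ε) ^ ((d : ℝ) / 2) * Real.exp (-‖z‖ ^ 2 / (2 * ε))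

/-- The density of `ρ * η^ε`. -/
def convDensity {d : ℕ} (ε : ℝ) (ρ : Measure (EuclideanSpace ℝ (Fin d)))
    (y : EuclideanSpace ℝ (Fin d)) : ℝ≥0∞ :=
  ∫⁻ x, ENNReal.ofReal (heatKernel ε (y - x)) ∂ρ

/-- The measure `Λ^ε[μ]`: the convolution of `μ` with `η^ε(x_1) ⋯ η^ε(x_N)`. -/
def lambdaMeasure {N d : ℕ} (ε : ℝ) (μ : Measure (Config N d)) : Measure (Config N d) :=
  volume.withDensity fun Y => ∫⁻ X, ∏ k, ENNReal.ofReal (heatKernel ε (Y k - X k)) ∂μ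

/-- The measure `P^ε[μ]` of pairs `(X, Y)`:
`∏_k η^ε(y_k - x_k) / (μ_k * η^ε)(y_k) · dμ_1(x_1) ⋯ dμ_N(x_N) dΛ^ε[μ](Y)`,
where `μ_k` is the `k`-th marginal of `μ`. -/
def couplingMeasure {N d : ℕ} (ε : ℝ) (μ : Measure (Config N d)) :
    Measure (Config N d × Config N d) :=
  ((Measure.pi (marginal μ)).prod (lambdaMeasure ε μ)).withDensity fun XY =>
    ∏ k, ENNReal.ofReal (heatKernel ε (XY.2 k - XY.1 k)) / convDensity ε (marginal μ k) (XY.2 k)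

/-- The smoothing operator: `Θ^ε[μ]` is the law of `X` under `P^ε[μ]`. -/
def theta {N d : ℕ} (ε : ℝ) (μ : Measure (Config N d)) : Measure (Config N d) :=
  (couplingMeasure ε μ).fst

end RegularPlan

end

/-! The Sobolev condition on a root density is traded for a condition on scores. If `μ` has density
`θ`, then `θ^{1/p}` lies in `W^{1,p}` exactly when each coordinate direction `e` has a score `s ∈
L^p(μ)`, meaning `∫ ∂_e φ dμ = -∫ φ s dμ`; the weak derivative of the root is then `(1/p) θ^{1/p}
s`. Scores suit measures built by randomisation, because pushing a measure forward turns its scores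
into conditional expectations.

Let `X'` have law `μ`, let `Y` be `X'` plus Gaussian noise, and let `X` come from `Y` by the
transition that reverses the noise for the product `π` of the marginals. Then `X` has law `Θ^ε[μ]`.
For the `k`-th component let `σ` be the score of `μ_k`, and let `c(Y_k)` be the conditional mean of
`σ(X_k)` given `Y_k`, which is also the logarithmic derivative of `μ_k * η^ε`. Integrating by parts
once in each of `X'`, `Y` and `X` makes the Gaussian displacements cancel
(`integral_fderiv_tripleMeasure`), so the score of `Θ^ε[μ]` is the conditional expectation given `X`
of `S = s(X') + σ(X_k) - c(Y_k)`. Conditional expectation contracts `L^p`, which gives regularity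
(`exists_isScore_theta`).

For the limit, all displacements are `O(√ε)` in `L^1`. The pair `(X_k, Y_k)` has the law of a point
of law `μ_k` and its noisy copy, so `σ(X_k) - c(Y_k)` tends to `0` in `L^p`: replace `σ` by a
function in `C_c`. Likewise, for `g ∈ C_c` close to `s` in `L^p(μ)`, `S - g(X)` is asymptotically as
small as `s - g`, and so is the new score minus `g`. To compare weighted scores, the root densities
must also converge in `L^p`. By `|a^{1/p} - b^{1/p}|^p ≤ |a - b|` this follows from `L^1`
convergence of the densities (`tendsto_eLpNorm_rootDensity_sub`): started from `π` the triple is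
reversible, and starting from `μ` only adds the weight `r(X')` with `r = dμ/dπ`. The error is
therefore at most the mean of `|r(X') - r(X)|` under the reversible law, which vanishes by
approximating `r` in `L^1(π)`. -/

noncomputable section

namespace RegularPlan

/-! ### Weak derivatives: dominated limits and the chain rule -/

section WeakDerivative

open Convolution ContinuousLinearMap

variable {E : Type*} [NormedAddCommGroup E] [NormedSpace ℝ E] [FiniteDimensional ℝ E]
  [MeasurableSpace E] [BorelSpace E] {κ : Measure E}

/-- `v` is the weak derivative of `u` in the direction `e`. -/
def HasWeakLineDeriv (κ : Measure E) (e : E) (u v : E → ℝ) : Prop :=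
  LocallyIntegrable u κ ∧ LocallyIntegrable v κ ∧
    ∀ φ : E → ℝ, ContDiff ℝ ∞ φ → HasCompactSupport φ →
      ∫ x, u x * fderiv ℝ φ x e ∂κ = -∫ x, v x * φ x ∂κ

/-- Dominated convergence on both sides of the defining identity. It serves to remove the truncation
or shift from regularised powers. -/
lemma HasWeakLineDeriv.of_tendsto {e : E} {u v gu gv : E → ℝ} {U V : ℕ → E → ℝ}
    (h : ∀ n, HasWeakLineDeriv κ e (U n) (V n)) (hgu : LocallyIntegrable gu κ)
    (hgv : LocallyIntegrable gv κ) (hUb : ∀ n, ∀ᵐ x ∂κ, |U n x| ≤ gu x)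
    (hVb : ∀ n, ∀ᵐ x ∂κ, |V n x| ≤ gv x)
    (hU : ∀ᵐ x ∂κ, Tendsto (fun n => U n x) atTop (𝓝 (u x)))
    (hV : ∀ᵐ x ∂κ, Tendsto (fun n => V n x) atTop (𝓝 (v x))) :
    HasWeakLineDeriv κ e u v := by
  have key : ∀ (w g : E → ℝ) (W : ℕ → E → ℝ), (∀ n, LocallyIntegrable (W n) κ) →
      LocallyIntegrable g κ → (∀ n, ∀ᵐ x ∂κ, |W n x| ≤ g x) →
      (∀ᵐ x ∂κ, Tendsto (fun n => W n x) atTop (𝓝 (w x))) → LocallyIntegrable w κ ∧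
      ∀ c : E → ℝ, Continuous c → HasCompactSupport c →
      Tendsto (fun n => ∫ x, W n x * c x ∂κ) atTop (𝓝 (∫ x, w x * c x ∂κ)) := by
    intro w g W hW hg hb hlim
    refine ⟨?_, fun c hc hcc => ?_⟩
    · refine hg.mono (aestronglyMeasurable_of_tendsto_ae _
        (fun n => (hW n).aestronglyMeasurable) hlim) ?_
      filter_upwards [ae_all_iff.2 hb, hlim] with x hx hx'
      exact (le_of_tendsto hx'.abs (Eventually.of_forall hx)).trans (le_abs_self _)
    · refine tendsto_integral_of_dominated_convergence (fun x => ‖g x * c x‖)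
        (fun n => (hW n).aestronglyMeasurable.mul hc.aestronglyMeasurable)
        (hg.integrable_smul_right_of_hasCompactSupport hc hcc).norm (fun n => ?_) ?_
      · filter_upwards [hb n] with x hx
        rw [norm_mul, norm_mul]
        gcongr
        exact hx.trans (le_abs_self _)
      · filter_upwards [hlim] with x hx
        exact hx.mul_const _
  obtain ⟨h1, h2⟩ := key u gu U (fun n => (h n).1) hgu hUb hU
  obtain ⟨h3, h4⟩ := key v gv V (fun n => (h n).2.1) hgv hVb hV
  refine ⟨h1, h3, fun χ hχ hχc => ?_⟩
  have l1 := h2 (fun x => fderiv ℝ χ x e) ((hχ.continuous_fderiv (by simp)).clm_apply continuous_const)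
    ((hχc.fderiv ℝ).comp_left (g := fun l : E →L[ℝ] ℝ => l e) rfl)
  have l2 := h4 χ hχ.continuous hχc
  simp only [fun n => (h n).2.2 χ hχ hχc] at l1
  exact tendsto_nhds_unique l1 l2.neg

variable [κ.IsAddHaarMeasure]

lemma tendsto_lintegral_enorm_sub_translate {u : E → ℝ} (hu : Integrable u κ) :
    Tendsto (fun t => ∫⁻ x, ‖u (x - t) - u x‖ₑ ∂κ) (𝓝 0) (𝓝 0) := by
  have hu1 : MemLp u 1 κ := memLp_one_iff_integrable.2 hu
  let g : C(E, C(E, E)) := (ContinuousMap.mk (fun a : E × E => a.2 - a.1) (by fun_prop)).curry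
  have hg : ∀ t, MeasurePreserving (g t) κ κ := fun t => measurePreserving_sub_right κ t
  have h := (continuous_const (y := hu1.toLp u)).compMeasurePreservingLp (μ := κ)
    g.continuous hg (by simp)
  have h0 := (h.tendsto 0)
  rw [tendsto_iff_edist_tendsto_0] at h0
  refine h0.congr fun t => ?_
  rw [Lp.toLp_compMeasurePreserving hu1, Lp.toLp_compMeasurePreserving hu1, Lp.edist_toLp_toLp,
    eLpNorm_one_eq_lintegral_enorm]
  simp [g]

lemma convolution_bump_sub (φ : ContDiffBump (0 : E)) {u : E → ℝ} (hu : LocallyIntegrable u κ)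
    (x : E) :
    (φ.normed κ ⋆[lsmul ℝ ℝ, κ] u) x - u x = ∫ t, φ.normed κ t * (u (x - t) - u x) ∂κ := by
  have h1 : Integrable (fun t => φ.normed κ t * u (x - t)) κ := by
    have := (φ.hasCompactSupport_normed (μ := κ)).convolutionExists_left (lsmul ℝ ℝ)
      φ.continuous_normed hu x
    simpa [ConvolutionExistsAt] using this
  have h2 : Integrable (fun t => φ.normed κ t * u x) κ := φ.integrable_normed.mul_const _
  simp only [mul_sub]
  rw [integral_sub h1 h2, integral_mul_const, φ.integral_normed, one_mul]
  simp [convolution_def]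

/-- The error is an average, over small `t`, of the `L^1` distance between `u` and its translate by
`t`, and translation is continuous in `L^1`. -/
lemma tendsto_convolution_bump {u : E → ℝ} (hu : LocallyIntegrable u κ) {K : Set E}
    (hK : IsCompact K) {φ : ℕ → ContDiffBump (0 : E)}
    (hφ : Tendsto (fun n => (φ n).rOut) atTop (𝓝 0)) :
    Tendsto (fun n => ∫⁻ x in K, ‖((φ n).normed κ ⋆[lsmul ℝ ℝ, κ] u) x - u x‖ₑ ∂κ)
      atTop (𝓝 0) := by
  -- A bump of radius below `1` sees `u` only on this neighbourhood of `K`, so `u` can be cut off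
  -- there to an integrable function.
  set K' := Metric.cthickening 1 K
  have hK' : IsCompact K' := hK.cthickening
  set w : E → ℝ := K'.indicator u
  have hw : Integrable w κ := by
    rw [integrable_indicator_iff hK'.measurableSet]
    exact hu.integrableOn_isCompact hK'
  have htr := tendsto_lintegral_enorm_sub_translate hw
  rw [ENNReal.tendsto_nhds_zero] at htr ⊢
  intro ε hε
  have h1 := htr ε hε
  obtain ⟨δ, hδ, hball⟩ := Metric.eventually_nhds_iff.1 h1
  filter_upwards [hφ.eventually (gt_mem_nhds (lt_min hδ one_pos))] with n hn
  have hwK : ∀ x ∈ K, w x = u x := fun x hx =>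
    Set.indicator_of_mem (Metric.self_subset_cthickening _ hx) _
  have key : ∀ x ∈ K, ‖((φ n).normed κ ⋆[lsmul ℝ ℝ, κ] u) x - u x‖ₑ ≤
      ∫⁻ t, ‖(φ n).normed κ t‖ₑ * ‖w (x - t) - w x‖ₑ ∂κ := by
    intro x hx
    rw [convolution_bump_sub _ hu]
    refine (enorm_integral_le_lintegral_enorm _).trans (le_of_eq (lintegral_congr fun t => ?_))
    rw [enorm_mul]
    by_cases ht : t ∈ Function.support ((φ n).normed κ)
    · rw [ContDiffBump.support_normed_eq] at ht
      have hm : x - t ∈ K' := by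
        refine Metric.mem_cthickening_of_dist_le (x - t) x 1 K hx ?_
        rw [mem_ball_zero_iff] at ht
        simpa using (ht.trans (hn.trans_le (min_le_right _ _))).le
      rw [hwK x hx, show w (x - t) = u (x - t) from Set.indicator_of_mem hm _]
    · rw [Function.notMem_support] at ht
      simp [ht]
  have hwm : AEMeasurable (Function.uncurry fun x t => ‖(φ n).normed κ t‖ₑ * ‖w (x - t) - w x‖ₑ)
      ((κ.restrict K).prod κ) := by
    have h1 : AEStronglyMeasurable (fun p : E × E => w (p.1 - p.2)) ((κ.restrict K).prod κ) := by
      have : AEStronglyMeasurable (fun p : E × E => w (p.1 - p.2)) (κ.prod κ) :=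
        hw.aestronglyMeasurable.comp_quasiMeasurePreserving (quasiMeasurePreserving_sub κ κ)
      exact this.mono_ac (Measure.AbsolutelyContinuous.prod Measure.restrict_le_self.absolutelyContinuous .rfl)
    have h2 : AEStronglyMeasurable (fun p : E × E => w p.1) ((κ.restrict K).prod κ) :=
      (hw.aestronglyMeasurable.mono_measure Measure.restrict_le_self).comp_fst
    have h3 : AEStronglyMeasurable (fun p : E × E => (φ n).normed κ p.2) ((κ.restrict K).prod κ) :=
      ((φ n).continuous_normed.comp continuous_snd).aestronglyMeasurable
    exact h3.enorm.mul (h1.sub h2).enorm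
  calc ∫⁻ x in K, ‖((φ n).normed κ ⋆[lsmul ℝ ℝ, κ] u) x - u x‖ₑ ∂κ
      ≤ ∫⁻ x in K, ∫⁻ t, ‖(φ n).normed κ t‖ₑ * ‖w (x - t) - w x‖ₑ ∂κ ∂κ :=
        setLIntegral_mono' hK.measurableSet key
    _ = ∫⁻ t, ∫⁻ x in K, ‖(φ n).normed κ t‖ₑ * ‖w (x - t) - w x‖ₑ ∂κ ∂κ :=
        lintegral_lintegral_swap hwm
    _ ≤ ∫⁻ t, ‖(φ n).normed κ t‖ₑ * ε ∂κ := by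
        refine lintegral_mono fun t => ?_
        rw [lintegral_const_mul' _ _ enorm_ne_top]
        by_cases ht : t ∈ Function.support ((φ n).normed κ)
        · rw [ContDiffBump.support_normed_eq] at ht
          gcongr
          refine (setLIntegral_le_lintegral _ _).trans (hball ?_)
          rw [mem_ball_zero_iff] at ht
          simpa using ht.trans (hn.trans_le (min_le_left _ _))
        · rw [Function.notMem_support] at ht
          simp [ht]
    _ = ε := by
        rw [lintegral_mul_const _ (φ n).continuous_normed.enorm.measurable,
          ← ofReal_integral_norm_eq_lintegral_enorm (φ n).integrable_normed]
        simp [Real.norm_of_nonneg ((φ n).nonneg_normed _), (φ n).integral_normed]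

/-- The derivative falls on the mollifier, and `t ↦ φ(x - t)` is an admissible test function for the
weak derivative. -/
lemma fderiv_convolution_bump {e : E} {u v : E → ℝ} (h : HasWeakLineDeriv κ e u v)
    (φ : ContDiffBump (0 : E)) (x : E) :
    fderiv ℝ (φ.normed κ ⋆[lsmul ℝ ℝ, κ] u) x e = (φ.normed κ ⋆[lsmul ℝ ℝ, κ] v) x := by
  obtain ⟨hu, hv, huv⟩ := h
  have hφ : ContDiff ℝ ∞ (φ.normed κ) := φ.contDiff_normed
  have hc := φ.hasCompactSupport_normed (μ := κ)
  rw [(hc.hasFDerivAt_convolution_left (lsmul ℝ ℝ) (hφ.of_le (by simp)) hu x).fderiv]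
  have hex := (hc.fderiv ℝ).convolutionExists_left ((lsmul ℝ ℝ).precompL E)
      (hφ.continuous_fderiv (by simp)) hu x
  rw [convolution_def, ContinuousLinearMap.integral_apply hex]
  simp only [precompL_apply, lsmul_apply, smul_eq_mul]
  have := huv (fun t => φ.normed κ (x - t)) (hφ.comp (contDiff_const.sub contDiff_id))
    (hc.comp_homeomorph (Homeomorph.subLeft x))
  have hd : ∀ t, fderiv ℝ (fun t => φ.normed κ (x - t)) t e = - fderiv ℝ (φ.normed κ) (x - t) e := by
    intro t
    have h1 : HasFDerivAt (φ.normed κ) (fderiv ℝ (φ.normed κ) (x - t)) (x - t) :=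
      (hφ.differentiable (by simp) _).hasFDerivAt
    have h2 := h1.comp t ((hasFDerivAt_id t).const_sub x)
    rw [show (fun t => φ.normed κ (x - t)) = φ.normed κ ∘ (fun t => x - t) from rfl]
    erw [h2.fderiv]
    simp
  simp only [hd, mul_neg, integral_neg, neg_inj] at this
  rw [convolution_def, ← integral_sub_left_eq_self _ κ x]
  simp only [sub_sub_cancel, lsmul_apply, smul_eq_mul]
  rw [← integral_sub_left_eq_self (fun t => φ.normed κ t * v (x - t)) κ x]
  simp only [sub_sub_cancel]
  simpa only [mul_comm] using this

/-- Mollifications of `u` obey the classical chain rule and integration by parts; both integrals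
then converge, since mollifications converge in `L^1` on compact sets and almost everywhere. -/
lemma HasWeakLineDeriv.comp {e : E} {u v : E → ℝ} (h : HasWeakLineDeriv κ e u v) {Φ : ℝ → ℝ}
    (hΦ : ContDiff ℝ 1 Φ) {L : ℝ} (hL : ∀ t, |deriv Φ t| ≤ L) :
    HasWeakLineDeriv κ e (fun x => Φ (u x)) (fun x => deriv Φ (u x) * v x) := by
  have hu := h.1
  have hv := h.2.1
  have hL0 : 0 ≤ L := (abs_nonneg _).trans (hL 0)
  have hΦd : Differentiable ℝ Φ := hΦ.differentiable (by simp)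
  have hΦ'c : Continuous (deriv Φ) := hΦ.continuous_deriv (by simp)
  have hlip : ∀ a b, |Φ a - Φ b| ≤ L * |a - b| := fun a b => by
    have := Convex.norm_image_sub_le_of_norm_deriv_le (f := Φ) (s := Set.univ) (C := L)
      (fun x _ => hΦd x) (fun x _ => hL x) convex_univ (Set.mem_univ b) (Set.mem_univ a)
    simpa using this
  have hI1 : LocallyIntegrable (fun x => Φ (u x)) κ := by
    refine LocallyIntegrable.mono (f := fun x => |Φ 0| + L * |u x|) ?_
      (hΦ.continuous.comp_aestronglyMeasurable hu.aestronglyMeasurable) (ae_of_all _ fun x => ?_)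
    · exact (locallyIntegrable_const _).add ((show LocallyIntegrable (fun x => |u x|) κ from
        hu.mono hu.aestronglyMeasurable.norm (ae_of_all _ fun x => by simp)).smul L)
    · have := hlip (u x) 0
      rw [sub_zero] at this
      have h2 : |Φ (u x)| ≤ |Φ 0| + |Φ (u x) - Φ 0| := by
        have := abs_add_le (Φ 0) (Φ (u x) - Φ 0); simpa using this
      rw [Real.norm_eq_abs, Real.norm_of_nonneg (by positivity)]
      linarith
  have hI2 : LocallyIntegrable (fun x => deriv Φ (u x) * v x) κ := by
    refine LocallyIntegrable.mono (f := fun x => L * v x) (hv.smul L)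
      ((hΦ'c.comp_aestronglyMeasurable hu.aestronglyMeasurable).mul hv.aestronglyMeasurable)
      (ae_of_all _ fun x => ?_)
    rw [norm_mul, norm_mul, Real.norm_of_nonneg hL0]
    gcongr
    exact hL _
  refine ⟨hI1, hI2, fun χ hχ hχc => ?_⟩
  -- The outer and inner radii keep the fixed ratio `2`, a bound needed for almost everywhere
  -- convergence of the mollifications.
  let φ : ℕ → ContDiffBump (0 : E) := fun n =>
    ⟨1 / ((n : ℝ) + 1), 2 * (1 / ((n : ℝ) + 1)), by positivity, by
      have : 0 < 1 / ((n : ℝ) + 1) := by positivity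
      linarith⟩
  have hφ0 : Tendsto (fun n => (φ n).rOut) atTop (𝓝 0) := by
    have := (tendsto_one_div_add_atTop_nhds_zero_nat (𝕜 := ℝ)).const_mul 2
    rwa [mul_zero] at this
  set U : ℕ → E → ℝ := fun n => (φ n).normed κ ⋆[lsmul ℝ ℝ, κ] u
  set V : ℕ → E → ℝ := fun n => (φ n).normed κ ⋆[lsmul ℝ ℝ, κ] v
  have hUae : ∀ᵐ x ∂κ, Tendsto (fun n => U n x) atTop (𝓝 (u x)) :=
    ContDiffBump.ae_convolution_tendsto_right_of_locallyIntegrable (K := 2) hφ0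
      (Eventually.of_forall fun n => le_rfl) hu
  have hUc : ∀ n, ContDiff ℝ 1 (U n) := fun n =>
    (φ n).hasCompactSupport_normed.contDiff_convolution_left (lsmul ℝ ℝ) (φ n).contDiff_normed hu
  have hVc : ∀ n, Continuous (V n) := fun n =>
    (φ n).hasCompactSupport_normed.continuous_convolution_left (lsmul ℝ ℝ)
      (φ n).continuous_normed hv
  have hχ' : Continuous (fun x => fderiv ℝ χ x e) :=
    (hχ.continuous_fderiv (by simp)).clm_apply continuous_const
  have hχ'c : HasCompactSupport (fun x => fderiv ℝ χ x e) :=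
    (hχc.fderiv ℝ).comp_left (g := fun l : E →L[ℝ] ℝ => l e) rfl
  have hfd : ∀ n x, fderiv ℝ (fun x => Φ (U n x)) x e = deriv Φ (U n x) * V n x := by
    intro n x
    have h1 := ((hΦd (U n x)).hasDerivAt.comp_hasFDerivAt x
      ((hUc n).differentiable (by simp) x).hasFDerivAt).fderiv
    rw [show (fun x => Φ (U n x)) = Φ ∘ U n from rfl, h1, show V n x = fderiv ℝ (U n) x e from
      (fderiv_convolution_bump h (φ n) x).symm]
    simp
  have hibp : ∀ n, ∫ x, Φ (U n x) * fderiv ℝ χ x e ∂κ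
      = -∫ x, (deriv Φ (U n x) * V n x) * χ x ∂κ := by
    intro n
    have hc1 : Continuous (fun x => Φ (U n x)) := hΦ.continuous.comp (hUc n).continuous
    have hc2 : Continuous (fun x => deriv Φ (U n x) * V n x) :=
      (hΦ'c.comp (hUc n).continuous).mul (hVc n)
    have := integral_mul_fderiv_eq_neg_fderiv_mul_of_integrable (μ := κ)
      (f := fun x => Φ (U n x)) (g := χ) (v := e)
      (by simp only [hfd]; exact (hc2.mul hχ.continuous).integrable_of_hasCompactSupport hχc.mul_left)
      ((hc1.mul hχ').integrable_of_hasCompactSupport hχ'c.mul_left)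
      ((hc1.mul hχ.continuous).integrable_of_hasCompactSupport hχc.mul_left)
      (fun x _ => (hΦ.comp (hUc n)).differentiable (by simp) x)
      (fun x _ => hχ.differentiable (by simp) x)
    simpa only [hfd] using this
  have hbdd : ∀ c : E → ℝ, Continuous c → HasCompactSupport c → ∀ F : ℕ → E → ℝ, ∀ f : E → ℝ,
      LocallyIntegrable f κ → (∀ n, Continuous (F n)) →
      Tendsto (fun n => ∫⁻ x in tsupport c, ‖F n x - f x‖ₑ ∂κ) atTop (𝓝 0) →
      Tendsto (fun n => ∫ x, F n x * c x ∂κ) atTop (𝓝 (∫ x, f x * c x ∂κ)) := by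
    intro c hc hcc F f hf hF hlim
    obtain ⟨C, hC⟩ := hcc.exists_bound_of_continuous hc
    refine tendsto_integral_of_L1 _ (hf.integrable_smul_right_of_hasCompactSupport hc hcc).aestronglyMeasurable
      (Eventually.of_forall fun n =>
        ((hF n).mul hc).integrable_of_hasCompactSupport hcc.mul_left) ?_
    have h2 := ENNReal.Tendsto.const_mul (a := ENNReal.ofReal C) hlim (Or.inr ENNReal.ofReal_ne_top)
    rw [mul_zero] at h2
    refine tendsto_of_tendsto_of_tendsto_of_le_of_le tendsto_const_nhds h2
      (fun _ => zero_le) fun n => ?_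
    rw [← lintegral_const_mul' _ _ ENNReal.ofReal_ne_top,
      ← lintegral_indicator (isClosed_tsupport c).measurableSet]
    refine lintegral_mono fun x => ?_
    by_cases hx : x ∈ tsupport c
    · rw [Set.indicator_of_mem hx, smul_eq_mul, ← sub_mul, enorm_mul, mul_comm]
      gcongr
      rw [← ofReal_norm]
      exact ENNReal.ofReal_le_ofReal (hC x)
    · simp [image_eq_zero_of_notMem_tsupport hx]
  have hLe : ∀ t, ‖deriv Φ t‖ₑ ≤ ENNReal.ofReal L := fun t => by
    rw [← ofReal_norm]; exact ENNReal.ofReal_le_ofReal (hL t)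
  have lim1 := hbdd _ hχ' hχ'c (fun n x => Φ (U n x)) _ hI1
    (fun n => hΦ.continuous.comp (hUc n).continuous) <| by
      have h2 := ENNReal.Tendsto.const_mul (a := ENNReal.ofReal L)
        (tendsto_convolution_bump hu hχ'c hφ0) (Or.inr ENNReal.ofReal_ne_top)
      rw [mul_zero] at h2
      refine tendsto_of_tendsto_of_tendsto_of_le_of_le tendsto_const_nhds h2
        (fun _ => zero_le) fun n => ?_
      rw [← lintegral_const_mul' _ _ ENNReal.ofReal_ne_top]
      refine lintegral_mono fun x => ?_
      rw [← ofReal_norm, ← ofReal_norm, ← ENNReal.ofReal_mul hL0]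
      exact ENNReal.ofReal_le_ofReal (hlip _ _)
  have lim2 := hbdd χ hχ.continuous hχc (fun n x => deriv Φ (U n x) * V n x) _ hI2
    (fun n => (hΦ'c.comp (hUc n).continuous).mul (hVc n)) <| by
      have h2 := ENNReal.Tendsto.const_mul (a := ENNReal.ofReal L)
        (tendsto_convolution_bump hv hχc hφ0) (Or.inr ENNReal.ofReal_ne_top)
      rw [mul_zero] at h2
      -- The difference of products is split as `Φ'(U n) (V n - v) + (Φ'(U n) - Φ'(u)) v`. The first
      -- part is small in `L^1` as `Φ'` is bounded; this is the second, dominated by `2 L |v|`.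
      have h3 : Tendsto (fun n => ∫⁻ x in tsupport χ,
          ‖(deriv Φ (U n x) - deriv Φ (u x)) * v x‖ₑ ∂κ) atTop (𝓝 0) := by
        rw [← lintegral_zero (μ := κ.restrict (tsupport χ))]
        refine tendsto_lintegral_of_dominated_convergence'
          (fun x => 2 * ENNReal.ofReal L * ‖v x‖ₑ) (fun n => ?_) (fun n => ae_of_all _ fun x => ?_)
          ?_ ?_
        · exact ((((hΦ'c.comp (hUc n).continuous).aestronglyMeasurable.sub
            (hΦ'c.comp_aestronglyMeasurable hu.aestronglyMeasurable)).mul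
              hv.aestronglyMeasurable).enorm).mono_measure Measure.restrict_le_self
        · dsimp only
          rw [enorm_mul, two_mul]
          gcongr
          exact (enorm_sub_le).trans (add_le_add (hLe _) (hLe _))
        · rw [lintegral_const_mul' _ _ (by finiteness)]
          exact ENNReal.mul_ne_top (by finiteness) (hv.integrableOn_isCompact hχc).2.ne
        · refine ae_restrict_of_ae (hUae.mono fun x hx => ?_)
          have := ((((hΦ'c.tendsto _).comp hx).sub_const (deriv Φ (u x))).mul_const (v x)).enorm
          simpa using this
      have h4 := h2.add h3
      rw [add_zero] at h4
      refine tendsto_of_tendsto_of_tendsto_of_le_of_le tendsto_const_nhds h4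
        (fun _ => zero_le) fun n => ?_
      dsimp only
      rw [← lintegral_const_mul' _ _ ENNReal.ofReal_ne_top, ← lintegral_add_left']
      · refine lintegral_mono fun x => ?_
        rw [show deriv Φ (U n x) * V n x - deriv Φ (u x) * v x = deriv Φ (U n x) * (V n x - v x)
          + (deriv Φ (U n x) - deriv Φ (u x)) * v x by ring]
        refine (enorm_add_le _ _).trans ?_
        rw [enorm_mul]
        gcongr
        exact hLe _
      · exact ((((hVc n).aestronglyMeasurable.sub hv.aestronglyMeasurable).enorm).mono_measure
          Measure.restrict_le_self).const_mul _
  simp only [hibp] at lim1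
  exact tendsto_nhds_unique lim1 lim2.neg

lemma HasWeakLineDeriv.comp_primitive {e : E} {u v : E → ℝ} (h : HasWeakLineDeriv κ e u v)
    {φ : ℝ → ℝ} (hφ : Continuous φ) {L : ℝ} (hL : ∀ t, |φ t| ≤ L) :
    HasWeakLineDeriv κ e (fun x => ∫ s in (0 : ℝ)..u x, φ s) (fun x => φ (u x) * v x) := by
  have hd : deriv (fun t => ∫ s in (0 : ℝ)..t, φ s) = φ :=
    funext fun t => hφ.deriv_integral φ 0 t
  have := h.comp (Φ := fun t => ∫ s in (0 : ℝ)..t, φ s) (L := L)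
    (contDiff_one_iff_deriv.2 ⟨fun t => (hφ.integral_hasStrictDerivAt 0 t).hasDerivAt.differentiableAt, by rwa [hd]⟩)
    (by rwa [hd])
  rwa [hd] at this

end WeakDerivative

/-! ### Scores -/

section Score

variable {E : Type*} [NormedAddCommGroup E] [NormedSpace ℝ E] [MeasurableSpace E]

/-- `s` is the score (logarithmic derivative) of the measure `ν` in the direction `e`. -/
structure IsScore (ν : Measure E) (e : E) (s : E → ℝ) : Prop where
  integrable : Integrable s ν
  ibp : ∀ φ : E → ℝ, ContDiff ℝ ∞ φ → (∃ C, ∀ x, |φ x| ≤ C) → (∃ C, ∀ x, ‖fderiv ℝ φ x‖ ≤ C) →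
    ∫ x, fderiv ℝ φ x e ∂ν = -∫ x, φ x * s x ∂ν

/-- Multiply the test function by cutoffs `χ(c n • x)` with `c n → 0`: the derivative of the cutoff
carries the factor `c n` and drops out in the limit. The larger class of test functions is needed
later for Gaussian kernels and for functions of a single component. -/
lemma IsScore.of_hasCompactSupport [FiniteDimensional ℝ E] [BorelSpace E] {ν : Measure E}
    [IsFiniteMeasure ν] {e : E} {s : E → ℝ} (hs : Integrable s ν)
    (h : ∀ φ : E → ℝ, ContDiff ℝ ∞ φ → HasCompactSupport φ →
      ∫ x, fderiv ℝ φ x e ∂ν = -∫ x, φ x * s x ∂ν) : IsScore ν e s := by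
  refine ⟨hs, fun φ hφ ⟨C, hC⟩ ⟨C', hC'⟩ => ?_⟩
  have hC0 : 0 ≤ C := (abs_nonneg _).trans (hC 0)
  have hC0' : 0 ≤ C' := (norm_nonneg _).trans (hC' 0)
  let χ : ContDiffBump (0 : E) := ⟨1, 2, one_pos, one_lt_two⟩
  have hχ : ContDiff ℝ ∞ χ := χ.contDiff
  obtain ⟨D, hD⟩ := (χ.hasCompactSupport.fderiv ℝ).exists_bound_of_continuous
    (hχ.continuous_fderiv (by simp))
  have hD0 : 0 ≤ D := (norm_nonneg _).trans (hD 0)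
  let c : ℕ → ℝ := fun n => 1 / ((n : ℝ) + 1)
  have hc0 : ∀ n, 0 < c n := fun n => by positivity
  have hc1 : ∀ n, c n ≤ 1 := fun n => by
    have : (0 : ℝ) ≤ n := n.cast_nonneg
    exact (div_le_one (by positivity)).2 (by linarith)
  have hc : Tendsto c atTop (𝓝 0) := tendsto_one_div_add_atTop_nhds_zero_nat
  have hfd : ∀ n x, HasFDerivAt (fun x => χ (c n • x) * φ x)
      (χ (c n • x) • fderiv ℝ φ x + φ x • (c n • fderiv ℝ χ (c n • x))) x := by
    intro n x
    have h1 : HasFDerivAt (fun x : E => χ (c n • x)) (c n • fderiv ℝ χ (c n • x)) x := by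
      have := (hχ.differentiable (by simp) (c n • x)).hasFDerivAt.comp x
        ((hasFDerivAt_id (𝕜 := ℝ) x).const_smul (c n))
      refine this.congr_fderiv ?_
      ext y; simp
    exact h1.mul (hφ.differentiable (by simp) x).hasFDerivAt
  have hn : ∀ n, ∫ x, (χ (c n • x) * fderiv ℝ φ x e + φ x * (c n * fderiv ℝ χ (c n • x) e)) ∂ν
      = -∫ x, (χ (c n • x) * φ x) * s x ∂ν := by
    intro n
    rw [← h (fun x => χ (c n • x) * φ x)
      ((hχ.comp (contDiff_const_smul (c n))).mul hφ)
      (HasCompactSupport.mul_right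
        (χ.hasCompactSupport.comp_homeomorph (Homeomorph.smulOfNeZero (c n) (hc0 n).ne')))]
    refine integral_congr_ae (ae_of_all _ fun x => ?_)
    simp [(hfd n x).fderiv]
  have hχlim : ∀ x, Tendsto (fun n => χ (c n • x)) atTop (𝓝 1) := by
    intro x
    have h1 : Tendsto (fun n => χ (c n • x)) atTop (𝓝 (χ ((0 : ℝ) • x))) :=
      (χ.continuous.tendsto _).comp (hc.smul_const x)
    rwa [zero_smul, χ.one_of_mem_closedBall (Metric.mem_closedBall_self zero_le_one)] at h1
  have hφ'c : Continuous (fun x => fderiv ℝ φ x e) :=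
    (hφ.continuous_fderiv (by simp)).clm_apply continuous_const
  have hχc : ∀ n, Continuous fun x : E => χ (c n • x) := fun n =>
    χ.continuous.comp (continuous_const_smul (c n))
  have hχ'c : ∀ n, Continuous fun x : E => fderiv ℝ χ (c n • x) e := fun n =>
    ((hχ.continuous_fderiv (by simp)).comp (continuous_const_smul (c n))).clm_apply
      continuous_const
  have l1 : Tendsto (fun n => ∫ x, (χ (c n • x) * fderiv ℝ φ x e
      + φ x * (c n * fderiv ℝ χ (c n • x) e)) ∂ν) atTop (𝓝 (∫ x, fderiv ℝ φ x e ∂ν)) := by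
    refine tendsto_integral_of_dominated_convergence (fun _ => C' * ‖e‖ + C * (D * ‖e‖))
      (fun n => (((hχc n).mul hφ'c).add
        (hφ.continuous.mul (continuous_const.mul (hχ'c n)))).aestronglyMeasurable)
      (integrable_const _) (fun n => ae_of_all _ fun x => ?_) (ae_of_all _ fun x => ?_)
    · refine (norm_add_le _ _).trans (add_le_add ?_ ?_)
      · rw [norm_mul, Real.norm_of_nonneg χ.nonneg]
        calc _ ≤ 1 * ‖fderiv ℝ φ x e‖ := by gcongr; exact χ.le_one
          _ ≤ _ := by rw [one_mul]; exact ContinuousLinearMap.le_of_opNorm_le _ (hC' x) _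
      · rw [norm_mul, norm_mul, Real.norm_of_nonneg (hc0 n).le]
        refine mul_le_mul (hC x) ?_ (by have := (hc0 n).le; positivity) hC0
        calc _ ≤ 1 * ‖fderiv ℝ χ (c n • x) e‖ := by gcongr; exact hc1 n
          _ ≤ _ := by rw [one_mul]; exact ContinuousLinearMap.le_of_opNorm_le _ (hD _) _
    · have h2 : Tendsto (fun n => c n * fderiv ℝ χ (c n • x) e) atTop (𝓝 0) := by
        refine squeeze_zero_norm (a := fun n => c n * (D * ‖e‖)) (fun n => ?_)
          (by simpa using hc.mul_const (D * ‖e‖))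
        rw [norm_mul, Real.norm_of_nonneg (hc0 n).le]
        exact mul_le_mul_of_nonneg_left (ContinuousLinearMap.le_of_opNorm_le _ (hD _) _) (hc0 n).le
      simpa using ((hχlim x).mul_const (fderiv ℝ φ x e)).add (h2.const_mul (φ x))
  have l2 : Tendsto (fun n => ∫ x, (χ (c n • x) * φ x) * s x ∂ν) atTop
      (𝓝 (∫ x, φ x * s x ∂ν)) := by
    refine tendsto_integral_of_dominated_convergence (fun x => C * ‖s x‖)
      (fun n => (((hχc n).mul hφ.continuous).aestronglyMeasurable).mul hs.aestronglyMeasurable)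
      (hs.norm.const_mul C) (fun n => ae_of_all _ fun x => ?_) (ae_of_all _ fun x => ?_)
    · rw [norm_mul, norm_mul, Real.norm_of_nonneg χ.nonneg]
      gcongr
      calc _ ≤ 1 * ‖φ x‖ := by gcongr; exact χ.le_one
        _ ≤ C := by rw [one_mul]; exact hC x
    · simpa using ((hχlim x).mul_const (φ x)).mul_const (s x)
  simp only [hn] at l1
  exact tendsto_nhds_unique l1 l2.neg

end Score

/-! ### Sobolev roots versus scores in `L^p` -/

section RootDensity

variable {N d : ℕ} {p : ℝ} {ν : Measure (Config N d)}

lemma rootDensity_nonneg (X : Config N d) : 0 ≤ rootDensity p ν X :=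
  Real.rpow_nonneg ENNReal.toReal_nonneg _

lemma measurable_rootDensity : Measurable (rootDensity p ν) :=
  (Measure.measurable_rnDeriv _ _).ennreal_toReal.pow_const _

lemma rootDensity_rpow (hp : 1 < p) (X : Config N d) :
    rootDensity p ν X ^ p = (ν.rnDeriv volume X).toReal := by
  rw [rootDensity, ← Real.rpow_mul ENNReal.toReal_nonneg, one_div,
    inv_mul_cancel₀ (by linarith), Real.rpow_one]

/-- Pointwise `|θ^{1/p} s|^p = θ |s|^p`. This converts every `L^p` estimate on gradients into one on
scores. -/
lemma eLpNorm_rootDensity_mul [IsFiniteMeasure ν] (hp : 1 < p) (hν : ν ≪ volume)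
    {s : Config N d → ℝ} (hs : AEMeasurable s volume) :
    eLpNorm (fun X => rootDensity p ν X * s X) (ENNReal.ofReal p) volume
      = eLpNorm s (ENNReal.ofReal p) ν := by
  have hp0 : 0 < p := by linarith
  have h0 : ENNReal.ofReal p ≠ 0 := by simpa using hp0
  rw [eLpNorm_eq_lintegral_rpow_enorm_toReal h0 ENNReal.ofReal_ne_top,
    eLpNorm_eq_lintegral_rpow_enorm_toReal h0 ENNReal.ofReal_ne_top,
    ENNReal.toReal_ofReal hp0.le, ← lintegral_rnDeriv_mul hν (hs.enorm.pow_const p)]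
  congr 1
  refine lintegral_congr_ae ?_
  filter_upwards [ν.rnDeriv_lt_top volume] with X hX
  rw [enorm_mul, ENNReal.mul_rpow_of_nonneg _ _ hp0.le, Real.enorm_of_nonneg (rootDensity_nonneg X),
    ENNReal.ofReal_rpow_of_nonneg (rootDensity_nonneg X) hp0.le, rootDensity_rpow hp,
    ENNReal.ofReal_toReal hX.ne]

lemma memLp_rootDensity_mul_iff [IsFiniteMeasure ν] (hp : 1 < p) (hν : ν ≪ volume)
    {s : Config N d → ℝ} (hs : AEMeasurable s volume) :
    MemLp (fun X => rootDensity p ν X * s X) (ENNReal.ofReal p) volume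
      ↔ MemLp s (ENNReal.ofReal p) ν := by
  rw [MemLp, MemLp, eLpNorm_rootDensity_mul hp hν hs]
  exact and_congr_left fun _ => ⟨fun _ => (hs.mono_ac hν).aestronglyMeasurable,
    fun _ => (measurable_rootDensity.aemeasurable.mul hs).aestronglyMeasurable⟩

lemma rpow_sub_one_mul_le {a b : ℝ} (hp : 1 < p) (ha : 0 ≤ a) (hb : 0 ≤ b) :
    a ^ (p - 1) * b ≤ a ^ p + b ^ p := by
  have key : ∀ c : ℝ, 0 ≤ c → c ^ (p - 1) * c = c ^ p := fun c hc => by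
    rw [← Real.rpow_add_one' hc (by linarith), sub_add_cancel]
  rcases le_total a b with h | h
  · calc a ^ (p - 1) * b ≤ b ^ (p - 1) * b := by
          gcongr
      _ ≤ _ := by rw [key b hb]; linarith [Real.rpow_nonneg ha p]
  · calc a ^ (p - 1) * b ≤ a ^ (p - 1) * a := by gcongr
      _ ≤ _ := by rw [key a ha]; linarith [Real.rpow_nonneg hb p]

/-- The power `t ^ p` is not Lipschitz, so its derivative is truncated at height `n` and integrated
back. The primitives increase to `t ^ p`, and `rpow_sub_one_mul_le` supplies an integrable bound for
the derivatives. -/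
lemma hasWeakLineDeriv_rpow {u G : Config N d → ℝ} {e : Config N d} (hp : 1 < p)
    (h : HasWeakLineDeriv volume e u G) (hu0 : ∀ X, 0 ≤ u X)
    (hu : MemLp u (ENNReal.ofReal p) volume) (hG : MemLp G (ENNReal.ofReal p) volume) :
    HasWeakLineDeriv volume e (fun X => u X ^ p) (fun X => p * u X ^ (p - 1) * G X) := by
  have hp0 : 0 < p := by linarith
  have h0 : ENNReal.ofReal p ≠ 0 := by simpa using hp0
  have hup : Integrable (fun X => u X ^ p) volume := by
    have := hu.integrable_norm_rpow h0 ENNReal.ofReal_ne_top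
    simpa only [ENNReal.toReal_ofReal hp0.le, Real.norm_of_nonneg (hu0 _)] using this
  have hGp : Integrable (fun X => |G X| ^ p) volume := by
    have := hG.integrable_norm_rpow h0 ENNReal.ofReal_ne_top
    simpa only [ENNReal.toReal_ofReal hp0.le, Real.norm_eq_abs] using this
  have hcont : Continuous fun t : ℝ => p * |t| ^ (p - 1) :=
    continuous_const.mul (continuous_abs.rpow_const fun _ => Or.inr (by linarith))
  let φ : ℕ → ℝ → ℝ := fun n t => min (p * |t| ^ (p - 1)) n
  have hφ : ∀ n, Continuous (φ n) := fun n => hcont.min continuous_const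
  have hφ0 : ∀ n t, 0 ≤ φ n t := fun n t => le_min (by positivity) n.cast_nonneg
  have hint : ∀ t, 0 ≤ t → ∫ s in (0 : ℝ)..t, p * |s| ^ (p - 1) = t ^ p := by
    intro t ht
    rw [intervalIntegral.integral_congr (g := fun s => p * s ^ (p - 1)),
      intervalIntegral.integral_const_mul, integral_rpow (Or.inl (by linarith))]
    · rw [sub_add_cancel, Real.zero_rpow hp0.ne']
      field_simp
      ring
    · intro s hs
      rw [Set.uIcc_of_le ht] at hs
      simp only [abs_of_nonneg hs.1]
  refine HasWeakLineDeriv.of_tendsto (gu := fun X => u X ^ p)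
    (gv := fun X => p * (u X ^ p + |G X| ^ p))
    (fun n => h.comp_primitive (hφ n) (L := n) fun t => by
      rw [abs_of_nonneg (hφ0 n t)]; exact min_le_right _ _)
    hup.locallyIntegrable ((hup.add hGp).const_mul p).locallyIntegrable
    (fun n => ae_of_all _ fun X => ?_) (fun n => ae_of_all _ fun X => ?_)
    (ae_of_all _ fun X => ?_) (ae_of_all _ fun X => ?_)
  · rw [abs_of_nonneg (intervalIntegral.integral_nonneg (hu0 X) fun s _ => hφ0 n s), ← hint _ (hu0 X)]
    exact intervalIntegral.integral_mono_on (hu0 X) ((hφ n).intervalIntegrable _ _)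
      (hcont.intervalIntegrable _ _) fun s _ => min_le_left _ _
  · rw [abs_mul, abs_of_nonneg (hφ0 n _)]
    calc φ n (u X) * |G X| ≤ (p * |u X| ^ (p - 1)) * |G X| := by
          gcongr; exact min_le_left _ _
      _ ≤ _ := by
          rw [abs_of_nonneg (hu0 X), mul_assoc]
          gcongr
          exact rpow_sub_one_mul_le hp (hu0 X) (abs_nonneg _)
  · rw [← hint _ (hu0 X)]
    refine tendsto_const_nhds.congr' ?_
    filter_upwards [eventually_ge_atTop ⌈p * u X ^ (p - 1)⌉₊] with n hn
    refine intervalIntegral.integral_congr fun s hs => ?_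
    rw [Set.uIcc_of_le (hu0 X)] at hs
    refine (min_eq_left ?_).symm
    refine le_trans ?_ (Nat.ceil_le.1 hn)
    rw [abs_of_nonneg hs.1]
    exact mul_le_mul_of_nonneg_left (Real.rpow_le_rpow hs.1 hs.2 (by linarith)) hp0.le
  · refine Tendsto.mul_const _ (tendsto_const_nhds.congr' ?_)
    filter_upwards [eventually_ge_atTop ⌈p * u X ^ (p - 1)⌉₊] with n hn
    simp only [φ, abs_of_nonneg (hu0 X)]
    exact (min_eq_left (Nat.ceil_le.1 hn)).symm

/-- With `u` the root density, `∂(u^p) = p u^{p-1} ∂u = u^p (p ∂u / u)`, so the score is `p ∂u / u`.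
-/
lemma IsW1pRegular.exists_isScore (hp : 1 < p) (hν : IsW1pRegular p ν) (k : Fin N) (i : Fin d) :
    ∃ s, Measurable s ∧ MemLp s (ENNReal.ofReal p) ν ∧ IsScore ν (coordVec k i) s := by
  have := hν.isProbabilityMeasure
  have hp0 : 0 < p := by linarith
  have hp1 : 1 ≤ ENNReal.ofReal p := by simpa using hp.le
  have hac := hν.absolutelyContinuous
  obtain ⟨hu, G, hG, hGp⟩ := hν.memW1p
  have hw : HasWeakLineDeriv volume (coordVec k i) _ _ :=
    hasWeakLineDeriv_rpow hp (hG k i) rootDensity_nonneg hu (hGp k i)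
  set u := rootDensity p ν with hu_def
  set g : Config N d → ℝ := (hGp k i).1.mk (G k i)
  have hg : Measurable g := (hGp k i).1.stronglyMeasurable_mk.measurable
  have hgG : G k i =ᵐ[volume] g := (hGp k i).1.ae_eq_mk
  have hum : Measurable u := measurable_rootDensity
  -- Division by zero makes the score `0` where `u = 0`. This is consistent, as both `u^p` and
  -- `u^{p-1}` vanish there because `p > 1`.
  have hs : Measurable fun X => p * g X / u X := (hg.const_mul p).div hum
  have hsL : MemLp (fun X => p * g X / u X) (ENNReal.ofReal p) ν := by
    rw [← memLp_rootDensity_mul_iff hp hac hs.aemeasurable]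
    refine (((hGp k i).ae_eq hgG).const_mul p).mono (hum.mul hs).aestronglyMeasurable
      (ae_of_all _ fun X => ?_)
    rw [← hu_def]
    by_cases h0 : u X = 0
    · rw [h0, zero_mul, norm_zero]; exact norm_nonneg _
    · rw [mul_div_cancel₀ _ h0]
  refine ⟨_, hs, hsL, IsScore.of_hasCompactSupport (hsL.integrable hp1) fun φ hφ hφc => ?_⟩
  rw [← integral_rnDeriv_smul hac, ← integral_rnDeriv_smul hac]
  simp only [← rootDensity_rpow hp, ← hu_def, smul_eq_mul]
  rw [hw.2.2 φ hφ hφc]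
  congr 1
  refine integral_congr_ae ?_
  filter_upwards [hgG] with X hX
  rw [hX]
  by_cases h0 : u X = 0
  · simp [h0, Real.zero_rpow (by linarith : p - 1 ≠ 0)]
  · have h1 : u X ^ p = u X ^ (p - 1) * u X := by
      rw [← Real.rpow_add_one h0, sub_add_cancel]
    rw [h1]
    field_simp

/-- The root has infinite slope at `0`. The chain rule is applied to `(t + δ)^{1/p} - δ^{1/p}`,
which is at most `t^{1/p}` by subadditivity and whose derivative times `t` is at most `(1/p)
t^{1/p}`; then `δ → 0`. -/
lemma IsScore.hasWeakLineDeriv_rootDensity [IsFiniteMeasure ν] (hp : 1 < p) (hν : ν ≪ volume)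
    {e : Config N d} {s : Config N d → ℝ} (hs : Measurable s) (hsL : MemLp s (ENNReal.ofReal p) ν)
    (h : IsScore ν e s) :
    HasWeakLineDeriv volume e (rootDensity p ν)
      (fun X => 1 / p * (rootDensity p ν X * s X)) := by
  have hp0 : 0 < p := by linarith
  have hp1 : 1 ≤ ENNReal.ofReal p := by simpa using hp.le
  have hip : 0 < 1 / p := by positivity
  have hip1 : 1 / p < 1 := (div_lt_one hp0).2 hp
  set θ : Config N d → ℝ := fun X => (ν.rnDeriv volume X).toReal
  have hθ0 : ∀ X, 0 ≤ θ X := fun X => ENNReal.toReal_nonneg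
  have hθi : Integrable θ volume := Measure.integrable_toReal_rnDeriv
  have hw : HasWeakLineDeriv volume e θ (fun X => θ X * s X) := by
    refine ⟨hθi.locallyIntegrable,
      ((integrable_rnDeriv_smul_iff hν).2 h.integrable).locallyIntegrable, fun φ hφ hφc => ?_⟩
    have h1 := h.ibp φ hφ (by simpa using hφc.exists_bound_of_continuous hφ.continuous)
      ((hφc.fderiv ℝ).exists_bound_of_continuous (hφ.continuous_fderiv (by simp)))
    rw [← integral_rnDeriv_smul hν, ← integral_rnDeriv_smul hν] at h1
    simpa only [smul_eq_mul, mul_comm (φ _), mul_assoc] using h1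
  have hup : MemLp (rootDensity p ν) (ENNReal.ofReal p) volume := by
    have := (memLp_rootDensity_mul_iff hp hν (s := fun _ => 1) aemeasurable_const).2
      (memLp_const 1)
    simpa using this
  have husp : MemLp (fun X => rootDensity p ν X * s X) (ENNReal.ofReal p) volume :=
    (memLp_rootDensity_mul_iff hp hν hs.aemeasurable).2 hsL
  let δ : ℕ → ℝ := fun n => 1 / ((n : ℝ) + 1)
  have hδ0 : ∀ n, 0 < δ n := fun n => by positivity
  have hδ : Tendsto δ atTop (𝓝 0) := tendsto_one_div_add_atTop_nhds_zero_nat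
  let φ : ℕ → ℝ → ℝ := fun n t => 1 / p * (|t| + δ n) ^ (1 / p - 1)
  have hpos : ∀ n t, 0 < |t| + δ n := fun n t => add_pos_of_nonneg_of_pos (abs_nonneg t) (hδ0 n)
  have hφ : ∀ n, Continuous (φ n) := fun n => continuous_const.mul
    ((continuous_abs.add continuous_const).rpow_const fun t => Or.inl (hpos n t).ne')
  have hφ0 : ∀ n t, 0 ≤ φ n t := fun n t =>
    mul_nonneg hip.le (Real.rpow_nonneg (hpos n t).le _)
  have hint : ∀ n t, 0 ≤ t → ∫ s in (0 : ℝ)..t, φ n s = (t + δ n) ^ (1 / p) - δ n ^ (1 / p) := by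
    intro n t ht
    rw [intervalIntegral.integral_congr (g := fun s => 1 / p * (s + δ n) ^ (1 / p - 1)),
      intervalIntegral.integral_const_mul,
      intervalIntegral.integral_comp_add_right (fun s => s ^ (1 / p - 1)),
      integral_rpow (Or.inl (by linarith))]
    · rw [sub_add_cancel, zero_add]
      field_simp
    · intro s hs
      rw [Set.uIcc_of_le ht] at hs
      simp only [φ, abs_of_nonneg hs.1]
  refine HasWeakLineDeriv.of_tendsto (gu := rootDensity p ν)
    (gv := fun X => 1 / p * |rootDensity p ν X * s X|)
    (fun n => hw.comp_primitive (hφ n) (L := 1 / p * δ n ^ (1 / p - 1)) fun t => by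
      rw [abs_of_nonneg (hφ0 n t)]
      refine mul_le_mul_of_nonneg_left ?_ hip.le
      exact Real.rpow_le_rpow_of_nonpos (hδ0 n) (by simp) (by linarith))
    (hup.locallyIntegrable hp1) ((husp.norm.const_mul (1 / p)).locallyIntegrable hp1)
    (fun n => ae_of_all _ fun X => ?_) (fun n => ae_of_all _ fun X => ?_)
    (ae_of_all _ fun X => ?_) (ae_of_all _ fun X => ?_)
  · rw [abs_of_nonneg (intervalIntegral.integral_nonneg (hθ0 X) fun s _ => hφ0 n s),
      hint _ _ (hθ0 X), sub_le_iff_le_add]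
    exact Real.rpow_add_le_add_rpow (hθ0 X) (hδ0 n).le hip.le hip1.le
  · rw [abs_mul, abs_of_nonneg (hφ0 n _), abs_mul, abs_mul, abs_of_nonneg (hθ0 X),
      abs_of_nonneg (rootDensity_nonneg X), ← mul_assoc, ← mul_assoc]
    refine mul_le_mul_of_nonneg_right ?_ (abs_nonneg _)
    rw [show φ n (θ X) = 1 / p * (θ X + δ n) ^ (1 / p - 1) by simp only [φ, abs_of_nonneg (hθ0 X)],
      mul_assoc]
    refine mul_le_mul_of_nonneg_left ?_ hip.le
    rcases (hθ0 X).eq_or_lt with h0 | h0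
    · rw [← h0, mul_zero]; exact rootDensity_nonneg X
    · calc (θ X + δ n) ^ (1 / p - 1) * θ X ≤ θ X ^ (1 / p - 1) * θ X :=
            mul_le_mul_of_nonneg_right (Real.rpow_le_rpow_of_nonpos h0
              (le_add_of_nonneg_right (hδ0 n).le) (sub_nonpos.2 hip1.le)) h0.le
        _ = θ X ^ (1 / p) := by rw [← Real.rpow_add_one h0.ne', sub_add_cancel]
        _ = _ := rfl
  · simp only [hint _ _ (hθ0 X)]
    have h1 : Tendsto (fun n => θ X + δ n) atTop (𝓝 (θ X)) := by simpa using hδ.const_add (θ X)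
    have h2 := (h1.rpow_const (p := 1 / p) (Or.inr hip.le)).sub
      (hδ.rpow_const (p := 1 / p) (Or.inr hip.le))
    rw [Real.zero_rpow hip.ne', sub_zero] at h2
    exact h2
  -- Where `θ` vanishes the slopes blow up, but the factor `θ X` makes each term and the limit zero.
  · rcases (hθ0 X).eq_or_lt with h0 | h0
    · have : rootDensity p ν X = 0 := by
        rw [rootDensity, show (ν.rnDeriv volume X).toReal = 0 from h0.symm,
          Real.zero_rpow hip.ne']
      simp [← h0, this]
    · have h1 : Tendsto (fun n => |θ X| + δ n) atTop (𝓝 (θ X)) := by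
        simpa [abs_of_nonneg h0.le] using hδ.const_add |θ X|
      have h2 := ((h1.rpow_const (p := 1 / p - 1) (Or.inl h0.ne')).const_mul (1 / p)).mul_const
        (θ X * s X)
      have h3 : rootDensity p ν X = θ X ^ (1 / p - 1) * θ X := by
        rw [← Real.rpow_add_one h0.ne', sub_add_cancel]; rfl
      rw [h3, show 1 / p * (θ X ^ (1 / p - 1) * θ X * s X)
        = 1 / p * θ X ^ (1 / p - 1) * (θ X * s X) by ring]
      exact h2

end RootDensity

/-! ### Product measures and product densities -/

section ProductMeasures

lemma lintegral_pi_prod {α : Type*} [MeasurableSpace α] : ∀ {N : ℕ} (μ : Fin N → Measure α)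
    [∀ j, SigmaFinite (μ j)] {f : Fin N → α → ℝ≥0∞}, (∀ j, Measurable (f j)) →
    ∫⁻ x, ∏ j, f j (x j) ∂Measure.pi μ = ∏ j, ∫⁻ x, f j x ∂μ j
  | 0, μ, _, f, _ => by simp
  | n + 1, μ, _, f, hf => by
    have ih := lintegral_pi_prod (fun j => μ (Fin.succ j)) (fun j => hf (Fin.succ j))
    have hm : Measurable fun x : Fin (n + 1) → α => ∏ j, f j (x j) := by fun_prop
    rw [← ((measurePreserving_piFinSuccAbove μ 0).symm).lintegral_comp hm]
    simp only [MeasurableEquiv.piFinSuccAbove_symm_apply, Fin.insertNthEquiv,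
      Fin.prod_univ_succ, Fin.insertNth_zero, Equiv.coe_fn_mk, Fin.cons_succ, Fin.cons_zero,
      Fin.zero_succAbove, cast_eq]
    rw [lintegral_prod_mul (f := f 0) (g := fun x : Fin n → α => ∏ j : Fin n, f (Fin.succ j) (x j)) (hf 0).aemeasurable
      (Finset.measurable_fun_prod _ fun j _ =>
        (hf j.succ).comp (measurable_pi_apply j)).aemeasurable, ih]

variable {α : Type*} [MeasurableSpace α] {N : ℕ} (μ : Fin N → Measure α)
  [∀ j, SigmaFinite (μ j)]

lemma pi_withDensity {f : Fin N → α → ℝ≥0∞} (hf : ∀ j, Measurable (f j))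
    [∀ j, SigmaFinite ((μ j).withDensity (f j))] :
    Measure.pi (fun j => (μ j).withDensity (f j))
      = (Measure.pi μ).withDensity fun x => ∏ j, f j (x j) := by
  refine Measure.pi_eq (μ := fun j => (μ j).withDensity (f j)) fun s hs => ?_
  rw [withDensity_apply _ (MeasurableSet.univ_pi hs),
    ← lintegral_indicator (MeasurableSet.univ_pi hs)]
  rw [show (∏ j, (μ j).withDensity (f j) (s j)) = ∏ j, ∫⁻ x, (s j).indicator (f j) x ∂μ j from
    Finset.prod_congr rfl fun j _ => by
      rw [withDensity_apply _ (hs j), lintegral_indicator (hs j)]]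
  rw [← lintegral_pi_prod μ fun j => (hf j).indicator (hs j)]
  refine lintegral_congr fun x => ?_
  by_cases hx : x ∈ Set.univ.pi s
  · rw [Set.indicator_of_mem hx]
    exact Finset.prod_congr rfl fun j _ => (Set.indicator_of_mem (hx j trivial) _).symm
  · rw [Set.indicator_of_notMem hx]
    simp only [Set.mem_pi, Set.mem_univ, true_imp_iff, not_forall] at hx
    obtain ⟨j, hj⟩ := hx
    exact (Finset.prod_eq_zero (Finset.mem_univ j) (Set.indicator_of_notMem hj _)).symm

lemma lintegral_pi_prod_eq_one {f : Fin N → α → ℝ≥0∞} (hf : ∀ j, Measurable (f j))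
    (h1 : ∀ j, ∫⁻ x, f j x ∂μ j = 1) : ∫⁻ x, ∏ j, f j (x j) ∂Measure.pi μ = 1 := by
  rw [lintegral_pi_prod μ hf]
  simp [h1]

/-- Under the product of the probability measures `f j · μ j`, the `k`-th coordinate has law `f k ·
μ k`. -/
lemma lintegral_pi_prod_mul {f : Fin N → α → ℝ≥0∞} (hf : ∀ j, Measurable (f j))
    (h1 : ∀ j, ∫⁻ x, f j x ∂μ j = 1) (k : Fin N) {g : α → ℝ≥0∞} (hg : Measurable g) :
    ∫⁻ x, (∏ j, f j (x j)) * g (x k) ∂Measure.pi μ = ∫⁻ x, f k x * g x ∂μ k := by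
  have hp : ∀ j, IsProbabilityMeasure ((μ j).withDensity (f j)) := fun j =>
    ⟨by rw [withDensity_apply _ .univ, Measure.restrict_univ, h1]⟩
  have h2 := lintegral_withDensity_eq_lintegral_mul (Measure.pi μ)
    (show Measurable fun x : Fin N → α => ∏ j, f j (x j) by fun_prop)
    (hg.comp (measurable_pi_apply k))
  rw [← pi_withDensity μ hf] at h2
  simp only [Pi.mul_apply, Function.comp_apply] at h2
  rw [← h2, ← lintegral_map hg (measurable_pi_apply k),
    (measurePreserving_eval (fun j => (μ j).withDensity (f j)) k).map_eq,
    lintegral_withDensity_eq_lintegral_mul _ (hf k) hg]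
  rfl

/-- Resampling one coordinate keeps a product law; this lets integration by parts act on that
coordinate with the others frozen. -/
lemma measurePreserving_update [∀ j, IsProbabilityMeasure (μ j)] (k : Fin N) :
    MeasurePreserving (fun Xz : (Fin N → α) × α => Function.update Xz.1 k Xz.2)
      ((Measure.pi μ).prod (μ k)) (Measure.pi μ) := by
  have hm : Measurable fun Xz : (Fin N → α) × α => Function.update Xz.1 k Xz.2 := by
    rw [measurable_pi_iff]
    intro j
    by_cases hj : j = k
    · subst hj; simpa using measurable_snd
    · simp only [Function.update_of_ne hj]; fun_prop
  refine ⟨hm, (Measure.pi_eq fun s hs => ?_).symm⟩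
  rw [Measure.map_apply hm (MeasurableSet.univ_pi hs)]
  have : (fun Xz : (Fin N → α) × α => Function.update Xz.1 k Xz.2) ⁻¹' Set.univ.pi s
      = (Set.univ.pi (Function.update s k Set.univ)) ×ˢ s k := by
    ext ⟨X, z⟩
    simp only [Set.mem_preimage, Set.mem_pi, Set.mem_univ, true_imp_iff, Set.mem_prod]
    constructor
    · intro h
      refine ⟨fun j => ?_, by simpa using h k⟩
      by_cases hj : j = k
      · subst hj; simp
      · simpa [Function.update_of_ne hj] using h j
    · rintro ⟨h1, h2⟩ j
      by_cases hj : j = k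
      · subst hj; simpa using h2
      · simpa [Function.update_of_ne hj] using h1 j
  rw [this, Measure.prod_prod, Measure.pi_pi, ← Finset.prod_erase_mul _ _ (Finset.mem_univ k),
    ← Finset.prod_erase_mul (f := fun j => μ j (s j)) _ (Finset.mem_univ k)]
  congr 1
  simp only [Function.update_self, measure_univ, mul_one]
  refine Finset.prod_congr rfl fun j hj => ?_
  rw [Function.update_of_ne (Finset.ne_of_mem_erase hj)]

end ProductMeasures

/-! ### Test functions bounded together with their derivative -/

section BoundedSmooth

variable {E F : Type*} [NormedAddCommGroup E] [NormedSpace ℝ E]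
  [NormedAddCommGroup F] [NormedSpace ℝ F]

/-- Smooth functions that are bounded together with their derivative. -/
structure BoundedSmooth (φ : E → ℝ) : Prop where
  contDiff : ContDiff ℝ ∞ φ
  bound : ∃ C, ∀ x, |φ x| ≤ C
  bound_fderiv : ∃ C, ∀ x, ‖fderiv ℝ φ x‖ ≤ C

lemma BoundedSmooth.differentiable {φ : E → ℝ} (h : BoundedSmooth φ) : Differentiable ℝ φ :=
  h.contDiff.differentiable (by simp)

lemma BoundedSmooth.mul {φ ψ : E → ℝ} (hφ : BoundedSmooth φ) (hψ : BoundedSmooth ψ) :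
    BoundedSmooth fun x => φ x * ψ x := by
  obtain ⟨C, hC⟩ := hφ.bound
  obtain ⟨D, hD⟩ := hψ.bound
  obtain ⟨C', hC'⟩ := hφ.bound_fderiv
  obtain ⟨D', hD'⟩ := hψ.bound_fderiv
  have hC0 : 0 ≤ C := (abs_nonneg _).trans (hC 0)
  have hD0 : 0 ≤ D := (abs_nonneg _).trans (hD 0)
  refine ⟨hφ.contDiff.mul hψ.contDiff, ⟨C * D, fun x => ?_⟩, ⟨C * D' + D * C', fun x => ?_⟩⟩
  · rw [abs_mul]
    exact mul_le_mul (hC x) (hD x) (abs_nonneg _) hC0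
  · rw [fderiv_fun_mul (hφ.differentiable x) (hψ.differentiable x)]
    refine (norm_add_le _ _).trans (add_le_add ?_ ?_)
    · rw [norm_smul]
      exact mul_le_mul (hC x) (hD' x) (norm_nonneg _) hC0
    · rw [norm_smul]
      exact mul_le_mul (hD x) (hC' x) (norm_nonneg _) hD0

lemma BoundedSmooth.const (c : ℝ) : BoundedSmooth fun _ : E => c :=
  ⟨contDiff_const, ⟨|c|, fun _ => le_rfl⟩, ⟨0, fun x => by simp⟩⟩

lemma BoundedSmooth.prod {ι : Type*} {φ : ι → E → ℝ} (s : Finset ι)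
    (h : ∀ i, BoundedSmooth (φ i)) : BoundedSmooth fun x => ∏ i ∈ s, φ i x := by
  classical
  induction s using Finset.induction_on with
  | empty => simpa using BoundedSmooth.const 1
  | insert i s hi ih =>
    simp only [Finset.prod_insert hi]
    exact (h i).mul ih

lemma BoundedSmooth.comp_affine {φ : F → ℝ} (hφ : BoundedSmooth φ) (L : E →L[ℝ] F) (c : F) :
    BoundedSmooth fun x => φ (c + L x) := by
  obtain ⟨C, hC⟩ := hφ.bound
  obtain ⟨C', hC'⟩ := hφ.bound_fderiv
  refine ⟨hφ.contDiff.comp (contDiff_const.add L.contDiff), ⟨C, fun x => hC _⟩,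
    ⟨C' * ‖L‖, fun x => ?_⟩⟩
  have h1 := (hφ.differentiable (c + L x)).hasFDerivAt.comp x (L.hasFDerivAt.const_add c)
  have h2 : fderiv ℝ (fun x => φ (c + L x)) x = (fderiv ℝ φ (c + L x)).comp L := h1.fderiv
  rw [h2]
  exact (ContinuousLinearMap.opNorm_comp_le _ _).trans (by gcongr; exact hC' _)

lemma BoundedSmooth.fderiv_comp_affine {φ : F → ℝ} (hφ : BoundedSmooth φ) (L : E →L[ℝ] F) (c : F)
    (x e : E) : fderiv ℝ (fun x => φ (c + L x)) x e = fderiv ℝ φ (c + L x) (L e) := by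
  have h1 := (hφ.differentiable (c + L x)).hasFDerivAt.comp x (L.hasFDerivAt.const_add c)
  have h2 : fderiv ℝ (fun x => φ (c + L x)) x = (fderiv ℝ φ (c + L x)).comp L := h1.fderiv
  rw [h2]; rfl

end BoundedSmooth

/-! ### The heat kernel -/

section HeatKernel

variable {d : ℕ} {ε : ℝ}

lemma heatKernel_pos (hε : 0 < ε) (z : EuclideanSpace ℝ (Fin d)) : 0 < heatKernel ε z := by
  unfold heatKernel
  positivity

lemma contDiff_heatKernel : ContDiff ℝ ∞ (heatKernel (d := d) ε) := by
  unfold heatKernel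
  exact contDiff_const.mul (((contDiff_norm_sq ℝ).neg.div_const _).exp)

@[fun_prop]
lemma measurable_heatKernel : Measurable (heatKernel (d := d) ε) :=
  contDiff_heatKernel.continuous.measurable

lemma fderiv_heatKernel (z e : EuclideanSpace ℝ (Fin d)) :
    fderiv ℝ (heatKernel ε) z e = -(inner ℝ z e / ε) * heatKernel ε z := by
  have h1 : HasFDerivAt (fun z : EuclideanSpace ℝ (Fin d) => ‖z‖ ^ 2) (2 • innerSL ℝ z) z :=
    (hasStrictFDerivAt_norm_sq z).hasFDerivAt
  have h2 := ((h1.neg.mul_const (2 * ε)⁻¹).exp).const_mul (1 / (2 * Real.pi * ε) ^ ((d : ℝ) / 2))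
  have h3 : fderiv ℝ (heatKernel ε) z = _ := h2.fderiv
  rw [h3]
  simp [heatKernel, div_eq_mul_inv]
  ring

lemma heatKernel_le (hε : 0 < ε) (z : EuclideanSpace ℝ (Fin d)) :
    heatKernel ε z ≤ 1 / (2 * Real.pi * ε) ^ ((d : ℝ) / 2) := by
  unfold heatKernel
  refine mul_le_of_le_one_right (by positivity) (Real.exp_le_one_iff.2 ?_)
  exact div_nonpos_of_nonpos_of_nonneg (by simp) (by positivity)

/-- Half of the Gaussian exponent absorbs `‖z‖` at the cost of `2 √ε`; the other half is the
exponent at variance `2ε`, and `2^{d/2}` is the ratio of the normalising constants. Integrated, this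
is the `O(√ε)` bound on displacements. -/
lemma norm_mul_heatKernel_le (hε : 0 < ε) (z : EuclideanSpace ℝ (Fin d)) :
    ‖z‖ * heatKernel ε z ≤ (2 * 2 ^ ((d : ℝ) / 2)) * √ε * heatKernel (2 * ε) z := by
  have hs : √ε ^ 2 = ε := Real.sq_sqrt hε.le
  have hs0 : 0 < √ε := Real.sqrt_pos.2 hε
  -- With `a = ‖z‖² / (4ε)`, use `1 + a ≤ exp a`; the remaining inequality `‖z‖ ≤ 2 √ε (1 + a)` is a
  -- completed square.
  have h1 : ‖z‖ * Real.exp (-‖z‖ ^ 2 / (4 * ε)) ≤ 2 * √ε := by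
    have h2 : ‖z‖ ^ 2 / (4 * ε) + 1 ≤ Real.exp (‖z‖ ^ 2 / (4 * ε)) := Real.add_one_le_exp _
    have h3 : ‖z‖ ≤ 2 * √ε * (‖z‖ ^ 2 / (4 * ε) + 1) := by
      have h4 : 2 * √ε * (‖z‖ ^ 2 / (4 * ε) + 1) = ‖z‖ ^ 2 / (2 * √ε) + 2 * √ε := by
        nth_rewrite 2 [← hs]
        field_simp
        ring
      rw [h4, ← sub_nonneg]
      have : ‖z‖ ^ 2 / (2 * √ε) + 2 * √ε - ‖z‖
          = ((‖z‖ - √ε) ^ 2 + 3 * √ε ^ 2) / (2 * √ε) := by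
        field_simp
        ring
      rw [this]
      positivity
    rw [neg_div, Real.exp_neg, ← div_eq_mul_inv, div_le_iff₀ (Real.exp_pos _)]
    exact h3.trans (by gcongr)
  have h5 : Real.exp (-‖z‖ ^ 2 / (2 * ε))
      = Real.exp (-‖z‖ ^ 2 / (4 * ε)) * Real.exp (-‖z‖ ^ 2 / (2 * (2 * ε))) := by
    rw [← Real.exp_add]; congr 1; field_simp; ring
  have h6 : (2 * Real.pi * (2 * ε)) ^ ((d : ℝ) / 2)
      = 2 ^ ((d : ℝ) / 2) * (2 * Real.pi * ε) ^ ((d : ℝ) / 2) := by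
    rw [← Real.mul_rpow (by norm_num) (by positivity)]; congr 1; ring
  have hA : 0 < (2 * Real.pi * ε) ^ ((d : ℝ) / 2) := by positivity
  unfold heatKernel
  rw [h5, h6]
  calc _ = (‖z‖ * Real.exp (-‖z‖ ^ 2 / (4 * ε))) * (1 / (2 * Real.pi * ε) ^ ((d : ℝ) / 2)
        * Real.exp (-‖z‖ ^ 2 / (2 * (2 * ε)))) := by ring
    _ ≤ (2 * √ε) * (1 / (2 * Real.pi * ε) ^ ((d : ℝ) / 2)
        * Real.exp (-‖z‖ ^ 2 / (2 * (2 * ε)))) := by gcongr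
    _ = _ := by field_simp

lemma norm_fderiv_heatKernel_le (hε : 0 < ε) (z : EuclideanSpace ℝ (Fin d)) :
    ‖fderiv ℝ (heatKernel ε) z‖ ≤ ‖z‖ / ε * heatKernel ε z := by
  refine ContinuousLinearMap.opNorm_le_bound _
    (mul_nonneg (by positivity) (heatKernel_pos hε z).le) fun e => ?_
  rw [fderiv_heatKernel, norm_mul, norm_neg, norm_div, Real.norm_of_nonneg hε.le,
    Real.norm_of_nonneg (heatKernel_pos hε z).le]
  calc _ ≤ ‖z‖ * ‖e‖ / ε * heatKernel ε z := by
        have := (heatKernel_pos hε z).le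
        gcongr
        exact norm_inner_le_norm z e
    _ = _ := by ring

lemma boundedSmooth_heatKernel (hε : 0 < ε) : BoundedSmooth (heatKernel (d := d) ε) := by
  refine ⟨contDiff_heatKernel, ⟨1 / (2 * Real.pi * ε) ^ ((d : ℝ) / 2), fun z => ?_⟩, ⟨2 * 2 ^ ((d : ℝ) / 2) * √ε *
    (1 / (2 * Real.pi * (2 * ε)) ^ ((d : ℝ) / 2)) / ε, fun z => ?_⟩⟩
  · rw [abs_of_pos (heatKernel_pos hε z)]
    exact heatKernel_le hε z
  · refine (norm_fderiv_heatKernel_le hε z).trans ?_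
    rw [div_mul_eq_mul_div]
    refine div_le_div_of_nonneg_right ((norm_mul_heatKernel_le hε z).trans ?_) hε.le
    gcongr
    exact heatKernel_le (by positivity) z

lemma integral_heatKernel (hε : 0 < ε) :
    ∫ z : EuclideanSpace ℝ (Fin d), heatKernel ε z = 1 := by
  unfold heatKernel
  have h := GaussianFourier.integral_rexp_neg_mul_sq_norm (V := EuclideanSpace ℝ (Fin d))
    (b := 1 / (2 * ε)) (by positivity)
  rw [integral_const_mul]
  rw [show (fun z : EuclideanSpace ℝ (Fin d) => Real.exp (-‖z‖ ^ 2 / (2 * ε)))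
    = fun z => Real.exp (-(1 / (2 * ε)) * ‖z‖ ^ 2) by ext z; congr 1; ring]
  rw [h, finrank_euclideanSpace_fin, show Real.pi / (1 / (2 * ε)) = 2 * Real.pi * ε by
    field_simp]
  field_simp

lemma lintegral_heatKernel (hε : 0 < ε) :
    ∫⁻ z : EuclideanSpace ℝ (Fin d), ENNReal.ofReal (heatKernel ε z) = 1 := by
  rw [← ofReal_integral_eq_lintegral_ofReal _ (ae_of_all _ fun z => (heatKernel_pos hε z).le),
    integral_heatKernel hε, ENNReal.ofReal_one]
  -- A non-integrable function has integral `0` by convention, so the value `1` forces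
  -- integrability.
  by_contra h
  have := integral_undef h
  rw [integral_heatKernel hε] at this
  exact one_ne_zero this

lemma lintegral_heatKernel_sub (hε : 0 < ε) (x : EuclideanSpace ℝ (Fin d)) :
    ∫⁻ y : EuclideanSpace ℝ (Fin d), ENNReal.ofReal (heatKernel ε (y - x)) = 1 := by
  rw [lintegral_sub_right_eq_self (fun y => ENNReal.ofReal (heatKernel ε y)) x,
    lintegral_heatKernel hε]

end HeatKernel

/-! ### The smoothed marginals and the triple `(X', Y, X)` -/

section Measurability

variable {α β γ : Type*} [MeasurableSpace α] [MeasurableSpace β] [MeasurableSpace γ]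

lemma measurable_comp_uncurry {F : β → γ → ℝ≥0∞} (hF : Measurable (Function.uncurry F))
    {f : α → β} {g : α → γ} (hf : Measurable f) (hg : Measurable g) :
    Measurable fun a => F (f a) (g a) :=
  hF.comp (hf.prodMk hg)

end Measurability

section ConvDensity

variable {d : ℕ} {ε : ℝ} {ρ : Measure (EuclideanSpace ℝ (Fin d))}

lemma measurable_convDensity [SFinite ρ] : Measurable (convDensity ε ρ) := by
  unfold convDensity
  exact Measurable.lintegral_prod_right' (ν := ρ)
    (f := fun yx : EuclideanSpace ℝ (Fin d) × EuclideanSpace ℝ (Fin d) =>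
      ENNReal.ofReal (heatKernel ε (yx.1 - yx.2))) (by fun_prop)

variable [IsProbabilityMeasure ρ]

lemma convDensity_ne_zero (hε : 0 < ε) (y : EuclideanSpace ℝ (Fin d)) : convDensity ε ρ y ≠ 0 := by
  unfold convDensity
  rw [Ne, lintegral_eq_zero_iff (by fun_prop)]
  intro h
  have : ∀ᵐ x ∂ρ, False := by
    filter_upwards [h] with x hx
    have := heatKernel_pos hε (y - x)
    simp only [Pi.zero_apply, ENNReal.ofReal_eq_zero] at hx
    linarith
  rw [ae_iff] at this
  simp at this

lemma convDensity_ne_top (hε : 0 < ε) (y : EuclideanSpace ℝ (Fin d)) : convDensity ε ρ y ≠ ⊤ := by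
  refine ne_top_of_le_ne_top (b := ∫⁻ _, ENNReal.ofReal (1 / (2 * Real.pi * ε) ^ ((d : ℝ) / 2)) ∂ρ)
    (by simp) (lintegral_mono fun x => ENNReal.ofReal_le_ofReal (heatKernel_le hε _))

lemma lintegral_heatKernel_div_convDensity (hε : 0 < ε) (y : EuclideanSpace ℝ (Fin d)) :
    ∫⁻ x, ENNReal.ofReal (heatKernel ε (y - x)) / convDensity ε ρ y ∂ρ = 1 := by
  simp only [div_eq_mul_inv]
  rw [lintegral_mul_const _ (by fun_prop)]
  exact ENNReal.mul_inv_cancel (convDensity_ne_zero (ρ := ρ) hε y) (convDensity_ne_top hε y)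

end ConvDensity

section TripleMeasure

variable {N d : ℕ}

/-- The Lebesgue measure on the configuration space. -/
def lebesgue (N d : ℕ) : Measure (Config N d) := volume

instance sigmaFinite_lebesgue (N d : ℕ) : SigmaFinite (lebesgue N d) :=
  inferInstanceAs (SigmaFinite (volume : Measure (Config N d)))

instance isAddHaarMeasure_lebesgue (N d : ℕ) : (lebesgue N d).IsAddHaarMeasure :=
  inferInstanceAs ((volume : Measure (Config N d)).IsAddHaarMeasure)

/-- The density of the Gaussian transition from `X` to `Y`. -/
def forwardDensity (ε : ℝ) (X Y : Config N d) : ℝ≥0∞ :=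
  ∏ k, ENNReal.ofReal (heatKernel ε (Y k - X k))

/-- The density, with respect to the product of the `ρ k`, of the transition from `Y` to `X`
that reverses the Gaussian one. -/
def backwardDensity (ε : ℝ) (ρ : Fin N → Measure (EuclideanSpace ℝ (Fin d)))
    (X Y : Config N d) : ℝ≥0∞ :=
  ∏ k, ENNReal.ofReal (heatKernel ε (Y k - X k)) / convDensity ε (ρ k) (Y k)

/-- The law of `(X', Y, X)`, where `X'` has law `ν`, `Y` is obtained from `X'` by adding Gaussian
noise and `X` is obtained from `Y` by the reversed transition. -/
def tripleMeasure (ε : ℝ) (ρ : Fin N → Measure (EuclideanSpace ℝ (Fin d)))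
    (ν : Measure (Config N d)) : Measure (Config N d × Config N d × Config N d) :=
  (ν.prod ((lebesgue N d).prod (Measure.pi ρ))).withDensity fun w =>
    forwardDensity ε w.1 w.2.1 * backwardDensity ε ρ w.2.2 w.2.1

variable {ε : ℝ} {ρ : Fin N → Measure (EuclideanSpace ℝ (Fin d))}
  {ν : Measure (Config N d)}

@[fun_prop]
lemma measurable_forwardDensity {α : Type*} [MeasurableSpace α] {f g : α → Config N d}
    (hf : Measurable f) (hg : Measurable g) :
    Measurable fun a => forwardDensity ε (f a) (g a) := by
  unfold forwardDensity
  fun_prop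

lemma lintegral_comp_apply_of_marginal {k : Fin N} (hk : marginal ν k = ρ k)
    {g : EuclideanSpace ℝ (Fin d) → ℝ≥0∞} (hg : Measurable g) :
    ∫⁻ X, g (X k) ∂ν = ∫⁻ x, g x ∂ρ k := by
  rw [← hk, marginal, lintegral_map hg (measurable_pi_apply k)]

variable [∀ k, IsProbabilityMeasure (ρ k)]

@[fun_prop]
lemma measurable_backwardDensity {α : Type*} [MeasurableSpace α] {f g : α → Config N d}
    (hf : Measurable f) (hg : Measurable g) :
    Measurable fun a => backwardDensity ε ρ (f a) (g a) := by
  unfold backwardDensity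
  refine Finset.measurable_fun_prod _ fun k _ => ?_
  exact Measurable.div (by fun_prop) (measurable_convDensity.comp (by fun_prop))

lemma lintegral_forwardDensity (hε : 0 < ε) (X : Config N d) :
    ∫⁻ Y, forwardDensity ε X Y ∂lebesgue N d = 1 :=
  lintegral_pi_prod_eq_one (fun _ => volume)
    (f := fun k y => ENNReal.ofReal (heatKernel ε (y - X k))) (fun k => by fun_prop)
    fun k => lintegral_heatKernel_sub hε (X k)

lemma lintegral_forwardDensity_mul (hε : 0 < ε) (X : Config N d) (k : Fin N)
    {g : EuclideanSpace ℝ (Fin d) → ℝ≥0∞} (hg : Measurable g) :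
    ∫⁻ Y, forwardDensity ε X Y * g (Y k) ∂lebesgue N d
      = ∫⁻ y, ENNReal.ofReal (heatKernel ε (y - X k)) * g y :=
  lintegral_pi_prod_mul (fun _ => volume)
    (f := fun k y => ENNReal.ofReal (heatKernel ε (y - X k))) (fun k => by fun_prop)
    (fun k => lintegral_heatKernel_sub hε (X k)) k hg

lemma lintegral_backwardDensity (hε : 0 < ε) (Y : Config N d) :
    ∫⁻ X, backwardDensity ε ρ X Y ∂Measure.pi ρ = 1 :=
  lintegral_pi_prod_eq_one ρ
    (f := fun k x => ENNReal.ofReal (heatKernel ε (Y k - x)) / convDensity ε (ρ k) (Y k))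
    (fun k => by fun_prop) fun k => lintegral_heatKernel_div_convDensity hε (Y k)

lemma lintegral_backwardDensity_mul (hε : 0 < ε) (Y : Config N d) (k : Fin N)
    {g : EuclideanSpace ℝ (Fin d) → ℝ≥0∞} (hg : Measurable g) :
    ∫⁻ X, backwardDensity ε ρ X Y * g (X k) ∂Measure.pi ρ
      = ∫⁻ x, ENNReal.ofReal (heatKernel ε (Y k - x)) / convDensity ε (ρ k) (Y k) * g x ∂ρ k :=
  lintegral_pi_prod_mul ρ
    (f := fun k x => ENNReal.ofReal (heatKernel ε (Y k - x)) / convDensity ε (ρ k) (Y k))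
    (fun k => by fun_prop) (fun k => lintegral_heatKernel_div_convDensity hε (Y k)) k hg

lemma measurable_tripleDensity :
    Measurable fun w : Config N d × Config N d × Config N d =>
      forwardDensity ε w.1 w.2.1 * backwardDensity ε ρ w.2.2 w.2.1 := by
  fun_prop

lemma lintegral_tripleMeasure [SFinite ν] {F : Config N d × Config N d × Config N d → ℝ≥0∞}
    (hF : Measurable F) :
    ∫⁻ w, F w ∂tripleMeasure ε ρ ν = ∫⁻ X', ∫⁻ Y, ∫⁻ X,
      forwardDensity ε X' Y * backwardDensity ε ρ X Y * F (X', Y, X) ∂Measure.pi ρ ∂lebesgue N d ∂ν := by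
  have hm := (measurable_tripleDensity (ε := ε) (ρ := ρ)).mul hF
  rw [tripleMeasure, lintegral_withDensity_eq_lintegral_mul _ measurable_tripleDensity hF,
    lintegral_prod _ hm.aemeasurable]
  refine lintegral_congr fun X' => ?_
  have hm2 : Measurable fun q : Config N d × Config N d =>
      forwardDensity ε X' q.1 * backwardDensity ε ρ q.2 q.1 * F (X', q) := by fun_prop
  exact lintegral_prod _ hm2.aemeasurable

lemma lintegral_tripleMeasure_fst_snd [SFinite ν] (hε : 0 < ε)
    {F : Config N d → Config N d → ℝ≥0∞} (hF : Measurable (Function.uncurry F)) :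
    ∫⁻ w, F w.1 w.2.1 ∂tripleMeasure ε ρ ν = ∫⁻ X', ∫⁻ Y, forwardDensity ε X' Y * F X' Y ∂lebesgue N d ∂ν := by
  rw [lintegral_tripleMeasure (F := fun w => F w.1 w.2.1)
    (measurable_comp_uncurry hF (by fun_prop) (by fun_prop))]
  refine lintegral_congr fun X' => lintegral_congr fun Y => ?_
  have hm : Measurable fun X => backwardDensity ε ρ X Y := by fun_prop
  calc ∫⁻ X, forwardDensity ε X' Y * backwardDensity ε ρ X Y * F X' Y ∂Measure.pi ρ
      = ∫⁻ X, backwardDensity ε ρ X Y * (forwardDensity ε X' Y * F X' Y) ∂Measure.pi ρ :=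
        lintegral_congr fun X => by ring
    _ = _ := by rw [lintegral_mul_const _ hm, lintegral_backwardDensity hε, one_mul]

lemma map_fst_tripleMeasure [SFinite ν] (hε : 0 < ε) :
    (tripleMeasure ε ρ ν).map Prod.fst = ν := by
  refine Measure.ext_of_lintegral _ fun F hF => ?_
  rw [lintegral_map hF measurable_fst,
    lintegral_tripleMeasure_fst_snd hε (F := fun X' _ => F X') (hF.comp measurable_fst)]
  refine lintegral_congr fun X' => ?_
  rw [lintegral_mul_const _ (by fun_prop), lintegral_forwardDensity hε, one_mul]

lemma isProbabilityMeasure_tripleMeasure [IsProbabilityMeasure ν] (hε : 0 < ε) :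
    IsProbabilityMeasure (tripleMeasure ε ρ ν) := by
  constructor
  have := congrArg (fun m => m Set.univ) (map_fst_tripleMeasure (ε := ε) (ρ := ρ) (ν := ν) hε)
  simpa [Measure.map_apply measurable_fst] using this

lemma lintegral_tripleMeasure_source [SFinite ν] (hε : 0 < ε) {k : Fin N}
    (hk : marginal ν k = ρ k)
    {F : EuclideanSpace ℝ (Fin d) → EuclideanSpace ℝ (Fin d) → ℝ≥0∞}
    (hF : Measurable (Function.uncurry F)) :
    ∫⁻ w, F (w.1 k) (w.2.1 k) ∂tripleMeasure ε ρ ν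
      = ∫⁻ x, ∫⁻ y, ENNReal.ofReal (heatKernel ε (y - x)) * F x y ∂volume ∂ρ k := by
  rw [lintegral_tripleMeasure_fst_snd hε (F := fun X' Y => F (X' k) (Y k))
    (measurable_comp_uncurry hF (by fun_prop) (by fun_prop))]
  refine (lintegral_congr fun X' => lintegral_forwardDensity_mul hε X' k
    (hF.comp measurable_prodMk_left)).trans ?_
  refine lintegral_comp_apply_of_marginal hk
    (g := fun x => ∫⁻ y, ENNReal.ofReal (heatKernel ε (y - x)) * F x y) ?_
  exact Measurable.lintegral_prod_right'
    (f := fun xy : EuclideanSpace ℝ (Fin d) × EuclideanSpace ℝ (Fin d) =>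
      ENNReal.ofReal (heatKernel ε (xy.2 - xy.1)) * F xy.1 xy.2)
    (Measurable.mul (by fun_prop) hF)

/-- Bayes' rule in one component. Since the `k`-th marginal of `ν` is `ρ k`, the density of `Y_k` is
`convDensity ε (ρ k)`, exactly the denominator of the reversed transition, so `(X_k, Y_k)` and
`(X'_k, Y_k)` have the same law. For the full configurations this generally fails. -/
lemma lintegral_tripleMeasure_target [SFinite ν] (hε : 0 < ε) {k : Fin N}
    (hk : marginal ν k = ρ k)
    {F : EuclideanSpace ℝ (Fin d) → EuclideanSpace ℝ (Fin d) → ℝ≥0∞}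
    (hF : Measurable (Function.uncurry F)) :
    ∫⁻ w, F (w.2.2 k) (w.2.1 k) ∂tripleMeasure ε ρ ν
      = ∫⁻ x, ∫⁻ y, ENNReal.ofReal (heatKernel ε (y - x)) * F x y ∂volume ∂ρ k := by
  have hFs : ∀ y, Measurable fun x => F x y := fun y => hF.comp measurable_prodMk_right
  have hη : Measurable fun xy : EuclideanSpace ℝ (Fin d) × EuclideanSpace ℝ (Fin d) =>
      ENNReal.ofReal (heatKernel ε (xy.2 - xy.1)) := by fun_prop
  set H : EuclideanSpace ℝ (Fin d) → ℝ≥0∞ :=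
    fun y => ∫⁻ x, ENNReal.ofReal (heatKernel ε (y - x)) * F x y ∂ρ k
  have hH : Measurable H := Measurable.lintegral_prod_left' (hη.mul hF)
  have hG : Measurable fun y => H y / convDensity ε (ρ k) y := hH.div measurable_convDensity
  have hc : ∀ x, Measurable fun y : EuclideanSpace ℝ (Fin d) =>
      ENNReal.ofReal (heatKernel ε (y - x)) * (H y / convDensity ε (ρ k) y) :=
    fun x => Measurable.mul (by fun_prop) hG
  rw [lintegral_tripleMeasure (F := fun w => F (w.2.2 k) (w.2.1 k))
    (measurable_comp_uncurry hF (by fun_prop) (by fun_prop))]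
  have h1 : ∀ X' Y : Config N d, ∫⁻ X, forwardDensity ε X' Y * backwardDensity ε ρ X Y
      * F (X k) (Y k) ∂Measure.pi ρ
      = forwardDensity ε X' Y * (H (Y k) / convDensity ε (ρ k) (Y k)) := by
    intro X' Y
    have hm : Measurable fun X : Config N d => backwardDensity ε ρ X Y * F (X k) (Y k) :=
      Measurable.mul (by fun_prop) ((hFs (Y k)).comp (measurable_pi_apply k))
    simp only [mul_assoc]
    rw [lintegral_const_mul _ hm, lintegral_backwardDensity_mul hε Y k (hFs (Y k))]
    congr 1
    have hm2 : Measurable fun x => ENNReal.ofReal (heatKernel ε (Y k - x)) * F x (Y k) :=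
      Measurable.mul (by fun_prop) (hFs (Y k))
    rw [div_eq_mul_inv, ← lintegral_mul_const _ hm2]
    refine lintegral_congr fun x => ?_
    rw [div_eq_mul_inv]
    ring
  simp only [h1, fun X' : Config N d => lintegral_forwardDensity_mul hε X' k hG]
  rw [lintegral_comp_apply_of_marginal hk (g := fun x => ∫⁻ y,
    ENNReal.ofReal (heatKernel ε (y - x)) * (H y / convDensity ε (ρ k) y) ∂volume)
    (Measurable.lintegral_prod_right' (f := fun xy : EuclideanSpace ℝ (Fin d) ×
      EuclideanSpace ℝ (Fin d) => ENNReal.ofReal (heatKernel ε (xy.2 - xy.1)) *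
        (H xy.2 / convDensity ε (ρ k) xy.2)) (hη.mul (hG.comp measurable_snd)))]
  refine (lintegral_lintegral_swap (hη.mul (hG.comp measurable_snd)).aemeasurable).trans
    (Eq.trans ?_ (lintegral_lintegral_swap (hη.mul hF).aemeasurable).symm)
  refine lintegral_congr fun y => ?_
  rw [lintegral_mul_const _ (by fun_prop)]
  exact ENNReal.mul_div_cancel (convDensity_ne_zero hε y) (convDensity_ne_top hε y)

lemma absolutelyContinuous_map_tripleMeasure [SFinite ν] :
    (tripleMeasure ε ρ ν).map (fun w => w.2.2) ≪ Measure.pi ρ := by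
  refine ((withDensity_absolutelyContinuous _ _).map (by fun_prop)).trans ?_
  refine Measure.AbsolutelyContinuous.mk fun s hs h0 => ?_
  rw [Measure.map_apply (by fun_prop) hs]
  have : (fun w : Config N d × Config N d × Config N d => w.2.2) ⁻¹' s
      = Set.univ ×ˢ (Set.univ ×ˢ s) := by ext; simp
  rw [this, Measure.prod_prod, Measure.prod_prod, h0]
  simp

/-- Detailed balance: started from the product measure, the joint density of the triple is symmetric
in `X'` and `X`. -/
lemma lintegral_tripleMeasure_swap {F : Config N d → Config N d → ℝ≥0∞}
    (hF : Measurable (Function.uncurry F)) :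
    ∫⁻ w, F w.1 w.2.2 ∂tripleMeasure ε ρ (Measure.pi ρ)
      = ∫⁻ w, F w.2.2 w.1 ∂tripleMeasure ε ρ (Measure.pi ρ) := by
  have e1 : Measurable fun w : Config N d × Config N d × Config N d => F w.1 w.2.2 :=
    measurable_comp_uncurry hF (by fun_prop) (by fun_prop)
  have e2 : Measurable fun w : Config N d × Config N d × Config N d => F w.2.2 w.1 :=
    measurable_comp_uncurry hF (by fun_prop) (by fun_prop)
  have hsym : ∀ X' X Y : Config N d, forwardDensity ε X' Y * backwardDensity ε ρ X Y
      = forwardDensity ε X Y * backwardDensity ε ρ X' Y := by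
    intro X' X Y
    simp only [forwardDensity, backwardDensity, ← Finset.prod_mul_distrib]
    exact Finset.prod_congr rfl fun k _ => by simp only [div_eq_mul_inv]; ring
  rw [lintegral_tripleMeasure e1, lintegral_tripleMeasure e2]
  have hA : Measurable fun q : Config N d × Config N d =>
      ∫⁻ X, forwardDensity ε q.1 q.2 * backwardDensity ε ρ X q.2 * F q.1 X ∂Measure.pi ρ :=
    Measurable.lintegral_prod_right' (f := fun r : (Config N d × Config N d) × Config N d =>
      forwardDensity ε r.1.1 r.1.2 * backwardDensity ε ρ r.2 r.1.2 * F r.1.1 r.2)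
      (Measurable.mul (by fun_prop) (measurable_comp_uncurry hF (by fun_prop) (by fun_prop)))
  have hB : Measurable fun q : Config N d × Config N d =>
      ∫⁻ X, forwardDensity ε q.1 q.2 * backwardDensity ε ρ X q.2 * F X q.1 ∂Measure.pi ρ :=
    Measurable.lintegral_prod_right' (f := fun r : (Config N d × Config N d) × Config N d =>
      forwardDensity ε r.1.1 r.1.2 * backwardDensity ε ρ r.2 r.1.2 * F r.2 r.1.1)
      (Measurable.mul (by fun_prop) (measurable_comp_uncurry hF (by fun_prop) (by fun_prop)))
  refine (lintegral_lintegral_swap hA.aemeasurable).trans (Eq.trans ?_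
    (lintegral_lintegral_swap hB.aemeasurable).symm)
  refine lintegral_congr fun Y => ?_
  have hC : Measurable fun q : Config N d × Config N d =>
      forwardDensity ε q.1 Y * backwardDensity ε ρ q.2 Y * F q.1 q.2 :=
    Measurable.mul (by fun_prop) (measurable_comp_uncurry hF (by fun_prop) (by fun_prop))
  refine (lintegral_lintegral_swap hC.aemeasurable).trans ?_
  refine lintegral_congr fun X => lintegral_congr fun X' => ?_
  simp only [hsym X' X Y]

end TripleMeasure

section Theta

variable {N d : ℕ} {ε : ℝ} {μ : Measure (Config N d)} [IsProbabilityMeasure μ]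

instance isProbabilityMeasure_marginal (k : Fin N) : IsProbabilityMeasure (marginal μ k) :=
  Measure.isProbabilityMeasure_map (measurable_pi_apply k).aemeasurable

/-- By Tonelli, integrating out `X'` first leaves the density of `lambdaMeasure`, and the remaining
pair is the coupling measure. -/
lemma map_tripleMeasure_eq_theta :
    (tripleMeasure ε (marginal μ) μ).map (fun w => w.2.2) = theta ε μ := by
  refine Measure.ext_of_lintegral _ fun F hF => ?_
  have hb : Measurable fun XY : Config N d × Config N d =>
    backwardDensity ε (marginal μ) XY.1 XY.2 := by fun_prop
  have hΛ : Measurable fun Y : Config N d => ∫⁻ X, forwardDensity ε X Y ∂μ :=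
    Measurable.lintegral_prod_left' (f := fun XY : Config N d × Config N d =>
      forwardDensity ε XY.1 XY.2) (by fun_prop)
  have hF1 : Measurable fun XY : Config N d × Config N d => F XY.1 := hF.comp measurable_fst
  rw [lintegral_map hF (by fun_prop), theta, Measure.fst, lintegral_map hF measurable_fst]
  have h1 : couplingMeasure ε μ = ((Measure.pi (marginal μ)).prod
      ((lebesgue N d).withDensity fun Y => ∫⁻ X, forwardDensity ε X Y ∂μ)).withDensity
        fun XY => backwardDensity ε (marginal μ) XY.1 XY.2 := rfl
  have hΛ2 : Measurable fun XY : Config N d × Config N d =>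
    ∫⁻ X, forwardDensity ε X XY.2 ∂μ := hΛ.comp measurable_snd
  rw [h1, prod_withDensity_right hΛ,
    lintegral_withDensity_eq_lintegral_mul _ hb hF1,
    lintegral_withDensity_eq_lintegral_mul _ hΛ2 (hb.mul hF1),
    lintegral_tripleMeasure (F := fun w => F w.2.2) (hF.comp (by fun_prop)),
    lintegral_prod_symm' _ (hΛ2.mul (hb.mul hF1))]
  have hA : Measurable fun q : Config N d × Config N d =>
      ∫⁻ X, forwardDensity ε q.1 q.2 * backwardDensity ε (marginal μ) X q.2 * F X
        ∂Measure.pi (marginal μ) :=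
    Measurable.lintegral_prod_right' (f := fun r : (Config N d × Config N d) × Config N d =>
      forwardDensity ε r.1.1 r.1.2 * backwardDensity ε (marginal μ) r.2 r.1.2 * F r.2)
      (by fun_prop)
  refine (lintegral_lintegral_swap hA.aemeasurable).trans (lintegral_congr fun Y => ?_)
  have hC : Measurable fun q : Config N d × Config N d =>
      forwardDensity ε q.1 Y * backwardDensity ε (marginal μ) q.2 Y * F q.2 := by fun_prop
  refine (lintegral_lintegral_swap hC.aemeasurable).trans (lintegral_congr fun X => ?_)
  simp only [mul_assoc, Pi.mul_apply]
  rw [lintegral_mul_const _ (by fun_prop)]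

end Theta

/-! ### Conditional expectations; scores of marginals and of products -/

section ConditionalExpectation

variable {Ω α : Type*} {mΩ : MeasurableSpace Ω} [MeasurableSpace α] {P : Measure Ω}
  {X : Ω → α} {S : Ω → ℝ}

lemma integral_comp_mul_condExp [IsProbabilityMeasure P] (hX : Measurable X) (hS : Integrable S P) {φ : α → ℝ}
    (hφ : Measurable φ) {C : ℝ} (hC : ∀ x, |φ x| ≤ C) :
    ∫ w, φ (X w) * S w ∂P = ∫ w, φ (X w) * (P[S | MeasurableSpace.comap X inferInstance]) w ∂P := by
  have hm := hX.comap_le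
  have hφX : StronglyMeasurable[MeasurableSpace.comap X inferInstance] (fun w => φ (X w)) :=
    (hφ.comp (comap_measurable X)).stronglyMeasurable
  have hint : Integrable (fun w => φ (X w) * S w) P :=
    hS.bdd_mul (hφX.mono hm).aestronglyMeasurable (ae_of_all _ fun w => hC (X w))
  rw [← integral_condExp hm]
  exact integral_congr_ae (condExp_mul_of_stronglyMeasurable_left hφX hint hS)

lemma exists_condExp_eq_comp (P : Measure Ω) (X : Ω → α) (S : Ω → ℝ) :
    ∃ h : α → ℝ, Measurable h ∧
      P[S | MeasurableSpace.comap X inferInstance] = fun w => h (X w) := by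
  obtain ⟨h, hm, he⟩ := (stronglyMeasurable_condExp (f := S) (μ := P)
    (m := MeasurableSpace.comap X inferInstance)).exists_eq_measurable_comp
  exact ⟨h, hm.measurable, he⟩

end ConditionalExpectation

section Coordinates

variable {N d : ℕ}

lemma fderiv_comp_apply {φ : EuclideanSpace ℝ (Fin d) → ℝ} (hφ : BoundedSmooth φ) (k : Fin N)
    (i : Fin d) (X : Config N d) :
    fderiv ℝ (fun X : Config N d => φ (X k)) X (coordVec k i)
      = fderiv ℝ φ (X k) (EuclideanSpace.single i 1) := by
  have := hφ.fderiv_comp_affine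
    (ContinuousLinearMap.proj (R := ℝ) (φ := fun _ : Fin N => EuclideanSpace ℝ (Fin d)) k) 0 X
    (coordVec k i)
  simpa [coordVec] using this

lemma BoundedSmooth.comp_apply {φ : EuclideanSpace ℝ (Fin d) → ℝ} (hφ : BoundedSmooth φ)
    (k : Fin N) : BoundedSmooth fun X : Config N d => φ (X k) := by
  simpa using hφ.comp_affine
    (ContinuousLinearMap.proj (R := ℝ) (φ := fun _ : Fin N => EuclideanSpace ℝ (Fin d)) k) 0

lemma coordVec_apply_self (k : Fin N) (i : Fin d) :
    coordVec k i k = EuclideanSpace.single i (1 : ℝ) := by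
  simp [coordVec]

lemma coordVec_apply_of_ne {k j : Fin N} (h : j ≠ k) (i : Fin d) : coordVec k i j = 0 := by
  simp [coordVec, h]

/-- Only the `k`-th factor moves along `coordVec k i`. Here `c` plays the role of a logarithmic
derivative, so it passes unchanged to the product. -/
lemma hasLineDerivAt_prod {f : Fin N → EuclideanSpace ℝ (Fin d) → ℝ} {X : Config N d} {k : Fin N}
    {i : Fin d} {c : ℝ}
    (h : HasDerivAt (fun t : ℝ => f k (X k + t • EuclideanSpace.single i (1 : ℝ)))
      (c * f k (X k)) 0) :
    HasLineDerivAt ℝ (fun X : Config N d => ∏ j, f j (X j)) (c * ∏ j, f j (X j)) X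
      (coordVec k i) := by
  have h1 := h.mul_const (∏ j ∈ Finset.univ.erase k, f j (X j))
  unfold HasLineDerivAt
  rw [mul_assoc, Finset.mul_prod_erase _ (fun j => f j (X j)) (Finset.mem_univ k)] at h1
  refine h1.congr_of_eventuallyEq (Eventually.of_forall fun t => ?_)
  dsimp only
  rw [← Finset.mul_prod_erase _ _ (Finset.mem_univ k)]
  congr 1
  · simp [coordVec_apply_self]
  · refine Finset.prod_congr rfl fun j hj => ?_
    simp [coordVec_apply_of_ne (Finset.ne_of_mem_erase hj)]

end Coordinates

section MarginalScores

variable {N d : ℕ} {μ : Measure (Config N d)} [IsProbabilityMeasure μ]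

/-- Testing with functions of `X k` alone sees only the conditional expectation of `s` given `X k`.
-/
lemma isScore_marginal {k : Fin N} {i : Fin d} {s : Config N d → ℝ}
    (hs : IsScore μ (coordVec k i) s) {σ : EuclideanSpace ℝ (Fin d) → ℝ} (hσ : Measurable σ)
    (h : μ[s | MeasurableSpace.comap (fun X : Config N d => X k) inferInstance]
      = fun X => σ (X k)) :
    IsScore (marginal μ k) (EuclideanSpace.single i 1) σ := by
  have hk : Measurable fun X : Config N d => X k := measurable_pi_apply k
  have hint : Integrable (fun X : Config N d => σ (X k)) μ := h ▸ integrable_condExp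
  refine ⟨(integrable_map_measure hσ.aestronglyMeasurable hk.aemeasurable).2 hint,
    fun φ hφ hb hb' => ?_⟩
  have hφs : BoundedSmooth φ := ⟨hφ, hb, hb'⟩
  have hφk := hφs.comp_apply (N := N) k
  have h1 := hs.ibp _ hφk.contDiff hφk.bound hφk.bound_fderiv
  obtain ⟨C, hC⟩ := hb
  rw [integral_comp_mul_condExp hk hs.integrable hφ.continuous.measurable hC, h] at h1
  simp only [fderiv_comp_apply hφs] at h1
  have hm : Measurable fun x => fderiv ℝ φ x (EuclideanSpace.single i (1 : ℝ)) :=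
    ((hφ.continuous_fderiv (by simp)).clm_apply continuous_const).measurable
  have hm2 : Measurable fun x => φ x * σ x := hφ.continuous.measurable.mul hσ
  rw [marginal, integral_map hk.aemeasurable hm.aestronglyMeasurable,
    integral_map hk.aemeasurable hm2.aestronglyMeasurable, h1]

variable {ρ : Fin N → Measure (EuclideanSpace ℝ (Fin d))} [∀ k, IsProbabilityMeasure (ρ k)]

lemma boundedSmooth_comp_update {φ : Config N d → ℝ} (hφ : BoundedSmooth φ) (X : Config N d)
    (k : Fin N) : BoundedSmooth (fun z => φ (Function.update X k z)) ∧
    ∀ z i, fderiv ℝ (fun z => φ (Function.update X k z)) z (EuclideanSpace.single i (1 : ℝ))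
      = fderiv ℝ φ (Function.update X k z) (coordVec k i) := by
  have he : (fun z => φ (Function.update X k z)) = fun z => φ (Function.update X k 0 +
      ContinuousLinearMap.single ℝ (fun _ : Fin N => EuclideanSpace ℝ (Fin d)) k z) := by
    funext z
    congr 1
    ext1 j
    by_cases hj : j = k
    · subst hj; simp
    · simp [Function.update_of_ne hj, Pi.single_eq_of_ne hj]
  have he' : ∀ z, Function.update X k z = Function.update X k 0 +
      ContinuousLinearMap.single ℝ (fun _ : Fin N => EuclideanSpace ℝ (Fin d)) k z := by
    intro z
    ext1 j
    by_cases hj : j = k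
    · subst hj; simp
    · simp [Function.update_of_ne hj, Pi.single_eq_of_ne hj]
  refine ⟨he ▸ hφ.comp_affine _ _, fun z i => ?_⟩
  rw [he, hφ.fderiv_comp_affine, ← he']
  rfl

/-- Resample the `k`-th component and integrate by parts in it, the other components being fixed. -/
lemma isScore_pi {k : Fin N} {i : Fin d} {σ : EuclideanSpace ℝ (Fin d) → ℝ}
    (h : IsScore (ρ k) (EuclideanSpace.single i 1) σ) :
    IsScore (Measure.pi ρ) (coordVec k i) (fun X : Config N d => σ (X k)) := by
  have hint : Integrable (fun X : Config N d => σ (X k)) (Measure.pi ρ) :=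
    integrable_comp_eval h.integrable
  refine ⟨hint, fun φ hφ hb hb' => ?_⟩
  have hφs : BoundedSmooth φ := ⟨hφ, hb, hb'⟩
  obtain ⟨C, hC⟩ := hb
  obtain ⟨C', hC'⟩ := hb'
  have hm := measurePreserving_update ρ k
  have hφ'c : Continuous fun X => fderiv ℝ φ X (coordVec k i) :=
    (hφ.continuous_fderiv (by simp)).clm_apply continuous_const
  have i1 : Integrable (fun X => fderiv ℝ φ X (coordVec k i)) (Measure.pi ρ) :=
    Integrable.of_bound hφ'c.aestronglyMeasurable (C' * ‖coordVec (N := N) k i‖)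
      (ae_of_all _ fun X => ContinuousLinearMap.le_of_opNorm_le _ (hC' X) _)
  have i2 : Integrable (fun X => φ X * σ (X k)) (Measure.pi ρ) :=
    hint.bdd_mul hφ.continuous.aestronglyMeasurable (ae_of_all _ hC)
  have hsm : ∀ f : Config N d → ℝ, Integrable f (Measure.pi ρ) →
      ∫ X, f X ∂Measure.pi ρ = ∫ X, ∫ z, f (Function.update X k z) ∂ρ k ∂Measure.pi ρ := by
    intro f hf
    have h1 := integral_map (μ := (Measure.pi ρ).prod (ρ k)) hm.measurable.aemeasurable
      (f := f) (by rw [hm.map_eq]; exact hf.aestronglyMeasurable)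
    rw [hm.map_eq] at h1
    rw [h1]
    exact integral_prod _ (hm.integrable_comp_of_integrable hf)
  rw [hsm _ i1, hsm _ i2, ← integral_neg]
  refine integral_congr_ae (ae_of_all _ fun X => ?_)
  obtain ⟨h1, h2⟩ := boundedSmooth_comp_update hφs X k
  have := h.ibp _ h1.contDiff h1.bound h1.bound_fderiv
  simpa only [h2, Function.update_self] using this

end MarginalScores

/-! ### A marginal and its Gaussian perturbation -/

section Convolution

variable {d : ℕ} {ε : ℝ} {ρ : Measure (EuclideanSpace ℝ (Fin d))} [IsProbabilityMeasure ρ]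

lemma boundedSmooth_heatKernel_sub (hε : 0 < ε) (y : EuclideanSpace ℝ (Fin d)) :
    BoundedSmooth fun x => heatKernel ε (y - x) := by
  simpa [sub_eq_add_neg] using (boundedSmooth_heatKernel (d := d) hε).comp_affine
    (-ContinuousLinearMap.id ℝ _) y

lemma hasDerivAt_heatKernel_line (z e : EuclideanSpace ℝ (Fin d)) (t : ℝ) :
    HasDerivAt (fun t : ℝ => heatKernel ε (z + t • e)) (fderiv ℝ (heatKernel ε) (z + t • e) e) t := by
  have h1 : HasDerivAt (fun t : ℝ => z + t • e) e t := by
    simpa using ((hasDerivAt_id t).smul_const e).const_add z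
  exact (contDiff_heatKernel.differentiable (by simp) (z + t • e)).hasFDerivAt.comp_hasDerivAt t h1

lemma integrable_heatKernel_sub (hε : 0 < ε) (y : EuclideanSpace ℝ (Fin d)) :
    Integrable (fun x => heatKernel ε (y - x)) ρ :=
  Integrable.of_bound (contDiff_heatKernel.continuous.comp
    (continuous_const.sub continuous_id)).aestronglyMeasurable _ (ae_of_all _ fun x => by
    rw [Real.norm_of_nonneg (heatKernel_pos hε _).le]
    exact heatKernel_le hε _)

lemma convDensity_eq_ofReal (hε : 0 < ε) (y : EuclideanSpace ℝ (Fin d)) :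
    convDensity ε ρ y = ENNReal.ofReal (∫ x, heatKernel ε (y - x) ∂ρ) := by
  rw [ofReal_integral_eq_lintegral_ofReal (integrable_heatKernel_sub hε y)
    (ae_of_all _ fun x => (heatKernel_pos hε _).le)]
  rfl

lemma integral_heatKernel_sub_pos (hε : 0 < ε) (y : EuclideanSpace ℝ (Fin d)) :
    0 < ∫ x, heatKernel ε (y - x) ∂ρ := by
  have := convDensity_ne_zero (ρ := ρ) hε y
  rw [convDensity_eq_ofReal hε, Ne, ENNReal.ofReal_eq_zero, not_le] at this
  exact this

/-- After differentiating under the integral, the derivative in `y` is minus the one in `x`, and the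
score of `ρ` absorbs it. Hence `backwardMean` is the logarithmic derivative of `ρ * η^ε`. -/
lemma hasDerivAt_integral_heatKernel (hε : 0 < ε) {e : EuclideanSpace ℝ (Fin d)}
    {σ : EuclideanSpace ℝ (Fin d) → ℝ} (h : IsScore ρ e σ) (y : EuclideanSpace ℝ (Fin d)) :
    HasDerivAt (fun t : ℝ => ∫ x, heatKernel ε (y + t • e - x) ∂ρ)
      (∫ x, heatKernel ε (y - x) * σ x ∂ρ) 0 := by
  obtain ⟨C, hC⟩ := (boundedSmooth_heatKernel (d := d) hε).bound_fderiv
  have hB := boundedSmooth_heatKernel_sub (d := d) hε y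
  have h1 : ∫ x, fderiv ℝ (heatKernel ε) (y - x) e ∂ρ = ∫ x, heatKernel ε (y - x) * σ x ∂ρ := by
    have h2 := h.ibp _ hB.contDiff hB.bound hB.bound_fderiv
    have h3 : ∀ x, fderiv ℝ (fun x => heatKernel ε (y - x)) x e
        = - fderiv ℝ (heatKernel ε) (y - x) e := by
      intro x
      have := (boundedSmooth_heatKernel (d := d) hε).fderiv_comp_affine
        (-ContinuousLinearMap.id ℝ _) y x e
      simpa [sub_eq_add_neg] using this
    simp only [h3, integral_neg, neg_inj] at h2
    exact h2
  have hc : Continuous fun z => fderiv ℝ (heatKernel (d := d) ε) z e :=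
    (contDiff_heatKernel.continuous_fderiv (by simp)).clm_apply continuous_const
  have hsub : ∀ (x : EuclideanSpace ℝ (Fin d)) (t : ℝ), y + t • e - x = (y - x) + t • e := fun x t => by abel
  have key := (hasDerivAt_integral_of_dominated_loc_of_deriv_le (μ := ρ)
    (F := fun (t : ℝ) x => heatKernel ε (y + t • e - x))
    (F' := fun (t : ℝ) x => fderiv ℝ (heatKernel ε) (y + t • e - x) e) (x₀ := 0)
    (bound := fun _ => C * ‖e‖) (s := Set.univ) univ_mem
    (Eventually.of_forall fun t => (integrable_heatKernel_sub hε _).aestronglyMeasurable)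
    (integrable_heatKernel_sub hε _)
    (hc.comp (continuous_const.sub continuous_id)).aestronglyMeasurable
    (ae_of_all _ fun x t _ => ContinuousLinearMap.le_of_opNorm_le _ (hC _) _)
    (integrable_const _)
    (ae_of_all _ fun x t _ => by
      simp only [hsub]; exact hasDerivAt_heatKernel_line (y - x) e t)).2
  simpa [h1] using key

end Convolution

section GaussianCoupling

variable {d : ℕ} {ε : ℝ} {ρ : Measure (EuclideanSpace ℝ (Fin d))}

/-- The law of `(x, y)` where `x` has law `ρ` and `y` is obtained from `x` by adding Gaussian
noise. -/
def gaussianCoupling (ε : ℝ) (ρ : Measure (EuclideanSpace ℝ (Fin d))) :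
    Measure (EuclideanSpace ℝ (Fin d) × EuclideanSpace ℝ (Fin d)) :=
  (ρ.prod volume).withDensity fun xy => ENNReal.ofReal (heatKernel ε (xy.2 - xy.1))

lemma measurable_gaussianCoupling_density :
    Measurable fun xy : EuclideanSpace ℝ (Fin d) × EuclideanSpace ℝ (Fin d) =>
      ENNReal.ofReal (heatKernel ε (xy.2 - xy.1)) := by
  fun_prop

lemma lintegral_gaussianCoupling
    {F : EuclideanSpace ℝ (Fin d) × EuclideanSpace ℝ (Fin d) → ℝ≥0∞} (hF : Measurable F) :
    ∫⁻ q, F q ∂gaussianCoupling ε ρ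
      = ∫⁻ x, ∫⁻ y, ENNReal.ofReal (heatKernel ε (y - x)) * F (x, y) ∂volume ∂ρ := by
  rw [gaussianCoupling, lintegral_withDensity_eq_lintegral_mul _
    measurable_gaussianCoupling_density hF,
    lintegral_prod _ (measurable_gaussianCoupling_density.mul hF).aemeasurable]
  rfl

lemma integral_gaussianCoupling {F : EuclideanSpace ℝ (Fin d) × EuclideanSpace ℝ (Fin d) → ℝ}
    (hε : 0 < ε) : ∫ q, F q ∂gaussianCoupling ε ρ
      = ∫ q, heatKernel ε (q.2 - q.1) * F q ∂(ρ.prod volume) := by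
  rw [gaussianCoupling, integral_withDensity_eq_integral_toReal_smul
    measurable_gaussianCoupling_density (ae_of_all _ fun _ => ENNReal.ofReal_lt_top)]
  simp only [ENNReal.toReal_ofReal (heatKernel_pos hε _).le, smul_eq_mul]

lemma integrable_gaussianCoupling_iff
    {F : EuclideanSpace ℝ (Fin d) × EuclideanSpace ℝ (Fin d) → ℝ} (hε : 0 < ε) :
    Integrable F (gaussianCoupling ε ρ) ↔
      Integrable (fun q => heatKernel ε (q.2 - q.1) * F q) (ρ.prod volume) := by
  rw [gaussianCoupling, integrable_withDensity_iff_integrable_smul'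
    measurable_gaussianCoupling_density (ae_of_all _ fun _ => ENNReal.ofReal_lt_top)]
  simp only [ENNReal.toReal_ofReal (heatKernel_pos hε _).le, smul_eq_mul]

lemma map_fst_gaussianCoupling [SFinite ρ] (hε : 0 < ε) : (gaussianCoupling ε ρ).map Prod.fst = ρ := by
  refine Measure.ext_of_lintegral _ fun F hF => ?_
  rw [lintegral_map hF measurable_fst, lintegral_gaussianCoupling (F := fun q => F q.1) (hF.comp measurable_fst)]
  refine lintegral_congr fun x => ?_
  dsimp only
  rw [lintegral_mul_const _ (by fun_prop), lintegral_heatKernel_sub hε, one_mul]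

variable [IsProbabilityMeasure ρ]

lemma lintegral_enorm_sub_gaussianCoupling_le (hε : 0 < ε) :
    ∫⁻ q, ‖q.2 - q.1‖ₑ ∂gaussianCoupling ε ρ
      ≤ ENNReal.ofReal ((2 * 2 ^ ((d : ℝ) / 2)) * √ε) := by
  rw [lintegral_gaussianCoupling (by fun_prop)]
  have h1 : ∀ x y : EuclideanSpace ℝ (Fin d), ENNReal.ofReal (heatKernel ε (y - x)) * ‖y - x‖ₑ
      ≤ ENNReal.ofReal ((2 * 2 ^ ((d : ℝ) / 2)) * √ε)
        * ENNReal.ofReal (heatKernel (2 * ε) (y - x)) := by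
    intro x y
    rw [← ofReal_norm, ← ENNReal.ofReal_mul (heatKernel_pos hε _).le,
      ← ENNReal.ofReal_mul (by positivity), mul_comm (heatKernel ε _)]
    exact ENNReal.ofReal_le_ofReal (norm_mul_heatKernel_le hε _)
  refine (lintegral_mono fun x => lintegral_mono fun y => h1 x y).trans ?_
  have h2 : ∀ x : EuclideanSpace ℝ (Fin d), ∫⁻ y, ENNReal.ofReal ((2 * 2 ^ ((d : ℝ) / 2)) * √ε)
        * ENNReal.ofReal (heatKernel (2 * ε) (y - x)) = ENNReal.ofReal ((2 * 2 ^ ((d : ℝ) / 2)) * √ε) := by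
    intro x
    rw [lintegral_const_mul _ (by fun_prop), lintegral_heatKernel_sub (by positivity), mul_one]
  simp only [h2]
  simp

end GaussianCoupling

section Laws

variable {N d : ℕ} {ε : ℝ} {ρ : Fin N → Measure (EuclideanSpace ℝ (Fin d))}
  [∀ k, IsProbabilityMeasure (ρ k)] {ν : Measure (Config N d)} [IsProbabilityMeasure ν]

lemma map_source_tripleMeasure (hε : 0 < ε) {k : Fin N} (hk : marginal ν k = ρ k) :
    (tripleMeasure ε ρ ν).map (fun w => (w.1 k, w.2.1 k)) = gaussianCoupling ε (ρ k) := by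
  refine Measure.ext_of_lintegral _ fun F hF => ?_
  rw [lintegral_map hF (by fun_prop), lintegral_gaussianCoupling hF]
  exact lintegral_tripleMeasure_source hε hk (F := fun x y => F (x, y)) hF

lemma map_target_tripleMeasure (hε : 0 < ε) {k : Fin N} (hk : marginal ν k = ρ k) :
    (tripleMeasure ε ρ ν).map (fun w => (w.2.2 k, w.2.1 k)) = gaussianCoupling ε (ρ k) := by
  refine Measure.ext_of_lintegral _ fun F hF => ?_
  rw [lintegral_map hF (by fun_prop), lintegral_gaussianCoupling hF]
  exact lintegral_tripleMeasure_target hε hk (F := fun x y => F (x, y)) hF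

lemma map_target_apply_tripleMeasure (hε : 0 < ε) {k : Fin N} (hk : marginal ν k = ρ k) :
    (tripleMeasure ε ρ ν).map (fun w => w.2.2 k) = ρ k := by
  rw [← map_fst_gaussianCoupling (ρ := ρ k) hε, ← map_target_tripleMeasure hε hk,
    Measure.map_map measurable_fst (by fun_prop)]
  rfl

lemma lintegral_enorm_source_sub_le (hε : 0 < ε) {k : Fin N} (hk : marginal ν k = ρ k) :
    ∫⁻ w, ‖w.2.1 k - w.1 k‖ₑ ∂tripleMeasure ε ρ ν
      ≤ ENNReal.ofReal ((2 * 2 ^ ((d : ℝ) / 2)) * √ε) := by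
  refine le_of_eq_of_le ?_ (lintegral_enorm_sub_gaussianCoupling_le (ρ := ρ k) hε)
  rw [← map_source_tripleMeasure hε hk, lintegral_map (by fun_prop) (by fun_prop)]

lemma lintegral_enorm_target_sub_le (hε : 0 < ε) {k : Fin N} (hk : marginal ν k = ρ k) :
    ∫⁻ w, ‖w.2.1 k - w.2.2 k‖ₑ ∂tripleMeasure ε ρ ν
      ≤ ENNReal.ofReal ((2 * 2 ^ ((d : ℝ) / 2)) * √ε) := by
  refine le_of_eq_of_le ?_ (lintegral_enorm_sub_gaussianCoupling_le (ρ := ρ k) hε)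
  rw [← map_target_tripleMeasure hε hk, lintegral_map (by fun_prop) (by fun_prop)]

lemma integrable_source_sub (hε : 0 < ε) {k : Fin N} (hk : marginal ν k = ρ k) :
    Integrable (fun w => w.2.1 k - w.1 k) (tripleMeasure ε ρ ν) :=
  ⟨by fun_prop, (lintegral_enorm_source_sub_le hε hk).trans_lt ENNReal.ofReal_lt_top⟩

lemma integrable_target_sub (hε : 0 < ε) {k : Fin N} (hk : marginal ν k = ρ k) :
    Integrable (fun w => w.2.1 k - w.2.2 k) (tripleMeasure ε ρ ν) :=
  ⟨by fun_prop, (lintegral_enorm_target_sub_le hε hk).trans_lt ENNReal.ofReal_lt_top⟩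

end Laws

section ConvolvedScore

variable {d : ℕ} {ε : ℝ} {ρ : Measure (EuclideanSpace ℝ (Fin d))} [IsProbabilityMeasure ρ]
  {σ : EuclideanSpace ℝ (Fin d) → ℝ}

/-- The weighted average of `σ x` with respect to the law of `x` given `y` under
`gaussianCoupling ε ρ`. -/
def backwardMean (ε : ℝ) (ρ : Measure (EuclideanSpace ℝ (Fin d)))
    (σ : EuclideanSpace ℝ (Fin d) → ℝ) (y : EuclideanSpace ℝ (Fin d)) : ℝ :=
  (∫ x, heatKernel ε (y - x) * σ x ∂ρ) / ∫ x, heatKernel ε (y - x) ∂ρ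

lemma measurable_backwardMean (hσ : Measurable σ) : Measurable (backwardMean ε ρ σ) := by
  have h1 : StronglyMeasurable fun y => ∫ x, heatKernel ε (y - x) * σ x ∂ρ :=
    StronglyMeasurable.integral_prod_right' (f := fun q : EuclideanSpace ℝ (Fin d) ×
      EuclideanSpace ℝ (Fin d) => heatKernel ε (q.1 - q.2) * σ q.2)
      (Measurable.stronglyMeasurable (by fun_prop))
  have h2 : StronglyMeasurable fun y => ∫ x, heatKernel ε (y - x) ∂ρ :=
    StronglyMeasurable.integral_prod_right' (f := fun q : EuclideanSpace ℝ (Fin d) ×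
      EuclideanSpace ℝ (Fin d) => heatKernel ε (q.1 - q.2))
      (Measurable.stronglyMeasurable (by fun_prop))
  exact h1.measurable.div h2.measurable

lemma integrable_comp_fst_gaussianCoupling (hε : 0 < ε) (hσ : Integrable σ ρ) :
    Integrable (fun q => σ q.1) (gaussianCoupling ε ρ) :=
  (show MeasurePreserving Prod.fst (gaussianCoupling ε ρ) ρ from
    ⟨measurable_fst, map_fst_gaussianCoupling hε⟩).integrable_comp_of_integrable hσ

/-- Integrating over `x` first cancels the denominator of `backwardMean`; what is left is at most
the integral of `|σ|` against the kernel. -/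
lemma integrable_backwardMean (hε : 0 < ε) (hσm : Measurable σ) (hσ : Integrable σ ρ) :
    Integrable (fun q => backwardMean ε ρ σ q.2) (gaussianCoupling ε ρ) := by
  have hm := measurable_backwardMean (ε := ε) (ρ := ρ) hσm
  refine ⟨(hm.comp measurable_snd).aestronglyMeasurable, ?_⟩
  have hfin := (integrable_comp_fst_gaussianCoupling hε hσ).hasFiniteIntegral
  unfold HasFiniteIntegral at hfin ⊢
  have hms : Measurable fun q : EuclideanSpace ℝ (Fin d) × EuclideanSpace ℝ (Fin d) =>
      ENNReal.ofReal (heatKernel ε (q.2 - q.1)) * ‖σ q.1‖ₑ := by fun_prop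
  have hmb : Measurable fun q : EuclideanSpace ℝ (Fin d) × EuclideanSpace ℝ (Fin d) =>
      ENNReal.ofReal (heatKernel ε (q.2 - q.1)) * ‖backwardMean ε ρ σ q.2‖ₑ := by fun_prop
  rw [lintegral_gaussianCoupling (by fun_prop)] at hfin ⊢
  refine lt_of_le_of_lt ?_ hfin
  refine le_of_eq_of_le (lintegral_lintegral_swap hmb.aemeasurable)
    (le_of_le_of_eq ?_ (lintegral_lintegral_swap hms.aemeasurable).symm)
  refine lintegral_mono fun y => ?_
  dsimp only
  rw [lintegral_mul_const _ (by fun_prop)]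
  have hb := integral_heatKernel_sub_pos (ρ := ρ) hε y
  have h1 : ∫⁻ x, ENNReal.ofReal (heatKernel ε (y - x)) ∂ρ
      = ENNReal.ofReal (∫ x, heatKernel ε (y - x) ∂ρ) := convDensity_eq_ofReal hε y
  rw [h1, ← ofReal_norm, ← ENNReal.ofReal_mul hb.le, backwardMean, norm_div,
    Real.norm_of_nonneg hb.le, mul_div_cancel₀ _ hb.ne', ofReal_norm]
  refine (enorm_integral_le_lintegral_enorm _).trans_eq (lintegral_congr fun x => ?_)
  rw [enorm_mul, Real.enorm_of_nonneg (heatKernel_pos hε _).le]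

lemma integral_mul_backwardMean (hε : 0 < ε) (hσm : Measurable σ) (hσ : Integrable σ ρ)
    {ψ : EuclideanSpace ℝ (Fin d) → ℝ} (hψ : Measurable ψ) {C : ℝ} (hC : ∀ y, |ψ y| ≤ C) :
    ∫ q, ψ q.2 * backwardMean ε ρ σ q.2 ∂gaussianCoupling ε ρ
      = ∫ q, ψ q.2 * σ q.1 ∂gaussianCoupling ε ρ := by
  have hψ2 : Measurable fun q : EuclideanSpace ℝ (Fin d) × EuclideanSpace ℝ (Fin d) => ψ q.2 :=
    hψ.comp measurable_snd
  have i1 : Integrable (fun q => ψ q.2 * backwardMean ε ρ σ q.2) (gaussianCoupling ε ρ) :=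
    (integrable_backwardMean hε hσm hσ).bdd_mul hψ2.aestronglyMeasurable (ae_of_all _ fun q => hC q.2)
  have i2 : Integrable (fun q => ψ q.2 * σ q.1) (gaussianCoupling ε ρ) :=
    (integrable_comp_fst_gaussianCoupling hε hσ).bdd_mul hψ2.aestronglyMeasurable
      (ae_of_all _ fun q => hC q.2)
  rw [integrable_gaussianCoupling_iff hε] at i1 i2
  rw [integral_gaussianCoupling hε, integral_gaussianCoupling hε, integral_prod_symm _ i1,
    integral_prod_symm _ i2]
  refine integral_congr_ae (ae_of_all _ fun y => ?_)
  dsimp only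
  have hb := integral_heatKernel_sub_pos (ρ := ρ) hε y
  rw [integral_mul_const, backwardMean]
  have : ∀ x, heatKernel ε (y - x) * (ψ y * σ x) = ψ y * (heatKernel ε (y - x) * σ x) :=
    fun x => by ring
  simp only [this, integral_const_mul]
  field_simp

end ConvolvedScore

section ConditionalMean

variable {Ω : Type*} {mΩ : MeasurableSpace Ω} {P : Measure Ω} [IsProbabilityMeasure P] {d : ℕ}
  {ε : ℝ} {ρ : Measure (EuclideanSpace ℝ (Fin d))} [IsProbabilityMeasure ρ]
  {X Y : Ω → EuclideanSpace ℝ (Fin d)} {σ : EuclideanSpace ℝ (Fin d) → ℝ}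

/-- Only the joint law of `(X, Y)` matters: the defining identity on events `Y ∈ t` is
`integral_mul_backwardMean` with an indicator. -/
lemma backwardMean_ae_eq_condExp (hX : Measurable X) (hY : Measurable Y) (hε : 0 < ε)
    (hXY : P.map (fun w => (X w, Y w)) = gaussianCoupling ε ρ)
    (hσm : Measurable σ) (hσ : Integrable σ ρ) :
    (fun w => backwardMean ε ρ σ (Y w)) =ᵐ[P]
      P[fun w => σ (X w) | MeasurableSpace.comap Y inferInstance] := by
  have hmp : MeasurePreserving (fun w => (X w, Y w)) P (gaussianCoupling ε ρ) :=
    ⟨hX.prodMk hY, hXY⟩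
  have hm := measurable_backwardMean (ε := ε) (ρ := ρ) hσm
  have hi : Integrable (fun w => backwardMean ε ρ σ (Y w)) P :=
    hmp.integrable_comp_of_integrable (integrable_backwardMean hε hσm hσ)
  have hiX : Integrable (fun w => σ (X w)) P :=
    hmp.integrable_comp_of_integrable (integrable_comp_fst_gaussianCoupling hε hσ)
  refine ae_eq_condExp_of_forall_setIntegral_eq hY.comap_le hiX
    (fun s _ _ => hi.integrableOn) (fun s hs _ => ?_)
    (hm.comp (comap_measurable _)).stronglyMeasurable.aestronglyMeasurable
  obtain ⟨t, ht, rfl⟩ := hs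
  have hset : ∀ f : Ω → ℝ, ∫ w in Y ⁻¹' t, f w ∂P = ∫ w, t.indicator 1 (Y w) * f w ∂P := by
    intro f
    rw [← integral_indicator (hY ht)]
    refine integral_congr_ae (ae_of_all _ fun w => ?_)
    by_cases h : Y w ∈ t <;> simp [h, Set.indicator]
  have hψ : Measurable (t.indicator (1 : EuclideanSpace ℝ (Fin d) → ℝ)) :=
    measurable_one.indicator ht
  have key := integral_mul_backwardMean hε hσm hσ hψ (C := 1) fun y => by
    by_cases h : y ∈ t <;> simp [h]
  rw [hset, hset]
  rw [← hXY] at key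
  have e1 : Measurable fun q : EuclideanSpace ℝ (Fin d) × EuclideanSpace ℝ (Fin d) =>
    t.indicator 1 q.2 * backwardMean ε ρ σ q.2 :=
    (hψ.comp measurable_snd).mul (hm.comp measurable_snd)
  have e2 : Measurable fun q : EuclideanSpace ℝ (Fin d) × EuclideanSpace ℝ (Fin d) =>
    t.indicator 1 q.2 * σ q.1 := (hψ.comp measurable_snd).mul (hσm.comp measurable_fst)
  rw [integral_map hmp.aemeasurable e1.aestronglyMeasurable,
    integral_map hmp.aemeasurable e2.aestronglyMeasurable] at key
  exact key

end ConditionalMean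

section ConditionalMeanTriple

variable {N d : ℕ} {ε : ℝ} {ρ : Fin N → Measure (EuclideanSpace ℝ (Fin d))}
  [∀ k, IsProbabilityMeasure (ρ k)] {ν : Measure (Config N d)} [IsProbabilityMeasure ν]
  {σ : EuclideanSpace ℝ (Fin d) → ℝ}

lemma integrable_target_apply (hε : 0 < ε) {k : Fin N} (hk : marginal ν k = ρ k)
    (hσ : Integrable σ (ρ k)) : Integrable (fun w => σ (w.2.2 k)) (tripleMeasure ε ρ ν) :=
  (show MeasurePreserving (fun w => w.2.2 k) (tripleMeasure ε ρ ν) (ρ k) from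
    ⟨by fun_prop, map_target_apply_tripleMeasure hε hk⟩).integrable_comp_of_integrable hσ

lemma backwardMean_ae_eq_condExp_tripleMeasure (hε : 0 < ε) {k : Fin N} (hk : marginal ν k = ρ k)
    (hσm : Measurable σ) (hσ : Integrable σ (ρ k)) :
    (fun w => backwardMean ε (ρ k) σ (w.2.1 k)) =ᵐ[tripleMeasure ε ρ ν]
      (tripleMeasure ε ρ ν)[fun w => σ (w.2.2 k) |
        MeasurableSpace.comap (fun w => w.2.1 k) inferInstance] :=
  have := isProbabilityMeasure_tripleMeasure (ρ := ρ) (ν := ν) hε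
  backwardMean_ae_eq_condExp (P := tripleMeasure ε ρ ν) (X := fun w => w.2.2 k)
    (Y := fun w => w.2.1 k) (by fun_prop) (by fun_prop) hε (map_target_tripleMeasure hε hk) hσm hσ

end ConditionalMeanTriple

/-! ### Integration by parts for the triple -/

section IteratedIntegrals

variable {α β γ : Type*} [MeasurableSpace α] [MeasurableSpace β] [MeasurableSpace γ]
  {A : Measure α} {B : Measure β} {C : Measure γ}

lemma integral_sub_sub {f g h : α → ℝ} (hf : Integrable f A) (hg : Integrable g A)
    (hh : Integrable h A) :
    ∫ x, (f x - g x - h x) ∂A = ∫ x, f x ∂A - ∫ x, g x ∂A - ∫ x, h x ∂A :=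
  (integral_sub (hf.sub hg) hh).trans (by rw [← integral_sub hf hg]; rfl)

lemma integral_add_sub {f g h : α → ℝ} (hf : Integrable f A) (hg : Integrable g A)
    (hh : Integrable h A) :
    ∫ x, (f x + g x - h x) ∂A = ∫ x, f x ∂A + ∫ x, g x ∂A - ∫ x, h x ∂A :=
  (integral_sub (hf.add hg) hh).trans (by rw [← integral_add hf hg]; rfl)

variable [SFinite A] [SFinite B] [SFinite C] {F G : α × β × γ → ℝ}

lemma integral_congr_of_integral_fst (hF : Integrable F (A.prod (B.prod C)))
    (hG : Integrable G (A.prod (B.prod C)))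
    (h : ∀ q, ∫ x, F (x, q) ∂A = ∫ x, G (x, q) ∂A) :
    ∫ w, F w ∂A.prod (B.prod C) = ∫ w, G w ∂A.prod (B.prod C) := by
  rw [integral_prod_symm _ hF, integral_prod_symm _ hG]
  simp only [h]

lemma integral_congr_of_integral_snd_snd (hF : Integrable F (A.prod (B.prod C)))
    (hG : Integrable G (A.prod (B.prod C)))
    (h : ∀ x y, ∫ z, F (x, y, z) ∂C = ∫ z, G (x, y, z) ∂C) :
    ∫ w, F w ∂A.prod (B.prod C) = ∫ w, G w ∂A.prod (B.prod C) := by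
  rw [integral_prod _ hF, integral_prod _ hG]
  refine integral_congr_ae ?_
  filter_upwards [hF.prod_right_ae, hG.prod_right_ae] with x hx hx'
  rw [integral_prod _ hx, integral_prod _ hx']
  simp only [h]

/-- `F` is a primitive of `G` in the middle variable in the application. Its integrability is
carried along because integration by parts on almost every slice needs both. -/
lemma integral_eq_zero_of_integral_snd_fst (hF : Integrable F (A.prod (B.prod C)))
    (hG : Integrable G (A.prod (B.prod C)))
    (h : ∀ x z, Integrable (fun y => F (x, y, z)) B → Integrable (fun y => G (x, y, z)) B →
      ∫ y, G (x, y, z) ∂B = 0) :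
    ∫ w, G w ∂A.prod (B.prod C) = 0 := by
  rw [integral_prod _ hG]
  refine integral_eq_zero_of_ae ?_
  filter_upwards [hF.prod_right_ae, hG.prod_right_ae] with x hx hx'
  rw [integral_prod_symm _ hx']
  refine integral_eq_zero_of_ae ?_
  filter_upwards [hx.prod_left_ae, hx'.prod_left_ae] with z hz hz'
  exact h x z hz hz'

end IteratedIntegrals

section Kernel

variable {N d : ℕ} {ε : ℝ} {ρ : Fin N → Measure (EuclideanSpace ℝ (Fin d))}

/-- The transition density of `N` independent Gaussian displacements. -/
def gaussianProduct (ε : ℝ) (X Y : Config N d) : ℝ :=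
  ∏ k, heatKernel ε (Y k - X k)

/-- The normalising factor of the reversed transition. -/
def convProduct (ε : ℝ) (ρ : Fin N → Measure (EuclideanSpace ℝ (Fin d))) (Y : Config N d) : ℝ :=
  ∏ k, ∫ x, heatKernel ε (Y k - x) ∂ρ k

/-- The density of `tripleMeasure` as a real number. -/
def tripleKernel (ε : ℝ) (ρ : Fin N → Measure (EuclideanSpace ℝ (Fin d)))
    (w : Config N d × Config N d × Config N d) : ℝ :=
  gaussianProduct ε w.1 w.2.1 * gaussianProduct ε w.2.2 w.2.1 / convProduct ε ρ w.2.1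

lemma gaussianProduct_pos (hε : 0 < ε) (X Y : Config N d) : 0 < gaussianProduct ε X Y :=
  Finset.prod_pos fun _ _ => heatKernel_pos hε _

lemma boundedSmooth_gaussianProduct (hε : 0 < ε) (Y : Config N d) :
    BoundedSmooth fun X => gaussianProduct ε X Y :=
  BoundedSmooth.prod _ fun k => (boundedSmooth_heatKernel_sub hε (Y k)).comp_apply k

lemma fderiv_gaussianProduct (hε : 0 < ε) (X Y : Config N d) (k : Fin N) (i : Fin d) :
    fderiv ℝ (fun X => gaussianProduct ε X Y) X (coordVec k i)
      = inner ℝ (Y k - X k) (EuclideanSpace.single i (1 : ℝ)) / ε * gaussianProduct ε X Y := by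
  rw [← ((boundedSmooth_gaussianProduct hε Y).differentiable X).lineDeriv_eq_fderiv]
  refine HasLineDerivAt.lineDeriv ?_
  refine hasLineDerivAt_prod (f := fun k x => heatKernel ε (Y k - x)) ?_
  have h := hasDerivAt_heatKernel_line (ε := ε) (Y k - X k) (-EuclideanSpace.single i (1 : ℝ)) 0
  rw [fderiv_heatKernel] at h
  simp only [zero_smul, add_zero, inner_neg_right, neg_div, neg_neg] at h
  refine h.congr_of_eventuallyEq (Eventually.of_forall fun t => ?_)
  dsimp only
  congr 1
  rw [smul_neg]
  abel

variable [∀ k, IsProbabilityMeasure (ρ k)] {ν : Measure (Config N d)}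

lemma convProduct_pos (hε : 0 < ε) (Y : Config N d) : 0 < convProduct ε ρ Y :=
  Finset.prod_pos fun _ _ => integral_heatKernel_sub_pos hε _

lemma tripleKernel_pos (hε : 0 < ε) (w : Config N d × Config N d × Config N d) :
    0 < tripleKernel ε ρ w :=
  div_pos (mul_pos (gaussianProduct_pos hε _ _) (gaussianProduct_pos hε _ _)) (convProduct_pos hε _)

lemma ofReal_tripleKernel (hε : 0 < ε) (w : Config N d × Config N d × Config N d) :
    ENNReal.ofReal (tripleKernel ε ρ w)
      = forwardDensity ε w.1 w.2.1 * backwardDensity ε ρ w.2.2 w.2.1 := by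
  have h1 : forwardDensity ε w.1 w.2.1 = ENNReal.ofReal (gaussianProduct ε w.1 w.2.1) :=
    (ENNReal.ofReal_prod_of_nonneg fun k _ => (heatKernel_pos hε _).le).symm
  have h2 : backwardDensity ε ρ w.2.2 w.2.1
      = ENNReal.ofReal (gaussianProduct ε w.2.2 w.2.1 / convProduct ε ρ w.2.1) := by
    rw [gaussianProduct, convProduct, ← Finset.prod_div_distrib, ENNReal.ofReal_prod_of_nonneg
      fun k _ => (div_pos (heatKernel_pos hε _) (integral_heatKernel_sub_pos hε _)).le]
    refine Finset.prod_congr rfl fun k _ => ?_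
    rw [ENNReal.ofReal_div_of_pos (integral_heatKernel_sub_pos hε _), convDensity_eq_ofReal hε]
  rw [h1, h2, ← ENNReal.ofReal_mul (gaussianProduct_pos hε _ _).le, tripleKernel, mul_div_assoc]

lemma tripleMeasure_eq_withDensity (hε : 0 < ε) :
    tripleMeasure ε ρ ν = (ν.prod ((lebesgue N d).prod (Measure.pi ρ))).withDensity
      fun w => ENNReal.ofReal (tripleKernel ε ρ w) := by
  simp only [ofReal_tripleKernel hε]
  rfl

lemma measurable_ofReal_tripleKernel (hε : 0 < ε) :
    Measurable fun w : Config N d × Config N d × Config N d =>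
      ENNReal.ofReal (tripleKernel ε ρ w) := by
  simp only [ofReal_tripleKernel hε]
  fun_prop

lemma integral_tripleMeasure (hε : 0 < ε) (F : Config N d × Config N d × Config N d → ℝ) :
    ∫ w, F w ∂tripleMeasure ε ρ ν
      = ∫ w, tripleKernel ε ρ w * F w ∂(ν.prod ((lebesgue N d).prod (Measure.pi ρ))) := by
  rw [tripleMeasure_eq_withDensity hε, integral_withDensity_eq_integral_toReal_smul
    (measurable_ofReal_tripleKernel hε) (ae_of_all _ fun _ => ENNReal.ofReal_lt_top)]
  simp only [ENNReal.toReal_ofReal (tripleKernel_pos hε _).le, smul_eq_mul]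

lemma integrable_tripleMeasure_iff (hε : 0 < ε) {F : Config N d × Config N d × Config N d → ℝ} :
    Integrable F (tripleMeasure ε ρ ν) ↔
      Integrable (fun w => tripleKernel ε ρ w * F w)
        (ν.prod ((lebesgue N d).prod (Measure.pi ρ))) := by
  rw [tripleMeasure_eq_withDensity hε, integrable_withDensity_iff_integrable_smul'
    (measurable_ofReal_tripleKernel hε) (ae_of_all _ fun _ => ENNReal.ofReal_lt_top)]
  simp only [ENNReal.toReal_ofReal (tripleKernel_pos hε _).le, smul_eq_mul]

/-- Logarithmic derivatives add up: each Gaussian contributes its displacement over `ε`, and the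
denominator contributes `backwardMean` with a minus sign. -/
lemma hasLineDerivAt_tripleKernel (hε : 0 < ε) {k : Fin N} {i : Fin d}
    {σ : EuclideanSpace ℝ (Fin d) → ℝ} (hσ : IsScore (ρ k) (EuclideanSpace.single i 1) σ)
    (X' Y X : Config N d) :
    HasLineDerivAt ℝ (fun Y => tripleKernel ε ρ (X', Y, X))
      ((-(inner ℝ (Y k - X' k) (EuclideanSpace.single i (1 : ℝ)) / ε)
        - inner ℝ (Y k - X k) (EuclideanSpace.single i (1 : ℝ)) / ε
        - backwardMean ε (ρ k) σ (Y k)) * tripleKernel ε ρ (X', Y, X)) Y (coordVec k i) := by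
  have hprod : ∀ Y, tripleKernel ε ρ (X', Y, X) = ∏ j, heatKernel ε (Y j - X' j)
      * heatKernel ε (Y j - X j) / ∫ x, heatKernel ε (Y j - x) ∂ρ j := fun Y => by
    rw [Finset.prod_div_distrib, Finset.prod_mul_distrib]
    rfl
  simp only [hprod]
  refine hasLineDerivAt_prod (f := fun j y => heatKernel ε (y - X' j)
      * heatKernel ε (y - X j) / ∫ x, heatKernel ε (y - x) ∂ρ j) ?_
  have hη : ∀ x : EuclideanSpace ℝ (Fin d), HasDerivAt
      (fun t : ℝ => heatKernel ε (Y k + t • EuclideanSpace.single i (1 : ℝ) - x))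
      (-(inner ℝ (Y k - x) (EuclideanSpace.single i (1 : ℝ)) / ε) * heatKernel ε (Y k - x)) 0 := by
    intro x
    have h := hasDerivAt_heatKernel_line (ε := ε) (Y k - x) (EuclideanSpace.single i (1 : ℝ)) 0
    rw [fderiv_heatKernel] at h
    simp only [zero_smul, add_zero] at h
    refine h.congr_of_eventuallyEq (Eventually.of_forall fun t => ?_)
    dsimp only
    congr 1
    abel
  have hb := (integral_heatKernel_sub_pos (ρ := ρ k) hε (Y k)).ne'
  have h := ((hη (X' k)).mul (hη (X k))).div (hasDerivAt_integral_heatKernel hε hσ (Y k))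
    (by simpa using hb)
  refine h.congr_deriv ?_
  simp only [zero_smul, add_zero, backwardMean]
  simp only [Pi.mul_apply, zero_smul, add_zero]
  field_simp
  ring

end Kernel

section IntegrationByParts

variable {N d : ℕ} {ε : ℝ} {ρ : Fin N → Measure (EuclideanSpace ℝ (Fin d))}
  {ν : Measure (Config N d)}

lemma integral_gaussianProduct_mul_score (hε : 0 < ε) {k : Fin N} {i : Fin d} {s : Config N d → ℝ}
    (hs : IsScore ν (coordVec k i) s) (Y : Config N d) :
    ∫ X, gaussianProduct ε X Y * s X ∂ν = ∫ X, gaussianProduct ε X Y *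
      -(inner ℝ (Y k - X k) (EuclideanSpace.single i (1 : ℝ)) / ε) ∂ν := by
  have hB := boundedSmooth_gaussianProduct hε Y
  have h := hs.ibp _ hB.contDiff hB.bound hB.bound_fderiv
  simp only [fderiv_gaussianProduct hε] at h
  rw [← neg_eq_iff_eq_neg.2 h, ← integral_neg]
  exact integral_congr_ae (ae_of_all _ fun X => by ring)

lemma integral_gaussianProduct_mul_fderiv (hε : 0 < ε) {k : Fin N} {i : Fin d}
    {s : Config N d → ℝ} (hs : IsScore ν (coordVec k i) s) {φ : Config N d → ℝ}
    (hφ : BoundedSmooth φ) (Y : Config N d) :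
    ∫ X, gaussianProduct ε X Y * (fderiv ℝ φ X (coordVec k i)
        + φ X * (inner ℝ (Y k - X k) (EuclideanSpace.single i (1 : ℝ)) / ε)) ∂ν
      = ∫ X, gaussianProduct ε X Y * -(φ X * s X) ∂ν := by
  have hB := (boundedSmooth_gaussianProduct hε Y)
  have hBφ := hB.mul hφ
  have h := hs.ibp _ hBφ.contDiff hBφ.bound hBφ.bound_fderiv
  rw [← integral_neg] at h
  refine Eq.trans ?_ (h.trans ?_)
  · refine integral_congr_ae (ae_of_all _ fun X => ?_)
    dsimp only
    rw [fderiv_fun_mul (hB.differentiable X) (hφ.differentiable X)]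
    simp only [add_apply, smul_apply, smul_eq_mul,
      fderiv_gaussianProduct hε]
    ring
  · exact integral_congr_ae (ae_of_all _ fun X => by ring)

/-- Integration by parts against the constant function `1`. -/
lemma integral_eq_zero_of_hasLineDerivAt {f f' : Config N d → ℝ} {e : Config N d}
    (hf : Integrable f (lebesgue N d)) (hf' : Integrable f' (lebesgue N d))
    (h : ∀ Y, HasLineDerivAt ℝ f (f' Y) Y e) : ∫ Y, f' Y ∂lebesgue N d = 0 := by
  have := integral_bilinear_hasLineDerivAt_right_eq_neg_left_of_integrable (μ := lebesgue N d)
    (f := fun _ : Config N d => (1 : ℝ)) (f' := fun _ => 0) (g := f) (g' := f') (v := e)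
    (B := ContinuousLinearMap.mul ℝ ℝ) (by simp) (by simpa using hf') (by simpa using hf)
    (fun x _ => by simpa [HasLineDerivAt] using hasDerivAt_const (0 : ℝ) (1 : ℝ)) (fun x _ => h x)
  simpa using this

variable [∀ k, IsProbabilityMeasure (ρ k)] [IsProbabilityMeasure ν]

/-- Put `u = ⟨Y_k - X'_k, e⟩ / ε`, `v = ⟨Y_k - X_k, e⟩ / ε` and `c` for the backward mean. The
kernel has logarithmic derivatives `u` in `X'`, `v` in `X` and `-u - v - c` in `Y`. One integration
by parts in each variable gives three relations, from which `u` and `v` are eliminated. -/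
theorem integral_fderiv_tripleMeasure (hε : 0 < ε) {k : Fin N} (hk : marginal ν k = ρ k)
    {i : Fin d} {s : Config N d → ℝ} (hs : IsScore ν (coordVec k i) s)
    {σ : EuclideanSpace ℝ (Fin d) → ℝ} (hσm : Measurable σ)
    (hσ : IsScore (ρ k) (EuclideanSpace.single i 1) σ)
    {φ : Config N d → ℝ} (hφ : BoundedSmooth φ) :
    ∫ w, fderiv ℝ φ w.2.2 (coordVec k i) ∂tripleMeasure ε ρ ν
      = -∫ w, φ w.2.2 * (s w.1 + σ (w.2.2 k) - backwardMean ε (ρ k) σ (w.2.1 k))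
          ∂tripleMeasure ε ρ ν := by
  have hJ := isProbabilityMeasure_tripleMeasure (ρ := ρ) (ν := ν) hε
  set e := EuclideanSpace.single i (1 : ℝ) with he
  set J := tripleMeasure ε ρ ν
  obtain ⟨C, hC⟩ := hφ.bound
  obtain ⟨C', hC'⟩ := hφ.bound_fderiv
  have hφm : Measurable fun w : Config N d × Config N d × Config N d => φ w.2.2 :=
    hφ.contDiff.continuous.measurable.comp (by fun_prop)
  have hφ'c : Continuous fun X => fderiv ℝ φ X (coordVec k i) :=
    (hφ.contDiff.continuous_fderiv (by simp)).clm_apply continuous_const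
  have hbdd : ∀ {f : Config N d × Config N d × Config N d → ℝ}, Integrable f J →
      Integrable (fun w => φ w.2.2 * f w) J := fun hf =>
    hf.bdd_mul hφm.aestronglyMeasurable (ae_of_all _ fun w => hC w.2.2)
  have i_der : Integrable (fun w => fderiv ℝ φ w.2.2 (coordVec k i)) J :=
    Integrable.of_bound (hφ'c.measurable.comp (by fun_prop)).aestronglyMeasurable
      (C' * ‖coordVec (N := N) k i‖)
      (ae_of_all _ fun X => ContinuousLinearMap.le_of_opNorm_le _ (hC' _) _)
  have i_s : Integrable (fun w => s w.1) J :=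
    (show MeasurePreserving Prod.fst J ν from
      ⟨measurable_fst, map_fst_tripleMeasure hε⟩).integrable_comp_of_integrable hs.integrable
  have i_σ : Integrable (fun w => σ (w.2.2 k)) J := integrable_target_apply hε hk hσ.integrable
  have i_c : Integrable (fun w => backwardMean ε (ρ k) σ (w.2.1 k)) J :=
    integrable_condExp.congr (backwardMean_ae_eq_condExp_tripleMeasure hε hk hσm hσ.integrable).symm
  have i_u : Integrable (fun w => inner ℝ (w.2.1 k - w.1 k) e / ε) J :=
    ((integrable_source_sub hε hk).inner_const e).div_const ε
  have i_v : Integrable (fun w => inner ℝ (w.2.1 k - w.2.2 k) e / ε) J :=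
    ((integrable_target_sub hε hk).inner_const e).div_const ε
  -- In `X'`, against `ν`: `E[φ s] = -E[φ u]`.
  have h1 : ∫ w, φ w.2.2 * s w.1 ∂J
      = ∫ w, φ w.2.2 * -(inner ℝ (w.2.1 k - w.1 k) e / ε) ∂J := by
    have e1 := hbdd i_s
    have e2 := hbdd i_u.neg
    rw [integrable_tripleMeasure_iff hε] at e1 e2
    rw [integral_tripleMeasure hε, integral_tripleMeasure hε]
    refine integral_congr_of_integral_fst e1 e2 fun q => ?_
    have key := integral_gaussianProduct_mul_score hε hs q.1
    have r1 : ∀ X, tripleKernel ε ρ (X, q) * (φ q.2 * s X)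
        = gaussianProduct ε q.2 q.1 / convProduct ε ρ q.1 * φ q.2 *
          (gaussianProduct ε X q.1 * s X) := fun X => by
      simp only [tripleKernel]; ring
    have r2 : ∀ X, tripleKernel ε ρ (X, q) * (φ q.2 * -(inner ℝ (q.1 k - X k) e / ε))
        = gaussianProduct ε q.2 q.1 / convProduct ε ρ q.1 * φ q.2 *
          (gaussianProduct ε X q.1 * -(inner ℝ (q.1 k - X k) e / ε)) := fun X => by
      simp only [tripleKernel]; ring
    simp only [r1, r2, integral_const_mul]
    rw [key]
  -- In `X`, against the product measure: `E[∂φ + φ v] = -E[φ σ]`.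
  have h2 : ∫ w, (fderiv ℝ φ w.2.2 (coordVec k i)
        + φ w.2.2 * (inner ℝ (w.2.1 k - w.2.2 k) e / ε)) ∂J = ∫ w, -(φ w.2.2 * σ (w.2.2 k)) ∂J := by
    have e1 := i_der.add (hbdd i_v)
    have e2 := (hbdd i_σ).neg
    rw [integrable_tripleMeasure_iff hε] at e1 e2
    rw [integral_tripleMeasure hε, integral_tripleMeasure hε]
    refine integral_congr_of_integral_snd_snd e1 e2 fun X' Y => ?_
    have key := integral_gaussianProduct_mul_fderiv hε (isScore_pi (ρ := ρ) hσ) hφ Y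
    have r : ∀ X t, tripleKernel ε ρ (X', Y, X) * t
        = gaussianProduct ε X' Y / convProduct ε ρ Y * (gaussianProduct ε X Y * t) := fun X t => by
      simp only [tripleKernel]; ring
    simp only [r, integral_const_mul]
    rw [key]
  -- In `Y`, against Lebesgue measure, where `φ` is constant: `E[φ (-u - v - c)] = 0`.
  have h3 : ∫ w, φ w.2.2 * (-(inner ℝ (w.2.1 k - w.1 k) e / ε)
      - inner ℝ (w.2.1 k - w.2.2 k) e / ε - backwardMean ε (ρ k) σ (w.2.1 k)) ∂J = 0 := by
    have e1 := hbdd (integrable_const (μ := J) (1 : ℝ))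
    have e2 := hbdd ((i_u.neg.sub i_v).sub i_c)
    rw [integrable_tripleMeasure_iff hε] at e1 e2
    rw [integral_tripleMeasure hε]
    refine integral_eq_zero_of_integral_snd_fst e1 e2 fun X' X j1 j2 => ?_
    refine integral_eq_zero_of_hasLineDerivAt (e := coordVec k i) j1 j2 fun Y => ?_
    have := (hasLineDerivAt_tripleKernel hε hσ X' Y X)
    have h4 := HasDerivAt.mul_const this (φ X)
    refine (h4.congr_deriv ?_).congr_of_eventuallyEq (Eventually.of_forall fun t => ?_)
    · rw [← he]
      ring
    · simp
  have t1 : ∫ w, φ w.2.2 * (-(inner ℝ (w.2.1 k - w.1 k) e / ε)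
      - inner ℝ (w.2.1 k - w.2.2 k) e / ε - backwardMean ε (ρ k) σ (w.2.1 k)) ∂J
      = ∫ w, φ w.2.2 * -(inner ℝ (w.2.1 k - w.1 k) e / ε) ∂J
        - ∫ w, φ w.2.2 * (inner ℝ (w.2.1 k - w.2.2 k) e / ε) ∂J
        - ∫ w, φ w.2.2 * backwardMean ε (ρ k) σ (w.2.1 k) ∂J := by
    simp only [mul_sub]
    exact integral_sub_sub (hbdd i_u.neg) (hbdd i_v) (hbdd i_c)
  have t2 : ∫ w, φ w.2.2 * (s w.1 + σ (w.2.2 k) - backwardMean ε (ρ k) σ (w.2.1 k)) ∂J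
      = ∫ w, φ w.2.2 * s w.1 ∂J + ∫ w, φ w.2.2 * σ (w.2.2 k) ∂J
        - ∫ w, φ w.2.2 * backwardMean ε (ρ k) σ (w.2.1 k) ∂J := by
    simp only [mul_sub, mul_add]
    exact integral_add_sub (hbdd i_s) (hbdd i_σ) (hbdd i_c)
  rw [integral_add i_der (hbdd i_v), integral_neg] at h2
  linarith

end IntegrationByParts

/-! ### Score and regularity of the smoothed measure -/

section Contraction

variable {Ω α : Type*} {mΩ : MeasurableSpace Ω} [MeasurableSpace α] {P : Measure Ω}
  [IsProbabilityMeasure P] {X : Ω → α} {S : Ω → ℝ}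

/-- Since `g(X)` is measurable with respect to `X`, `h(X) - g(X)` is the conditional expectation of
`S - g(X)`, and conditional expectation contracts `L^p`. -/
lemma eLpNorm_sub_le_of_condExp_eq (hX : Measurable X) (hS : Integrable S P) {h g : α → ℝ}
    (hh : Measurable h) (hg : Measurable g)
    (he : P[S | MeasurableSpace.comap X inferInstance] = fun w => h (X w))
    (hgi : Integrable (fun w => g (X w)) P) {p : ℝ≥0∞} (hp : 1 ≤ p) :
    eLpNorm (fun x => h x - g x) p (P.map X) ≤ eLpNorm (fun w => S w - g (X w)) p P := by
  have hhg : Measurable fun x => h x - g x := hh.sub hg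
  rw [eLpNorm_map_measure hhg.aestronglyMeasurable hX.aemeasurable]
  refine le_trans (le_of_eq (eLpNorm_congr_ae ?_))
    (eLpNorm_condExp_le_eLpNorm (m := MeasurableSpace.comap X inferInstance) _ hp)
  have h1 := condExp_sub hS hgi (MeasurableSpace.comap X inferInstance)
  have h2 : P[fun w => g (X w) | MeasurableSpace.comap X inferInstance] = fun w => g (X w) :=
    condExp_of_stronglyMeasurable hX.comap_le
      (hg.comp (comap_measurable X)).stronglyMeasurable hgi
  rw [he, h2] at h1
  exact h1.symm

end Contraction

section AbsoluteContinuity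

variable {N d : ℕ} {μ : Measure (Config N d)}

lemma marginal_absolutelyContinuous (hμ : μ ≪ volume) (k : Fin N) : marginal μ k ≪ volume :=
  (hμ.map (measurable_pi_apply k)).trans (Measure.quasiMeasurePreserving_eval
    (fun _ : Fin N => (volume : Measure (EuclideanSpace ℝ (Fin d)))) k).absolutelyContinuous

variable [IsProbabilityMeasure μ]

lemma pi_marginal_eq_withDensity (hμ : μ ≪ volume) :
    Measure.pi (marginal μ) = (lebesgue N d).withDensity
      fun X => ∏ k, (marginal μ k).rnDeriv volume (X k) := by
  have h : ∀ k, volume.withDensity ((marginal μ k).rnDeriv volume) = marginal μ k := fun k =>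
    Measure.withDensity_rnDeriv_eq _ _ (marginal_absolutelyContinuous hμ k)
  have : ∀ k, SigmaFinite (volume.withDensity ((marginal μ k).rnDeriv volume)) := fun k => by
    rw [h k]; infer_instance
  have h2 := pi_withDensity (fun _ : Fin N => (volume : Measure (EuclideanSpace ℝ (Fin d))))
    (f := fun k => (marginal μ k).rnDeriv volume) fun k => Measure.measurable_rnDeriv _ _
  simp only [h] at h2
  exact h2

lemma pi_marginal_absolutelyContinuous (hμ : μ ≪ volume) :
    Measure.pi (marginal μ) ≪ volume := by
  rw [pi_marginal_eq_withDensity hμ]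
  exact withDensity_absolutelyContinuous _ _

/-- Each marginal density is positive at `X k` for `μ`-almost every `X`, so `μ` lives where the
density of the product is positive; there a null set of the product is Lebesgue null. -/
lemma absolutelyContinuous_pi_marginal (hμ : μ ≪ volume) : μ ≪ Measure.pi (marginal μ) := by
  have hm : Measurable fun X : Config N d => ∏ k, (marginal μ k).rnDeriv volume (X k) :=
    Finset.measurable_fun_prod _ fun k _ =>
      (Measure.measurable_rnDeriv _ _).comp (measurable_pi_apply k)
  have hpos : ∀ᵐ X ∂μ, (∏ k, (marginal μ k).rnDeriv volume (X k)) ≠ 0 := by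
    have h1 : ∀ k, ∀ᵐ X ∂μ, (marginal μ k).rnDeriv volume (X k) ≠ 0 := fun k => by
      have h2 := Measure.rnDeriv_pos (marginal_absolutelyContinuous hμ k)
      filter_upwards [ae_of_ae_map (measurable_pi_apply k).aemeasurable h2] with X hX
      exact hX.ne'
    filter_upwards [ae_all_iff.2 h1] with X hX
    exact Finset.prod_ne_zero_iff.2 fun k _ => hX k
  rw [pi_marginal_eq_withDensity hμ]
  refine Measure.AbsolutelyContinuous.mk fun A hA h0 => ?_
  rw [withDensity_apply_eq_zero hm] at h0
  have h3 := hμ h0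
  rw [ae_iff] at hpos
  refine measure_mono_null (fun X hX => ?_) (measure_union_null h3 hpos)
  by_cases h : (∏ k, (marginal μ k).rnDeriv volume (X k)) = 0
  · exact Or.inr (by simpa using h)
  · exact Or.inl ⟨h, hX⟩

lemma theta_absolutelyContinuous (hμ : μ ≪ volume) (ε : ℝ) : theta ε μ ≪ volume := by
  rw [← map_tripleMeasure_eq_theta]
  exact absolutelyContinuous_map_tripleMeasure.trans (pi_marginal_absolutelyContinuous hμ)

lemma isProbabilityMeasure_theta {ε : ℝ} (hε : 0 < ε) : IsProbabilityMeasure (theta ε μ) := by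
  have := isProbabilityMeasure_tripleMeasure (ρ := marginal μ) (ν := μ) hε
  rw [← map_tripleMeasure_eq_theta]
  exact Measure.isProbabilityMeasure_map (by fun_prop)

end AbsoluteContinuity

section ThetaScore

variable {N d : ℕ} {μ : Measure (Config N d)} [IsProbabilityMeasure μ]

/-- The random variable whose conditional mean given the last component is the score of
`theta ε μ`. -/
def tripleScore (ε : ℝ) (μ : Measure (Config N d)) (k : Fin N) (s : Config N d → ℝ)
    (σ : EuclideanSpace ℝ (Fin d) → ℝ) (w : Config N d × Config N d × Config N d) : ℝ :=
  s w.1 + σ (w.2.2 k) - backwardMean ε (marginal μ k) σ (w.2.1 k)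

lemma memLp_tripleScore {ε : ℝ} (hε : 0 < ε) {k : Fin N} {p : ℝ≥0∞} (hp : 1 ≤ p)
    {s : Config N d → ℝ} (hs : MemLp s p μ) {σ : EuclideanSpace ℝ (Fin d) → ℝ}
    (hσm : Measurable σ) (hσ : MemLp σ p (marginal μ k)) :
    MemLp (tripleScore ε μ k s σ) p (tripleMeasure ε (marginal μ) μ) := by
  have := isProbabilityMeasure_tripleMeasure (ρ := marginal μ) (ν := μ) hε
  have h1 : MemLp (fun w => s w.1) p (tripleMeasure ε (marginal μ) μ) :=
    hs.comp_measurePreserving ⟨measurable_fst, map_fst_tripleMeasure hε⟩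
  have h2 : MemLp (fun w => σ (w.2.2 k)) p (tripleMeasure ε (marginal μ) μ) :=
    hσ.comp_measurePreserving
      (show MeasurePreserving (fun w => w.2.2 k) (tripleMeasure ε (marginal μ) μ) (marginal μ k) from
        ⟨by fun_prop, map_target_apply_tripleMeasure hε rfl⟩)
  have h3 := (memLp_congr_ae (backwardMean_ae_eq_condExp_tripleMeasure (ν := μ) hε rfl hσm
    (hσ.integrable hp))).2 (MemLp.condExp hp h2)
  exact (h1.add h2).sub h3

/-- The score is the conditional expectation of `tripleScore` given `X`. The comparison function `g`
has two uses: `g = 0` bounds the score in `L^p`, and `g` close to `s` yields convergence. -/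
lemma exists_isScore_theta {ε : ℝ} (hε : 0 < ε) {k : Fin N} {i : Fin d} {s : Config N d → ℝ}
    (hs : IsScore μ (coordVec k i) s) {σ : EuclideanSpace ℝ (Fin d) → ℝ} (hσm : Measurable σ)
    (hσ : IsScore (marginal μ k) (EuclideanSpace.single i 1) σ) :
    ∃ h, Measurable h ∧ IsScore (theta ε μ) (coordVec k i) h ∧
      ∀ p : ℝ≥0∞, 1 ≤ p → ∀ g : Config N d → ℝ, Measurable g → (∃ C, ∀ X, |g X| ≤ C) →
        eLpNorm (fun X => h X - g X) p (theta ε μ)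
          ≤ eLpNorm (fun w => tripleScore ε μ k s σ w - g w.2.2) p
            (tripleMeasure ε (marginal μ) μ) := by
  have hJ := isProbabilityMeasure_tripleMeasure (ρ := marginal μ) (ν := μ) hε
  have hX : Measurable fun w : Config N d × Config N d × Config N d => w.2.2 := by fun_prop
  have hSi : Integrable (tripleScore ε μ k s σ) (tripleMeasure ε (marginal μ) μ) :=
    memLp_one_iff_integrable.1 (memLp_tripleScore hε le_rfl (memLp_one_iff_integrable.2 hs.integrable)
      hσm (memLp_one_iff_integrable.2 hσ.integrable))
  obtain ⟨h, hm, he⟩ := exists_condExp_eq_comp (tripleMeasure ε (marginal μ) μ)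
    (fun w : Config N d × Config N d × Config N d => w.2.2) (tripleScore ε μ k s σ)
  refine ⟨h, hm, ⟨?_, fun φ hφ hb hb' => ?_⟩, fun p hp g hg hC => ?_⟩
  · rw [← map_tripleMeasure_eq_theta, integrable_map_measure hm.aestronglyMeasurable hX.aemeasurable]
    have : Integrable (fun w => h w.2.2) (tripleMeasure ε (marginal μ) μ) := he ▸ integrable_condExp
    exact this
  · have hm1 : Measurable fun X => fderiv ℝ φ X (coordVec k i) :=
      ((hφ.continuous_fderiv (by simp)).clm_apply continuous_const).measurable
    have hm2 : Measurable fun X => φ X * h X := hφ.continuous.measurable.mul hm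
    rw [← map_tripleMeasure_eq_theta, integral_map hX.aemeasurable hm1.aestronglyMeasurable,
      integral_map hX.aemeasurable hm2.aestronglyMeasurable,
      integral_fderiv_tripleMeasure hε rfl hs hσm hσ ⟨hφ, hb, hb'⟩]
    obtain ⟨C, hC⟩ := hb
    have key := integral_comp_mul_condExp hX hSi hφ.continuous.measurable hC
    rw [he] at key
    exact congrArg Neg.neg key
  · rw [← map_tripleMeasure_eq_theta]
    obtain ⟨C, hC⟩ := hC
    exact eLpNorm_sub_le_of_condExp_eq hX hSi hm hg he (Integrable.of_bound
      (hg.comp hX).aestronglyMeasurable C (ae_of_all _ fun w => hC _)) hp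

lemma exists_isScore_marginal {k : Fin N} {i : Fin d} {s : Config N d → ℝ}
    (hs : IsScore μ (coordVec k i) s) {p : ℝ≥0∞} (hp : 1 ≤ p) (hsp : MemLp s p μ) :
    ∃ σ, Measurable σ ∧ MemLp σ p (marginal μ k) ∧
      IsScore (marginal μ k) (EuclideanSpace.single i 1) σ := by
  obtain ⟨σ, hm, he⟩ := exists_condExp_eq_comp μ (fun X : Config N d => X k) s
  have hk : Measurable fun X : Config N d => X k := measurable_pi_apply k
  refine ⟨σ, hm, ?_, isScore_marginal hs hm he⟩
  rw [marginal, memLp_map_measure_iff hm.aestronglyMeasurable hk.aemeasurable]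
  have : MemLp (fun X : Config N d => σ (X k)) p μ := he ▸ MemLp.condExp hp hsp
  exact this

lemma isW1pRegular_of_isScore {p : ℝ} (hp : 1 < p) (hμ : μ ≪ volume)
    {s : Fin N → Fin d → Config N d → ℝ} (hs : ∀ k i, Measurable (s k i))
    (hsp : ∀ k i, MemLp (s k i) (ENNReal.ofReal p) μ)
    (h : ∀ k i, IsScore μ (coordVec k i) (s k i)) : IsW1pRegular p μ := by
  refine ⟨inferInstance, hμ, ?_, fun k i X => 1 / p * (rootDensity p μ X * s k i X),
    fun k i => (h k i).hasWeakLineDeriv_rootDensity hp hμ (hs k i) (hsp k i), fun k i => ?_⟩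
  · have := (memLp_rootDensity_mul_iff hp hμ (s := fun _ => 1) (by fun_prop)).2
      (memLp_const (1 : ℝ))
    simpa using this
  · exact ((memLp_rootDensity_mul_iff hp hμ (hs k i).aemeasurable).2 (hsp k i)).const_mul _

end ThetaScore

/-! ### Small displacements -/

section SmallIncrements

variable {E : Type*} [NormedAddCommGroup E]

/-- Small increments are handled by uniform continuity, large ones by boundedness. The bound is
linear in `‖x - y‖`, so `L^1` control of displacements suffices for every `p`. -/
lemma exists_rpow_abs_sub_le {g : E → ℝ} (hg : Continuous g) (hc : HasCompactSupport g) {p : ℝ}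
    (hp : 0 < p) {η : ℝ} (hη : 0 < η) :
    ∃ K, 0 ≤ K ∧ ∀ x y, |g x - g y| ^ p ≤ η + K * ‖x - y‖ := by
  obtain ⟨B, hB⟩ := hc.exists_bound_of_continuous hg
  have hB0 : 0 ≤ B := (norm_nonneg _).trans (hB 0)
  have hu : UniformContinuous g := hc.uniformContinuous_of_continuous hg
  obtain ⟨r, hr, h⟩ := Metric.uniformContinuous_iff.1 hu (η ^ (1 / p)) (by positivity)
  refine ⟨(2 * B) ^ p / r, by positivity, fun x y => ?_⟩
  rcases lt_or_ge ‖x - y‖ r with hxy | hxy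
  · have h1 := h (a := x) (b := y) (by rwa [dist_eq_norm])
    rw [Real.dist_eq] at h1
    calc |g x - g y| ^ p ≤ (η ^ (1 / p)) ^ p := by gcongr
      _ = η := by rw [← Real.rpow_mul hη.le, one_div_mul_cancel hp.ne', Real.rpow_one]
      _ ≤ _ := le_add_of_nonneg_right (by positivity)
  · have h1 : |g x - g y| ≤ 2 * B := by
      refine (norm_sub_le (g x) (g y)).trans ?_
      linarith [hB x, hB y]
    calc |g x - g y| ^ p ≤ (2 * B) ^ p := by gcongr
      _ = (2 * B) ^ p / r * r := by field_simp
      _ ≤ (2 * B) ^ p / r * ‖x - y‖ := by gcongr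
      _ ≤ _ := le_add_of_nonneg_left hη.le

lemma tendsto_zero_of_forall_le_add {ι : Type*} {l : Filter ι} {f : ι → ℝ≥0∞}
    (h : ∀ η : ℝ≥0∞, 0 < η → ∃ u : ι → ℝ≥0∞, Tendsto u l (𝓝 0) ∧ ∀ᶠ x in l, f x ≤ η + u x) :
    Tendsto f l (𝓝 0) := by
  rw [ENNReal.tendsto_nhds_zero]
  intro η hη
  obtain ⟨u, hu, hf⟩ := h (η / 2) (ENNReal.half_pos hη.ne')
  filter_upwards [hf, (ENNReal.tendsto_nhds_zero.1 hu) (η / 2) (ENNReal.half_pos hη.ne')]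
    with x h1 h2
  calc f x ≤ η / 2 + η / 2 := h1.trans (by gcongr)
    _ = η := ENNReal.add_halves η

lemma tendsto_zero_of_rpow {ι : Type*} {l : Filter ι} {f : ι → ℝ≥0∞} {p : ℝ} (hp : 0 < p)
    (h : Tendsto (fun x => f x ^ p) l (𝓝 0)) : Tendsto f l (𝓝 0) := by
  have h1 := h.ennrpow_const (1 / p)
  rw [ENNReal.zero_rpow_of_pos (by positivity)] at h1
  simpa [← ENNReal.rpow_mul, hp.ne'] using h1

lemma eLpNorm_rpow_eq_lintegral {Ω : Type*} {mΩ : MeasurableSpace Ω} {P : Measure Ω} {p : ℝ}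
    (hp : 0 < p) (f : Ω → ℝ) :
    eLpNorm f (ENNReal.ofReal p) P ^ p = ∫⁻ w, ENNReal.ofReal (|f w| ^ p) ∂P := by
  rw [eLpNorm_eq_lintegral_rpow_enorm_toReal (by simpa using hp) ENNReal.ofReal_ne_top,
    ENNReal.toReal_ofReal hp.le, ← ENNReal.rpow_mul, one_div_mul_cancel hp.ne', ENNReal.rpow_one]
  refine lintegral_congr fun w => ?_
  rw [← ENNReal.ofReal_rpow_of_nonneg (abs_nonneg _) hp.le, ← Real.norm_eq_abs, ofReal_norm]

variable [MeasurableSpace E] [BorelSpace E] [SecondCountableTopology E]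
  {Ω ι : Type*} {mΩ : MeasurableSpace Ω} {P : ι → Measure Ω} {X Y : Ω → E} {l : Filter ι}

lemma tendsto_eLpNorm_comp_sub_comp (hX : Measurable X) (hY : Measurable Y)
    (hP : ∀ᶠ t in l, IsProbabilityMeasure (P t))
    (h : Tendsto (fun t => ∫⁻ w, ‖X w - Y w‖ₑ ∂P t) l (𝓝 0)) {g : E → ℝ} (hg : Continuous g)
    (hc : HasCompactSupport g) {p : ℝ} (hp : 0 < p) :
    Tendsto (fun t => eLpNorm (fun w => g (X w) - g (Y w)) (ENNReal.ofReal p) (P t)) l (𝓝 0) := by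
  refine tendsto_zero_of_rpow hp (tendsto_zero_of_forall_le_add fun η hη => ?_)
  obtain ⟨η', hη', hle⟩ : ∃ η' : ℝ, 0 < η' ∧ ENNReal.ofReal η' ≤ η := by
    obtain ⟨q, hq, hq'⟩ := ENNReal.lt_iff_exists_nnreal_btwn.1 hη
    exact ⟨q, by exact_mod_cast hq, by simpa using hq'.le⟩
  obtain ⟨K, hK, hgK⟩ := exists_rpow_abs_sub_le hg hc hp hη'
  refine ⟨fun t => ENNReal.ofReal K * ∫⁻ w, ‖X w - Y w‖ₑ ∂P t, ?_, ?_⟩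
  · simpa using ENNReal.Tendsto.const_mul h (Or.inr ENNReal.ofReal_ne_top)
  · filter_upwards [hP] with t ht
    rw [eLpNorm_rpow_eq_lintegral hp]
    have hm : Measurable fun w => ‖X w - Y w‖ₑ := (hX.sub hY).enorm
    calc _ ≤ ∫⁻ w, (ENNReal.ofReal η' + ENNReal.ofReal K * ‖X w - Y w‖ₑ) ∂P t := by
          refine lintegral_mono fun w => ?_
          rw [← ofReal_norm, ← ENNReal.ofReal_mul hK, ← ENNReal.ofReal_add hη'.le (by positivity)]
          exact ENNReal.ofReal_le_ofReal (hgK _ _)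
      _ = ENNReal.ofReal η' + ENNReal.ofReal K * ∫⁻ w, ‖X w - Y w‖ₑ ∂P t := by
          rw [lintegral_add_left measurable_const, lintegral_const_mul _ hm, lintegral_const]
          simp
      _ ≤ _ := by gcongr

end SmallIncrements

section Displacement

variable {N d : ℕ} {ρ : Fin N → Measure (EuclideanSpace ℝ (Fin d))}
  [∀ k, IsProbabilityMeasure (ρ k)] {ν : Measure (Config N d)} [IsProbabilityMeasure ν]

lemma tendsto_const_mul_sqrt (c : ℝ) :
    Tendsto (fun ε : ℝ => ENNReal.ofReal (c * √ε)) (𝓝[>] 0) (𝓝 0) := by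
  have h : Continuous fun ε : ℝ => ENNReal.ofReal (c * √ε) :=
    ENNReal.continuous_ofReal.comp (by fun_prop)
  have := h.tendsto 0
  simp only [Real.sqrt_zero, mul_zero, ENNReal.ofReal_zero] at this
  exact this.mono_left nhdsWithin_le_nhds

lemma tendsto_lintegral_source_sub {k : Fin N} (hk : marginal ν k = ρ k) :
    Tendsto (fun ε => ∫⁻ w, ‖w.1 k - w.2.1 k‖ₑ ∂tripleMeasure ε ρ ν) (𝓝[>] 0) (𝓝 0) := by
  refine tendsto_of_tendsto_of_tendsto_of_le_of_le' tendsto_const_nhds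
    (tendsto_const_mul_sqrt (2 * 2 ^ ((d : ℝ) / 2))) (Eventually.of_forall fun _ => zero_le) ?_
  filter_upwards [self_mem_nhdsWithin] with ε hε
  exact le_of_eq_of_le (lintegral_congr fun w => enorm_sub_rev _ _)
    (lintegral_enorm_source_sub_le hε hk)

lemma tendsto_lintegral_target_sub {k : Fin N} (hk : marginal ν k = ρ k) :
    Tendsto (fun ε => ∫⁻ w, ‖w.2.2 k - w.2.1 k‖ₑ ∂tripleMeasure ε ρ ν) (𝓝[>] 0) (𝓝 0) := by
  refine tendsto_of_tendsto_of_tendsto_of_le_of_le' tendsto_const_nhds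
    (tendsto_const_mul_sqrt (2 * 2 ^ ((d : ℝ) / 2))) (Eventually.of_forall fun _ => zero_le) ?_
  filter_upwards [self_mem_nhdsWithin] with ε hε
  exact le_of_eq_of_le (lintegral_congr fun w => enorm_sub_rev _ _)
    (lintegral_enorm_target_sub_le hε hk)

lemma enorm_config_le (X : Config N d) : ‖X‖ₑ ≤ ∑ k, ‖X k‖ₑ := by
  have h : ‖X‖ ≤ ∑ k, ‖X k‖ :=
    (pi_norm_le_iff_of_nonneg (Finset.sum_nonneg fun _ _ => norm_nonneg _)).2 fun k =>
      Finset.single_le_sum (f := fun k => ‖X k‖) (fun _ _ => norm_nonneg _) (Finset.mem_univ k)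
  simp only [← ofReal_norm]
  rw [← ENNReal.ofReal_sum_of_nonneg fun _ _ => norm_nonneg _]
  exact ENNReal.ofReal_le_ofReal h

/-- Triangle inequality through `Y`, component by component. -/
lemma tendsto_lintegral_source_sub_target (hρ : ∀ k, marginal ν k = ρ k) :
    Tendsto (fun ε => ∫⁻ w, ‖w.1 - w.2.2‖ₑ ∂tripleMeasure ε ρ ν) (𝓝[>] 0) (𝓝 0) := by
  have h := tendsto_finsetSum Finset.univ fun k _ =>
    (tendsto_lintegral_source_sub (hρ k)).add (tendsto_lintegral_target_sub (hρ k))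
  simp only [add_zero, Finset.sum_const_zero] at h
  refine tendsto_of_tendsto_of_tendsto_of_le_of_le tendsto_const_nhds h
    (fun _ => zero_le) fun ε => ?_
  dsimp only
  have hm1 : ∀ k, Measurable fun w : Config N d × Config N d × Config N d =>
    ‖w.1 k - w.2.1 k‖ₑ := fun k => by fun_prop
  have hm2 : ∀ k, Measurable fun w : Config N d × Config N d × Config N d =>
    ‖w.2.2 k - w.2.1 k‖ₑ := fun k => by fun_prop
  have hs : ∀ k, ∫⁻ w, ‖w.1 k - w.2.1 k‖ₑ ∂tripleMeasure ε ρ ν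
      + ∫⁻ w, ‖w.2.2 k - w.2.1 k‖ₑ ∂tripleMeasure ε ρ ν
      = ∫⁻ w, (‖w.1 k - w.2.1 k‖ₑ + ‖w.2.2 k - w.2.1 k‖ₑ) ∂tripleMeasure ε ρ ν := fun k =>
    (lintegral_add_left (hm1 k) _).symm
  simp only [hs]
  have hm3 : ∀ k, Measurable fun w : Config N d × Config N d × Config N d =>
    ‖w.1 k - w.2.1 k‖ₑ + ‖w.2.2 k - w.2.1 k‖ₑ := fun k => (hm1 k).add (hm2 k)
  rw [← lintegral_finsetSum _ fun k _ => hm3 k]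
  refine lintegral_mono fun w => (enorm_config_le _).trans (Finset.sum_le_sum fun k _ => ?_)
  rw [Pi.sub_apply, ← sub_sub_sub_cancel_right _ _ (w.2.1 k)]
  exact enorm_sub_le

end Displacement

/-! ### Convergence of the densities in `L^1` and of their roots in `L^p` -/

section Transport

variable {Ω α : Type*} {mΩ : MeasurableSpace Ω} [MeasurableSpace α] {P : Measure Ω}
  {X X' : Ω → α}

/-- Both `X'` and `X` have law `m`, so both integrals become integrals of `B(X)` under `P`, one
weighted by the density at `X'`, the other by the density at `X`. -/
lemma abs_integral_withDensity_sub_le {m μ : Measure α} [IsFiniteMeasure μ] [SigmaFinite m]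
    (hμ : μ ≪ m) (hX' : MeasurePreserving X' P m) (hX : MeasurePreserving X P m) {B : α → ℝ}
    (hB : Measurable B) (hB1 : ∀ x, |B x| ≤ 1) :
    |∫ w, B (X w) ∂P.withDensity (fun w => μ.rnDeriv m (X' w)) - ∫ x, B x ∂μ|
      ≤ ∫ w, |(μ.rnDeriv m (X' w)).toReal - (μ.rnDeriv m (X w)).toReal| ∂P := by
  have hr := Measure.measurable_rnDeriv μ m
  have i1 : Integrable (fun w => (μ.rnDeriv m (X' w)).toReal) P :=
    hX'.integrable_comp_of_integrable Measure.integrable_toReal_rnDeriv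
  have i2 : Integrable (fun w => (μ.rnDeriv m (X w)).toReal) P :=
    hX.integrable_comp_of_integrable Measure.integrable_toReal_rnDeriv
  have hBX := hB.comp hX.measurable
  have b1 : Integrable (fun w => (μ.rnDeriv m (X' w)).toReal * B (X w)) P :=
    i1.mul_bdd hBX.aestronglyMeasurable (ae_of_all _ fun w => hB1 (X w))
  have b2 : Integrable (fun w => (μ.rnDeriv m (X w)).toReal * B (X w)) P :=
    i2.mul_bdd hBX.aestronglyMeasurable (ae_of_all _ fun w => hB1 (X w))
  have e1 : ∫ w, B (X w) ∂P.withDensity (fun w => μ.rnDeriv m (X' w))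
      = ∫ w, (μ.rnDeriv m (X' w)).toReal * B (X w) ∂P :=
    integral_withDensity_eq_integral_toReal_smul (hr.comp hX'.measurable)
        (hX'.quasiMeasurePreserving.ae (Measure.rnDeriv_lt_top _ _)) _
  have e2 : ∫ x, B x ∂μ = ∫ w, (μ.rnDeriv m (X w)).toReal * B (X w) ∂P := by
    have hm : Measurable fun x => (μ.rnDeriv m x).toReal * B x := hr.ennreal_toReal.mul hB
    have h1 : ∫ x, (μ.rnDeriv m x).toReal * B x ∂m = ∫ x, B x ∂μ := integral_rnDeriv_smul hμ
    have h2 := integral_map (μ := P) hX.aemeasurable hm.aestronglyMeasurable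
    rw [hX.map_eq] at h2
    exact h1.symm.trans h2
  rw [e1, e2, ← integral_sub b1 b2]
  refine (norm_integral_le_integral_norm _).trans (integral_mono
    (b1.sub b2).norm (i1.sub i2).abs fun w => ?_)
  simp only [Pi.sub_apply]
  rw [← sub_mul, norm_mul]
  exact mul_le_of_le_one_right (norm_nonneg _) (hB1 _)

lemma eLpNorm_comp_sub_comp_le {m : Measure α} (hX' : MeasurePreserving X' P m)
    (hX : MeasurePreserving X P m) {f g : α → ℝ} (hf : Measurable f) (hg : Measurable g)
    {p : ℝ≥0∞} (hp : 1 ≤ p) :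
    eLpNorm (fun w => f (X' w) - f (X w)) p P
      ≤ 2 * eLpNorm (f - g) p m + eLpNorm (fun w => g (X' w) - g (X w)) p P := by
  have hfg : AEStronglyMeasurable (f - g) m := (hf.sub hg).aestronglyMeasurable
  have a1 : AEStronglyMeasurable (fun w => (f - g) (X' w)) P := hfg.comp_measurePreserving hX'
  have a2 : AEStronglyMeasurable (fun w => (f - g) (X w)) P := hfg.comp_measurePreserving hX
  have a3 : AEStronglyMeasurable (fun w => g (X' w) - g (X w)) P :=
    ((hg.comp hX'.measurable).sub (hg.comp hX.measurable)).aestronglyMeasurable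
  have e : (fun w => f (X' w) - f (X w)) = (fun w => (f - g) (X' w))
      + (fun w => g (X' w) - g (X w)) - (fun w => (f - g) (X w)) := by
    funext w
    simp only [Pi.sub_apply, Pi.add_apply]
    ring
  have n1 : eLpNorm (fun w => (f - g) (X' w)) p P = eLpNorm (f - g) p m :=
    eLpNorm_comp_measurePreserving hfg hX'
  have n2 : eLpNorm (fun w => (f - g) (X w)) p P = eLpNorm (f - g) p m :=
    eLpNorm_comp_measurePreserving hfg hX
  rw [e]
  refine ((eLpNorm_sub_le (a1.add a3) a2 hp).trans
    (add_le_add (eLpNorm_add_le a1 a3 hp) le_rfl)).trans_eq ?_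
  rw [n1, n2, two_mul, add_right_comm]

end Transport

section L1Convergence

variable {N d : ℕ} {μ : Measure (Config N d)} {ε : ℝ}

lemma marginal_pi (ρ : Fin N → Measure (EuclideanSpace ℝ (Fin d)))
    [∀ k, IsProbabilityMeasure (ρ k)] (k : Fin N) : marginal (Measure.pi ρ) k = ρ k :=
  (measurePreserving_eval ρ k).map_eq

lemma map_target_tripleMeasure_pi {ρ : Fin N → Measure (EuclideanSpace ℝ (Fin d))}
    [∀ k, IsProbabilityMeasure (ρ k)] (hε : 0 < ε) :
    (tripleMeasure ε ρ (Measure.pi ρ)).map (fun w => w.2.2) = Measure.pi ρ := by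
  refine Measure.ext_of_lintegral _ fun F hF => ?_
  rw [lintegral_map hF (by fun_prop),
    ← lintegral_tripleMeasure_swap (F := fun X' _ => F X') (hF.comp measurable_fst),
    ← lintegral_map (μ := tripleMeasure ε ρ (Measure.pi ρ)) hF measurable_fst,
    map_fst_tripleMeasure hε]

lemma measurePreserving_fst_tripleMeasure {ρ : Fin N → Measure (EuclideanSpace ℝ (Fin d))}
    [∀ k, IsProbabilityMeasure (ρ k)] {ν : Measure (Config N d)} [SFinite ν] (hε : 0 < ε) :
    MeasurePreserving (fun w => w.1) (tripleMeasure ε ρ ν) ν :=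
  ⟨measurable_fst, map_fst_tripleMeasure hε⟩

lemma measurePreserving_target_tripleMeasure_pi {ρ : Fin N → Measure (EuclideanSpace ℝ (Fin d))}
    [∀ k, IsProbabilityMeasure (ρ k)] (hε : 0 < ε) :
    MeasurePreserving (fun w => w.2.2) (tripleMeasure ε ρ (Measure.pi ρ)) (Measure.pi ρ) :=
  ⟨by fun_prop, map_target_tripleMeasure_pi hε⟩

/-- The density of `μ` with respect to the product of its marginals. -/
def couplingDensity (μ : Measure (Config N d)) (X : Config N d) : ℝ :=
  (μ.rnDeriv (Measure.pi (marginal μ)) X).toReal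

lemma measurable_couplingDensity : Measurable (couplingDensity μ) :=
  (Measure.measurable_rnDeriv _ _).ennreal_toReal

variable [IsProbabilityMeasure μ]

lemma integrable_couplingDensity : Integrable (couplingDensity μ) (Measure.pi (marginal μ)) :=
  Measure.integrable_toReal_rnDeriv

/-- The two transitions do not depend on the initial law once the marginals are fixed, so changing
that law only reweights by a function of `X'`. -/
lemma tripleMeasure_eq_withDensity_rnDeriv (hμ : μ ≪ volume) :
    tripleMeasure ε (marginal μ) μ
      = (tripleMeasure ε (marginal μ) (Measure.pi (marginal μ))).withDensity
        fun w => μ.rnDeriv (Measure.pi (marginal μ)) w.1 := by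
  have hr := Measure.measurable_rnDeriv μ (Measure.pi (marginal μ))
  have h := Measure.withDensity_rnDeriv_eq _ _ (absolutelyContinuous_pi_marginal hμ)
  refine Measure.ext_of_lintegral _ fun F hF => ?_
  have hr1 : Measurable fun w : Config N d × Config N d × Config N d =>
    μ.rnDeriv (Measure.pi (marginal μ)) w.1 := hr.comp measurable_fst
  rw [lintegral_withDensity_eq_lintegral_mul _ hr1 hF, lintegral_tripleMeasure (hr1.mul hF),
    lintegral_tripleMeasure hF]
  have hA : Measurable fun X' : Config N d => ∫⁻ Y, ∫⁻ X, forwardDensity ε X' Y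
      * backwardDensity ε (marginal μ) X Y * F (X', Y, X) ∂Measure.pi (marginal μ) ∂lebesgue N d := by
    refine Measurable.lintegral_prod_right' (f := fun q : Config N d × Config N d =>
      ∫⁻ X, forwardDensity ε q.1 q.2 * backwardDensity ε (marginal μ) X q.2 * F (q.1, q.2, X)
        ∂Measure.pi (marginal μ)) ?_
    exact Measurable.lintegral_prod_right' (f := fun r : (Config N d × Config N d) × Config N d =>
      forwardDensity ε r.1.1 r.1.2 * backwardDensity ε (marginal μ) r.2 r.1.2
        * F (r.1.1, r.1.2, r.2)) (by fun_prop)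
  have h2 := lintegral_withDensity_eq_lintegral_mul (Measure.pi (marginal μ)) hr hA
  rw [h] at h2
  rw [h2]
  refine lintegral_congr fun X' => ?_
  simp only [Pi.mul_apply]
  have hB : Measurable fun Y => ∫⁻ X, forwardDensity ε X' Y * backwardDensity ε (marginal μ) X Y
      * F (X', Y, X) ∂Measure.pi (marginal μ) :=
    Measurable.lintegral_prod_right' (f := fun q : Config N d × Config N d =>
      forwardDensity ε X' q.1 * backwardDensity ε (marginal μ) q.2 q.1 * F (X', q.1, q.2))
      (by fun_prop)
  rw [← lintegral_const_mul _ hB]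
  refine lintegral_congr fun Y => ?_
  have hC : Measurable fun X => forwardDensity ε X' Y * backwardDensity ε (marginal μ) X Y
      * F (X', Y, X) := by fun_prop
  rw [← lintegral_const_mul _ hC]
  exact lintegral_congr fun X => by ring

lemma integral_theta_sub_integral (hμ : μ ≪ volume) (hε : 0 < ε) {B : Config N d → ℝ}
    (hB : Measurable B) (hB1 : ∀ X, |B X| ≤ 1) :
    |∫ X, B X ∂theta ε μ - ∫ X, B X ∂μ|
      ≤ ∫ w, |couplingDensity μ w.1 - couplingDensity μ w.2.2|
        ∂tripleMeasure ε (marginal μ) (Measure.pi (marginal μ)) := by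
  have h1 : ∫ X, B X ∂theta ε μ = ∫ w, B w.2.2 ∂(tripleMeasure ε (marginal μ)
      (Measure.pi (marginal μ))).withDensity fun w => μ.rnDeriv (Measure.pi (marginal μ)) w.1 := by
    rw [← map_tripleMeasure_eq_theta, integral_map (by fun_prop) hB.aestronglyMeasurable,
      tripleMeasure_eq_withDensity_rnDeriv hμ]
  rw [h1]
  exact abs_integral_withDensity_sub_le (absolutelyContinuous_pi_marginal hμ)
    (measurePreserving_fst_tripleMeasure hε) (measurePreserving_target_tripleMeasure_pi hε) hB hB1

/-- Duality: test with the sign of the difference of the densities. -/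
lemma integral_abs_rnDeriv_sub_le {ν₁ ν₂ : Measure (Config N d)} [IsFiniteMeasure ν₁]
    [IsFiniteMeasure ν₂] (h₁ : ν₁ ≪ volume) (h₂ : ν₂ ≪ volume) {K : ℝ}
    (h : ∀ B : Config N d → ℝ, Measurable B → (∀ X, |B X| ≤ 1) →
      |∫ X, B X ∂ν₁ - ∫ X, B X ∂ν₂| ≤ K) :
    ∫ X, |(ν₁.rnDeriv volume X).toReal - (ν₂.rnDeriv volume X).toReal| ≤ K := by
  set a := fun X => (ν₁.rnDeriv volume X).toReal
  set b := fun X => (ν₂.rnDeriv volume X).toReal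
  have ha : Measurable a := (Measure.measurable_rnDeriv _ _).ennreal_toReal
  have hb : Measurable b := (Measure.measurable_rnDeriv _ _).ennreal_toReal
  have ia : Integrable a := Measure.integrable_toReal_rnDeriv
  have ib : Integrable b := Measure.integrable_toReal_rnDeriv
  set B : Config N d → ℝ := fun X => if b X ≤ a X then 1 else -1
  have hB : Measurable B := Measurable.ite (measurableSet_le hb ha) measurable_const measurable_const
  have hB1 : ∀ X, |B X| ≤ 1 := fun X => by
    by_cases hX : b X ≤ a X <;> simp [B, hX]
  refine le_trans (le_of_eq ?_) ((le_abs_self _).trans (h B hB hB1))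
  rw [← integral_rnDeriv_smul h₁, ← integral_rnDeriv_smul h₂]
  simp only [smul_eq_mul]
  have j1 : Integrable fun X => a X * B X :=
    ia.mul_bdd hB.aestronglyMeasurable (ae_of_all _ hB1)
  have j2 : Integrable fun X => b X * B X :=
    ib.mul_bdd hB.aestronglyMeasurable (ae_of_all _ hB1)
  refine Eq.trans ?_ (integral_sub j1 j2)
  refine integral_congr_ae (ae_of_all _ fun X => ?_)
  change |a X - b X| = a X * B X - b X * B X
  by_cases hX : b X ≤ a X
  · simp [B, hX]
  · simp only [B, hX, if_false]
    rw [abs_of_neg (by linarith)]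
    ring

/-- Subadditivity of `t ↦ t^{1/p}`, applied to `a = b + (a - b)` when `b ≤ a`. -/
lemma rpow_abs_sub_rpow_inv_le {p a b : ℝ} (hp : 1 ≤ p) (ha : 0 ≤ a) (hb : 0 ≤ b) :
    |a ^ (1 / p) - b ^ (1 / p)| ^ p ≤ |a - b| := by
  wlog hab : b ≤ a generalizing a b
  · rw [abs_sub_comm, abs_sub_comm a]
    exact this hb ha (le_of_not_ge hab)
  have hp0 : 0 < p := by linarith
  have h1 : b ^ (1 / p) ≤ a ^ (1 / p) := by gcongr
  have h2 : a ^ (1 / p) ≤ b ^ (1 / p) + (a - b) ^ (1 / p) := by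
    have := Real.rpow_add_le_add_rpow (p := 1 / p) hb (sub_nonneg.2 hab) (by positivity)
      (by rw [div_le_one hp0]; exact hp)
    simpa using this
  rw [abs_of_nonneg (sub_nonneg.2 h1), abs_of_nonneg (sub_nonneg.2 hab)]
  calc (a ^ (1 / p) - b ^ (1 / p)) ^ p ≤ ((a - b) ^ (1 / p)) ^ p := by
        refine Real.rpow_le_rpow (sub_nonneg.2 h1) (by linarith) hp0.le
    _ = a - b := by
        rw [← Real.rpow_mul (sub_nonneg.2 hab), one_div_mul_cancel hp0.ne', Real.rpow_one]

lemma eLpNorm_rootDensity_sub_rpow_le {ν₁ ν₂ : Measure (Config N d)} [IsFiniteMeasure ν₁]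
    [IsFiniteMeasure ν₂] {p : ℝ} (hp : 1 < p) :
    eLpNorm (fun X => rootDensity p ν₁ X - rootDensity p ν₂ X) (ENNReal.ofReal p) volume ^ p
      ≤ ENNReal.ofReal (∫ X, |(ν₁.rnDeriv volume X).toReal - (ν₂.rnDeriv volume X).toReal|) := by
  have hint : Integrable fun X => |(ν₁.rnDeriv volume X).toReal - (ν₂.rnDeriv volume X).toReal| :=
    (Measure.integrable_toReal_rnDeriv.sub Measure.integrable_toReal_rnDeriv).abs
  rw [eLpNorm_rpow_eq_lintegral (by linarith),
    ofReal_integral_eq_lintegral_ofReal hint (ae_of_all _ fun _ => abs_nonneg _)]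
  exact lintegral_mono fun X => ENNReal.ofReal_le_ofReal
    (rpow_abs_sub_rpow_inv_le hp.le ENNReal.toReal_nonneg ENNReal.toReal_nonneg)

lemma ofReal_integral_couplingDensity_sub (hε : 0 < ε) :
    ENNReal.ofReal (∫ w, |couplingDensity μ w.1 - couplingDensity μ w.2.2|
        ∂tripleMeasure ε (marginal μ) (Measure.pi (marginal μ)))
      = eLpNorm (fun w => couplingDensity μ w.1 - couplingDensity μ w.2.2) 1
        (tripleMeasure ε (marginal μ) (Measure.pi (marginal μ))) := by
  have i1 := (measurePreserving_fst_tripleMeasure (ρ := marginal μ)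
    hε).integrable_comp_of_integrable (integrable_couplingDensity (μ := μ))
  have i2 := (measurePreserving_target_tripleMeasure_pi (ρ := marginal μ)
    hε).integrable_comp_of_integrable (integrable_couplingDensity (μ := μ))
  have i3 : Integrable (fun w => |couplingDensity μ w.1 - couplingDensity μ w.2.2|)
    (tripleMeasure ε (marginal μ) (Measure.pi (marginal μ))) := (i1.sub i2).abs
  rw [eLpNorm_one_eq_lintegral_enorm, ofReal_integral_eq_lintegral_ofReal i3
    (ae_of_all _ fun _ => abs_nonneg _)]
  exact lintegral_congr fun w => by rw [← Real.norm_eq_abs, ofReal_norm]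

lemma eventually_isProbabilityMeasure_tripleMeasure
    {ρ : Fin N → Measure (EuclideanSpace ℝ (Fin d))} [∀ k, IsProbabilityMeasure (ρ k)]
    {ν : Measure (Config N d)} [IsProbabilityMeasure ν] :
    ∀ᶠ ε in 𝓝[>] (0 : ℝ), IsProbabilityMeasure (tripleMeasure ε ρ ν) := by
  filter_upwards [self_mem_nhdsWithin] with ε hε
  exact isProbabilityMeasure_tripleMeasure hε

lemma tendsto_eLpNorm_rootDensity_sub (hμ : μ ≪ volume) {p : ℝ} (hp : 1 < p) :
    Tendsto (fun ε => eLpNorm (fun X => rootDensity p (theta ε μ) X - rootDensity p μ X)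
      (ENNReal.ofReal p) volume) (𝓝[>] 0) (𝓝 0) := by
  refine tendsto_zero_of_rpow (p := p) (by linarith) (tendsto_zero_of_forall_le_add fun η hη => ?_)
  -- Tolerance `η / 2`, because `eLpNorm_comp_sub_comp_le` pays the approximation error at both `X'`
  -- and `X`.
  obtain ⟨g, hgc, hg, hgcont, -⟩ := (memLp_one_iff_integrable.2
    (integrable_couplingDensity (μ := μ))).exists_hasCompactSupport_eLpNorm_sub_le (by simp)
    (ENNReal.half_pos hη.ne').ne'
  have hlim := tendsto_eLpNorm_comp_sub_comp
    (X := fun w : Config N d × Config N d × Config N d => w.1)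
    (Y := fun w => w.2.2) (by fun_prop) (by fun_prop)
    (eventually_isProbabilityMeasure_tripleMeasure (ρ := marginal μ)
      (ν := Measure.pi (marginal μ)))
    (tendsto_lintegral_source_sub_target (marginal_pi _)) hgcont hgc one_pos
  refine ⟨_, hlim, ?_⟩
  filter_upwards [self_mem_nhdsWithin] with ε hε
  have := isProbabilityMeasure_theta (μ := μ) hε
  have hL1 := integral_abs_rnDeriv_sub_le (theta_absolutelyContinuous hμ ε) hμ fun B hB hB1 =>
    integral_theta_sub_integral hμ hε hB hB1
  refine (eLpNorm_rootDensity_sub_rpow_le hp).trans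
    ((ENNReal.ofReal_le_ofReal hL1).trans ?_)
  rw [ofReal_integral_couplingDensity_sub hε]
  refine (eLpNorm_comp_sub_comp_le (measurePreserving_fst_tripleMeasure hε)
    (measurePreserving_target_tripleMeasure_pi hε) measurable_couplingDensity
    hgcont.measurable le_rfl).trans ?_
  rw [ENNReal.ofReal_one]
  refine add_le_add ((mul_le_mul_right hg 2).trans_eq ?_) le_rfl
  rw [two_mul, ENNReal.add_halves]

end L1Convergence

/-! ### Convergence of the scores -/

section ConditionalMeanError

variable {Ω : Type*} {mΩ : MeasurableSpace Ω} {P : Measure Ω} [IsProbabilityMeasure P]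

/-- Subtracting the `m`-measurable `T` does not change `S - P[S | m]`; the triangle inequality and
contraction then give the factor `2`. So the conditional expectation is, up to this factor, a best
approximation in `L^p`. -/
lemma eLpNorm_sub_condExp_le {m : MeasurableSpace Ω} (hm : m ≤ mΩ) {S T : Ω → ℝ}
    (hS : Integrable S P) (hT : Integrable T P) (hTm : StronglyMeasurable[m] T) {p : ℝ≥0∞}
    (hp : 1 ≤ p) : eLpNorm (S - P[S | m]) p P ≤ 2 * eLpNorm (S - T) p P := by
  have h1 : S - P[S | m] =ᵐ[P] (S - T) - P[S - T | m] := by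
    have h2 := condExp_sub hS hT m
    rw [condExp_of_stronglyMeasurable hm hTm hT] at h2
    filter_upwards [h2] with w hw
    simp only [Pi.sub_apply] at hw ⊢
    rw [hw]
    ring
  rw [eLpNorm_congr_ae h1]
  refine (eLpNorm_sub_le (hS.sub hT).aestronglyMeasurable
    integrable_condExp.aestronglyMeasurable hp).trans ?_
  rw [two_mul]
  exact add_le_add le_rfl (eLpNorm_condExp_le_eLpNorm _ hp)

variable {d : ℕ} {ε : ℝ} {ρ : Measure (EuclideanSpace ℝ (Fin d))} [IsProbabilityMeasure ρ]
  {X Y : Ω → EuclideanSpace ℝ (Fin d)} {σ g : EuclideanSpace ℝ (Fin d) → ℝ}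

lemma eLpNorm_sub_backwardMean_le (hX : Measurable X) (hY : Measurable Y) (hε : 0 < ε)
    (hXY : P.map (fun w => (X w, Y w)) = gaussianCoupling ε ρ)
    (hσm : Measurable σ) (hσ : Integrable σ ρ) (hg : Measurable g) (hC : ∃ C, ∀ x, |g x| ≤ C)
    {p : ℝ≥0∞} (hp : 1 ≤ p) :
    eLpNorm (fun w => σ (X w) - backwardMean ε ρ σ (Y w)) p P
      ≤ 2 * (eLpNorm (σ - g) p ρ + eLpNorm (fun w => g (X w) - g (Y w)) p P) := by
  obtain ⟨C, hC⟩ := hC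
  have hmp : MeasurePreserving (fun w => (X w, Y w)) P (gaussianCoupling ε ρ) :=
    ⟨hX.prodMk hY, hXY⟩
  have hmX : MeasurePreserving X P ρ :=
    (show MeasurePreserving Prod.fst (gaussianCoupling ε ρ) ρ from
      ⟨measurable_fst, map_fst_gaussianCoupling hε⟩).comp hmp
  have hσX : Integrable (fun w => σ (X w)) P := hmX.integrable_comp_of_integrable hσ
  have hgY : Integrable (fun w => g (Y w)) P :=
    Integrable.of_bound (hg.comp hY).aestronglyMeasurable C (ae_of_all _ fun w => hC _)
  have h1 := backwardMean_ae_eq_condExp hX hY hε hXY hσm hσ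
  have h2 : (fun w => σ (X w) - backwardMean ε ρ σ (Y w)) =ᵐ[P]
      (fun w => σ (X w)) - P[fun w => σ (X w) | MeasurableSpace.comap Y inferInstance] := by
    filter_upwards [h1] with w hw
    rw [Pi.sub_apply, ← hw]
  rw [eLpNorm_congr_ae h2]
  refine (eLpNorm_sub_condExp_le hY.comap_le hσX hgY
    (hg.comp (comap_measurable Y)).stronglyMeasurable hp).trans ?_
  have hσg : AEStronglyMeasurable (σ - g) ρ := (hσm.sub hg).aestronglyMeasurable
  have n1 : eLpNorm (fun w => (σ - g) (X w)) p P = eLpNorm (σ - g) p ρ :=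
    eLpNorm_comp_measurePreserving hσg hmX
  have e : ((fun w => σ (X w)) - fun w => g (Y w))
      = (fun w => (σ - g) (X w)) + fun w => g (X w) - g (Y w) := by
    funext w
    simp only [Pi.sub_apply, Pi.add_apply]
    ring
  rw [e, ← n1]
  refine mul_le_mul_right (eLpNorm_add_le (hσg.comp_measurePreserving hmX) ?_ hp) 2
  exact ((hg.comp hX).sub (hg.comp hY)).aestronglyMeasurable

end ConditionalMeanError

section ScoreConvergence

variable {N d : ℕ} {μ : Measure (Config N d)} [IsProbabilityMeasure μ]

/-- For `g ∈ C_c` near `σ`, the function `g(Y_k)` is a competitor for the conditional mean. The law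
of `X_k` does not depend on `ε`, so the error `σ - g` is uniform in `ε`. -/
lemma tendsto_eLpNorm_sub_backwardMean {k : Fin N} {p : ℝ} (hp : 1 < p)
    {σ : EuclideanSpace ℝ (Fin d) → ℝ} (hσm : Measurable σ)
    (hσ : MemLp σ (ENNReal.ofReal p) (marginal μ k)) :
    Tendsto (fun ε => eLpNorm (fun w => σ (w.2.2 k) - backwardMean ε (marginal μ k) σ (w.2.1 k))
      (ENNReal.ofReal p) (tripleMeasure ε (marginal μ) μ)) (𝓝[>] 0) (𝓝 0) := by
  have hp1 : 1 ≤ ENNReal.ofReal p := by simpa using hp.le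
  refine tendsto_zero_of_forall_le_add fun η hη => ?_
  obtain ⟨g, hgc, hg, hgcont, -⟩ := hσ.exists_hasCompactSupport_eLpNorm_sub_le (by simp)
    (ENNReal.half_pos hη.ne').ne'
  have hlim := tendsto_eLpNorm_comp_sub_comp
    (X := fun w : Config N d × Config N d × Config N d => w.2.2 k)
    (Y := fun w => w.2.1 k) (by fun_prop) (by fun_prop)
    (eventually_isProbabilityMeasure_tripleMeasure (ρ := marginal μ) (ν := μ))
    (tendsto_lintegral_target_sub rfl) hgcont hgc (p := p) (by linarith)
  have hlim2 := ENNReal.Tendsto.const_mul (a := 2) hlim (Or.inr (by simp))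
  rw [mul_zero] at hlim2
  refine ⟨_, hlim2, ?_⟩
  filter_upwards [self_mem_nhdsWithin] with ε hε
  have := isProbabilityMeasure_tripleMeasure (ρ := marginal μ) (ν := μ) hε
  refine (eLpNorm_sub_backwardMean_le (P := tripleMeasure ε (marginal μ) μ)
    (X := fun w => w.2.2 k) (Y := fun w => w.2.1 k) (by fun_prop) (by fun_prop) hε
    (map_target_tripleMeasure hε rfl) hσm (hσ.integrable hp1) hgcont.measurable
    (by simpa using hgc.exists_bound_of_continuous hgcont) hp1).trans ?_
  rw [mul_add]
  refine add_le_add ((mul_le_mul_right hg 2).trans_eq ?_) le_rfl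
  rw [two_mul, ENNReal.add_halves]

lemma eLpNorm_tripleScore_sub_le {ε : ℝ} (hε : 0 < ε) {k : Fin N} {p : ℝ≥0∞} (hp : 1 ≤ p)
    {s g : Config N d → ℝ} (hs : Measurable s) (hg : Measurable g)
    {σ : EuclideanSpace ℝ (Fin d) → ℝ} (hσ : Measurable σ) :
    eLpNorm (fun w => tripleScore ε μ k s σ w - g w.2.2) p (tripleMeasure ε (marginal μ) μ)
      ≤ eLpNorm (s - g) p μ + (eLpNorm (fun w => g w.1 - g w.2.2) p (tripleMeasure ε (marginal μ) μ)
        + eLpNorm (fun w => σ (w.2.2 k) - backwardMean ε (marginal μ k) σ (w.2.1 k)) p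
          (tripleMeasure ε (marginal μ) μ)) := by
  have m1 := measurePreserving_fst_tripleMeasure (ρ := marginal μ) (ν := μ) hε
  have hsg : AEStronglyMeasurable (s - g) μ := (hs.sub hg).aestronglyMeasurable
  have n1 : eLpNorm (fun w => (s - g) w.1) p (tripleMeasure ε (marginal μ) μ)
      = eLpNorm (s - g) p μ := eLpNorm_comp_measurePreserving hsg m1
  have e : (fun w => tripleScore ε μ k s σ w - g w.2.2) = (fun w => (s - g) w.1)
      + ((fun w => g w.1 - g w.2.2)
        + fun w => σ (w.2.2 k) - backwardMean ε (marginal μ k) σ (w.2.1 k)) := by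
    funext w
    simp only [tripleScore, Pi.sub_apply, Pi.add_apply]
    ring
  have hb := measurable_backwardMean (ε := ε) (ρ := marginal μ k) hσ
  have a2 : Measurable fun w : Config N d × Config N d × Config N d => g w.1 - g w.2.2 :=
    (hg.comp measurable_fst).sub (hg.comp (by fun_prop))
  have a3 : Measurable fun w : Config N d × Config N d × Config N d =>
      σ (w.2.2 k) - backwardMean ε (marginal μ k) σ (w.2.1 k) :=
    (hσ.comp (by fun_prop)).sub (hb.comp (by fun_prop))
  rw [e, ← n1]
  exact (eLpNorm_add_le (hsg.comp_measurePreserving m1) (a2.add a3).aestronglyMeasurable hp).trans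
    (add_le_add le_rfl (eLpNorm_add_le a2.aestronglyMeasurable a3.aestronglyMeasurable hp))

/-- The two scores live in different spaces `L^p(ν₁)` and `L^p(ν₂)`; a bounded `g` serves as
intermediary, and exchanging the root densities against it costs only its bound. -/
lemma eLpNorm_rootDensity_mul_sub_le {ν₁ ν₂ : Measure (Config N d)} [IsFiniteMeasure ν₁]
    [IsFiniteMeasure ν₂] (h₁ : ν₁ ≪ volume) (h₂ : ν₂ ≪ volume) {p : ℝ} (hp : 1 < p)
    {s₁ s₂ g : Config N d → ℝ} (hs₁ : Measurable s₁) (hs₂ : Measurable s₂) (hg : Measurable g)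
    {C : ℝ} (hC : ∀ X, |g X| ≤ C) :
    eLpNorm (fun X => rootDensity p ν₁ X * s₁ X - rootDensity p ν₂ X * s₂ X)
        (ENNReal.ofReal p) volume
      ≤ eLpNorm (fun X => s₁ X - g X) (ENNReal.ofReal p) ν₁ +
        (ENNReal.ofReal C * eLpNorm (fun X => rootDensity p ν₁ X - rootDensity p ν₂ X)
          (ENNReal.ofReal p) volume + eLpNorm (s₂ - g) (ENNReal.ofReal p) ν₂) := by
  have hp1 : 1 ≤ ENNReal.ofReal p := by simpa using hp.le
  have hr₁ := measurable_rootDensity (p := p) (ν := ν₁)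
  have hr₂ := measurable_rootDensity (p := p) (ν := ν₂)
  have d1 : Measurable fun X => s₁ X - g X := hs₁.sub hg
  have d2 : Measurable (s₂ - g) := hs₂.sub hg
  have a1 : Measurable fun X => rootDensity p ν₁ X * (s₁ X - g X) := hr₁.mul d1
  have a2 : Measurable fun X => g X * (rootDensity p ν₁ X - rootDensity p ν₂ X) :=
    hg.mul (hr₁.sub hr₂)
  have a3 : Measurable fun X => rootDensity p ν₂ X * (s₂ - g) X := hr₂.mul d2
  have e : (fun X => rootDensity p ν₁ X * s₁ X - rootDensity p ν₂ X * s₂ X)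
      = (fun X => rootDensity p ν₁ X * (s₁ X - g X))
        + ((fun X => g X * (rootDensity p ν₁ X - rootDensity p ν₂ X))
          - fun X => rootDensity p ν₂ X * (s₂ - g) X) := by
    funext X
    simp only [Pi.sub_apply, Pi.add_apply]
    ring
  rw [← eLpNorm_rootDensity_mul hp h₁ d1.aemeasurable, ← eLpNorm_rootDensity_mul hp h₂
    d2.aemeasurable, e]
  refine (eLpNorm_add_le a1.aestronglyMeasurable (a2.sub a3).aestronglyMeasurable hp1).trans
    (add_le_add le_rfl ((eLpNorm_sub_le a2.aestronglyMeasurable a3.aestronglyMeasurable hp1).trans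
      (add_le_add ?_ le_rfl)))
  refine eLpNorm_le_mul_eLpNorm_of_ae_le_mul (ae_of_all _ fun X => ?_) _
  rw [norm_mul]
  exact mul_le_mul_of_nonneg_right (hC X) (norm_nonneg _)

lemma tendsto_eLpNorm_rootDensity_mul_sub (hμ : μ ≪ volume) {p : ℝ} (hp : 1 < p) {k : Fin N}
    {s : Config N d → ℝ} (hs : Measurable s) (hsp : MemLp s (ENNReal.ofReal p) μ)
    {σ : EuclideanSpace ℝ (Fin d) → ℝ} (hσm : Measurable σ)
    (hσ : MemLp σ (ENNReal.ofReal p) (marginal μ k)) {h : ℝ → Config N d → ℝ}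
    (hm : ∀ ε, 0 < ε → Measurable (h ε))
    (hh : ∀ ε, 0 < ε → ∀ q : ℝ≥0∞, 1 ≤ q → ∀ g : Config N d → ℝ, Measurable g →
      (∃ C, ∀ X, |g X| ≤ C) → eLpNorm (fun X => h ε X - g X) q (theta ε μ)
        ≤ eLpNorm (fun w => tripleScore ε μ k s σ w - g w.2.2) q
          (tripleMeasure ε (marginal μ) μ)) :
    Tendsto (fun ε => eLpNorm (fun X => rootDensity p (theta ε μ) X * h ε X
      - rootDensity p μ X * s X) (ENNReal.ofReal p) volume) (𝓝[>] 0) (𝓝 0) := by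
  have hp1 : 1 ≤ ENNReal.ofReal p := by simpa using hp.le
  refine tendsto_zero_of_forall_le_add fun η hη => ?_
  obtain ⟨g, hgc, hg, hgcont, -⟩ := hsp.exists_hasCompactSupport_eLpNorm_sub_le (by simp)
    (ENNReal.half_pos hη.ne').ne'
  obtain ⟨C, hC⟩ : ∃ C, ∀ X, |g X| ≤ C := by simpa using hgc.exists_bound_of_continuous hgcont
  have l1 := tendsto_eLpNorm_comp_sub_comp
    (X := fun w : Config N d × Config N d × Config N d => w.1)
    (Y := fun w => w.2.2) (by fun_prop) (by fun_prop)
    (eventually_isProbabilityMeasure_tripleMeasure (ρ := marginal μ) (ν := μ))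
    (tendsto_lintegral_source_sub_target fun _ => rfl) hgcont hgc (p := p) (by linarith)
  have l2 := tendsto_eLpNorm_sub_backwardMean hp hσm hσ
  have l3 := ENNReal.Tendsto.const_mul (a := ENNReal.ofReal C)
    (tendsto_eLpNorm_rootDensity_sub hμ hp) (Or.inr ENNReal.ofReal_ne_top)
  have l4 := (l1.add l2).add l3
  rw [mul_zero, add_zero, add_zero] at l4
  refine ⟨_, l4, ?_⟩
  filter_upwards [self_mem_nhdsWithin] with ε hε
  have := isProbabilityMeasure_theta (μ := μ) hε
  have b1 := eLpNorm_rootDensity_mul_sub_le (theta_absolutelyContinuous hμ ε) hμ hp (hm ε hε) hs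
    hgcont.measurable hC
  have b2 := (hh ε hε _ hp1 g hgcont.measurable ⟨C, hC⟩).trans
    (eLpNorm_tripleScore_sub_le hε hp1 hs hgcont.measurable hσm)
  -- The error `s - g` enters twice, through the score of the smoothed measure and through that of
  -- `μ`, each time at most `η / 2`.
  refine b1.trans ((add_le_add b2 (add_le_add le_rfl hg)).trans ?_)
  refine (add_le_add (add_le_add hg le_rfl) le_rfl).trans (le_of_eq ?_)
  conv_rhs => rw [← ENNReal.add_halves η]
  ring

end ScoreConvergence

/-! ### Conclusion -/

variable {N d : ℕ}

lemma HasWeakPartialDeriv.sub {k : Fin N} {i : Fin d} {u₁ u₂ v₁ v₂ : Config N d → ℝ}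
    (h₁ : HasWeakPartialDeriv k i u₁ v₁) (h₂ : HasWeakPartialDeriv k i u₂ v₂) :
    HasWeakPartialDeriv k i (fun X => u₁ X - u₂ X) fun X => v₁ X - v₂ X := by
  refine ⟨h₁.1.sub h₂.1, h₁.2.1.sub h₂.2.1, fun φ hφ hc => ?_⟩
  have hi : ∀ {w c : Config N d → ℝ}, LocallyIntegrable w volume → Continuous c →
      HasCompactSupport c → Integrable (fun X => w X * c X) := fun hw hc hcs => by
    simpa [mul_comm] using hw.integrable_smul_right_of_hasCompactSupport hc hcs
  have hc' : Continuous fun X => fderiv ℝ φ X (coordVec k i) :=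
    (hφ.continuous_fderiv (by simp)).clm_apply continuous_const
  have hcs' : HasCompactSupport fun X => fderiv ℝ φ X (coordVec k i) := hc.fderiv_apply ℝ _
  simp only [sub_mul]
  rw [integral_sub (hi h₁.1 hc' hcs') (hi h₂.1 hc' hcs'),
    integral_sub (hi h₁.2.1 hφ.continuous hc) (hi h₂.2.1 hφ.continuous hc),
    h₁.2.2 φ hφ hc, h₂.2.2 φ hφ hc]
  ring

lemma exists_score_theta {p : ℝ} (hp : 1 < p) {μ : Measure (Config N d)}
    (hμ : IsW1pRegular p μ) (k : Fin N) (i : Fin d) :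
    ∃ (s : Config N d → ℝ) (h : ℝ → Config N d → ℝ), Measurable s ∧
      MemLp s (ENNReal.ofReal p) μ ∧ IsScore μ (coordVec k i) s ∧
      (∀ ε, 0 < ε → Measurable (h ε) ∧ MemLp (h ε) (ENNReal.ofReal p) (theta ε μ) ∧
        IsScore (theta ε μ) (coordVec k i) (h ε)) ∧
      Tendsto (fun ε => eLpNorm (fun X => rootDensity p (theta ε μ) X * h ε X
        - rootDensity p μ X * s X) (ENNReal.ofReal p) volume) (𝓝[>] 0) (𝓝 0) := by
  have := hμ.isProbabilityMeasure
  have hp1 : 1 ≤ ENNReal.ofReal p := by simpa using hp.le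
  obtain ⟨s, hsm, hsp, hs⟩ := hμ.exists_isScore hp k i
  obtain ⟨σ, hσm, hσp, hσ⟩ := exists_isScore_marginal hs hp1 hsp
  choose! h hm hsc hle using fun (ε : ℝ) (hε : 0 < ε) => exists_isScore_theta hε hs hσm hσ
  refine ⟨s, h, hsm, hsp, hs, fun ε hε => ⟨hm ε hε, ⟨(hm ε hε).aestronglyMeasurable, ?_⟩,
    hsc ε hε⟩, tendsto_eLpNorm_rootDensity_mul_sub hμ.absolutelyContinuous hp hsm hsp hσm hσp hm hle⟩
  have h0 := hle ε hε (ENNReal.ofReal p) hp1 (fun _ => 0) measurable_const ⟨0, by simp⟩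
  simp only [sub_zero] at h0
  exact h0.trans_lt (memLp_tripleScore hε hp1 hsp hσm hσp).2

theorem isW1pRegular_theta_and_tendsto {p : ℝ} (hp : 1 < p) {μ : Measure (Config N d)}
    (hμ : IsW1pRegular p μ) :
    (∀ ε : ℝ, 0 < ε → IsW1pRegular p (theta ε μ)) ∧
      Tendsto (fun ε : ℝ => d1p p (theta ε μ) μ) (𝓝[>] 0) (𝓝 0) := by
  have := hμ.isProbabilityMeasure
  have hp0 : 0 < p := by linarith
  choose s h hsm hsp hs hh hlim using exists_score_theta hp hμ
  have hac := hμ.absolutelyContinuous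
  refine ⟨fun ε hε => ?_, ?_⟩
  · have := isProbabilityMeasure_theta (μ := μ) hε
    exact isW1pRegular_of_isScore hp (theta_absolutelyContinuous hac ε)
      (fun k i => (hh k i ε hε).1) (fun k i => (hh k i ε hε).2.1) fun k i => (hh k i ε hε).2.2
  have hpow : ∀ {f : ℝ → ℝ≥0∞} {q : ℝ}, 0 < q → Tendsto f (𝓝[>] 0) (𝓝 0) →
      Tendsto (fun ε => f ε ^ q) (𝓝[>] 0) (𝓝 0) := fun {_ q} hq hf => by
    simpa [ENNReal.zero_rpow_of_pos hq] using hf.ennrpow_const q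
  have hgrad : ∀ k i, Tendsto (fun ε => eLpNorm (fun X => 1 / p * (rootDensity p (theta ε μ) X
      * h k i ε X) - 1 / p * (rootDensity p μ X * s k i X)) (ENNReal.ofReal p) volume ^ p)
      (𝓝[>] 0) (𝓝 0) := fun k i => by
    refine hpow hp0 ?_
    have e : ∀ ε, eLpNorm (fun X => 1 / p * (rootDensity p (theta ε μ) X * h k i ε X)
        - 1 / p * (rootDensity p μ X * s k i X)) (ENNReal.ofReal p) volume
        = ‖1 / p‖ₑ * eLpNorm (fun X => rootDensity p (theta ε μ) X * h k i ε X
          - rootDensity p μ X * s k i X) (ENNReal.ofReal p) volume := fun ε => by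
      rw [← eLpNorm_const_smul]
      congr 1
      funext X
      simp only [Pi.smul_apply, smul_eq_mul]
      ring
    simp only [e]
    simpa using ENNReal.Tendsto.const_mul (hlim k i) (Or.inr enorm_ne_top)
  have hsum := (hpow hp0 (tendsto_eLpNorm_rootDensity_sub hac hp)).add
    (tendsto_finsetSum Finset.univ fun k _ => tendsto_finsetSum Finset.univ fun i _ => hgrad k i)
  simp only [Finset.sum_const_zero, add_zero] at hsum
  refine tendsto_of_tendsto_of_tendsto_of_le_of_le' tendsto_const_nhds
    (hpow (q := 1 / p) (by positivity) hsum) (Eventually.of_forall fun _ => zero_le) ?_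
  filter_upwards [self_mem_nhdsWithin] with ε hε
  have := isProbabilityMeasure_theta (μ := μ) hε
  -- The norm is an infimum over weak gradients, so this explicit one bounds it from above.
  refine iInf₂_le (fun k i X => 1 / p * (rootDensity p (theta ε μ) X * h k i ε X)
    - 1 / p * (rootDensity p μ X * s k i X)) fun k i => ?_
  exact HasWeakPartialDeriv.sub
    ((hh k i ε hε).2.2.hasWeakLineDeriv_rootDensity hp (theta_absolutelyContinuous hac ε)
      (hh k i ε hε).1 (hh k i ε hε).2.1)
    ((hs k i).hasWeakLineDeriv_rootDensity hp hac (hsm k i) (hsp k i))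

end RegularPlan

end

theorem mainTheorem7 (N d : ℕ) (p : ℝ) (hp : 1 < p)
    (μ : MeasureTheory.Measure (RegularPlan.Config N d)) (hμ : RegularPlan.IsW1pRegular p μ) :
    (∀ ε : ℝ, 0 < ε → RegularPlan.IsW1pRegular p (RegularPlan.theta ε μ)) ∧
      Tendsto (fun ε : ℝ => RegularPlan.d1p p (RegularPlan.theta ε μ) μ) (𝓝[>] 0) (𝓝 0) :=
  RegularPlan.isW1pRegular_theta_and_tendsto hp hμ
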